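/- Notation. In a Maker-Breaker game with a finite board $X$ and a family $\mathcal F \subseteq 2^X$ of winning sets, two players, Maker and Breaker, alternately claim one unclaimed element of $X$ at a time until all elements are claimed; Maker wins if he has claimed all elements of some set in $\mathcal F$, otherwise Breaker wins. In the Hamiltonicity game on a graph $G$, the board is $E(G)$ and the winning sets are the edge sets of the Hamiltonian cycles of $G$. In the Fixed Hamiltonian Path game on a graph $H$ with two fixed vertices $u, v$, the board is $E(H)$ and the winning sets are the edge sets of the Hamiltonian paths of $H$ with endpoints $u$ and $v$. Let $\hat m(n)$ be the smallest number of edges of a graph on $n$ vertices on whose edge set Maker, moving first, has a winning strategy in the Hamiltonicity game. Theorem. For every $n \ge 336$ we have $\hat m(n) \le 4n$. More precisely, write $n = 7m + r$ with $0 \le r < 7$. There are a partition of a set of $n$ vertices into $V_0, \dots, V_{m-1}$ with $|V_i| = 8$ for $i < r$ and $|V_i| = 7$ for $r \le i < m$, and vertices $a_i \in V_i$, such that the following holds, where indices are read modulo $m$ and $W_i = \{a_{i-1}\} \cup V_i$. Let $G_n$ be the graph on these $n$ vertices in which two distinct vertices $x, y$ are adjacent if and only if there is an $i$ with $x, y \in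 W_i$ and $\{x, y\} \ne \{a_{i-1}, a_i\}$ (a cycle of cliques, in which consecutive cliques share a vertex and each clique lacks the edge between its two shared vertices). Then: 1. each $W_i$ has $8$ or $9$ vertices, and $G_n$ has at most $4n$ edges; 2. for every $i$, Maker, moving second, wins the Fixed Hamiltonian Path game on $G_n[W_i]$ with fixed vertices $a_{i-1}$ and $a_i$; 3. Maker, moving first on the board $E(G_n)$, can win all these Fixed Hamiltonian Path games in parallel: he can ensure that at the end his edges contain, for every $i$, a Hamiltonian path of $G_n[W_i]$ with endpoints $a_{i-1}$ and $a_i$; 4. Maker, moving first, wins the Hamiltonicity game on $E(G_n)$. -/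

import Mathlib

/-- The two players of a Maker-Breaker positional game. -/
inductive Player
  | maker
  | breaker

/-- `MakerWins F p U M` says that Maker has a winning strategy in the Maker-Breaker game with family
of winning sets `F`, from the position in which player `p` is to move, `U` is the set of unclaimed
elements of the board and `M` is the set of elements that Maker has claimed so far.
The players alternately claim one unclaimed element at a time until all of the elements are
claimed, and Maker wins if he has then claimed all elements of some winning set.
A derivation is a (finite) strategy tree for Maker: he names one move at each of his turns, and
answers every possible move of Breaker. -/
inductive MakerWins {α : Type*} [DecidableEq α] (F : Set (Finset α)) :
    Player → Finset α → Finset α → Prop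
  | game_over (p : Player) (M A : Finset α) (hA : A ∈ F) (hAM : A ⊆ M) : MakerWins F p ∅ M
  | maker_move (U M : Finset α) (x : α) (hx : x ∈ U)
      (h : MakerWins F Player.breaker (U.erase x) (insert x M)) : MakerWins F Player.maker U M
  | breaker_move (U M : Finset α) (hU : U.Nonempty)
      (h : ∀ x ∈ U, MakerWins F Player.maker (U.erase x) M) : MakerWins F Player.breaker U M

/-- Maker wins the positional game `(X, F)` as first player. -/
def MakerWinsFirst {α : Type*} [DecidableEq α] (X : Finset α) (F : Set (Finset α)) : Prop :=
  MakerWins F Player.maker X ∅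

/-- Maker wins the positional game `(X, F)` as second player. -/
def MakerWinsSecond {α : Type*} [DecidableEq α] (X : Finset α) (F : Set (Finset α)) : Prop :=
  MakerWins F Player.breaker X ∅

section Games

variable {V : Type*} [Fintype V] [DecidableEq V]

/-- The edge set `E(G)`, as a finite board. -/
noncomputable def edgeBoard (G : SimpleGraph V) : Finset (Sym2 V) :=
  (Set.toFinite G.edgeSet).toFinset

/-- The board `E_G(W)`: the edges of `G` with both endpoints in `W`, that is, the edges of `G[W]`. -/
noncomputable def edgeBoardOn (G : SimpleGraph V) (W : Finset V) : Finset (Sym2 V) :=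
  (Set.toFinite {e : Sym2 V | e ∈ G.edgeSet ∧ ∀ v ∈ e, v ∈ W}).toFinset

/-- The edge sets of all Hamiltonian cycles of `G`: the winning sets of the Hamiltonicity game. -/
def hamCycleSets (G : SimpleGraph V) : Set (Finset (Sym2 V)) :=
  {A | ∃ (v : V) (p : G.Walk v v), p.IsHamiltonianCycle ∧ p.edges.toFinset = A}

/-- The edge sets of all Hamiltonian paths of `G[W]` with endpoints `u` and `v`: the winning sets
of the Fixed Hamiltonian Path game on `G[W]`. -/
def fixedHamPathSets (G : SimpleGraph V) (W : Finset V) (u v : V) : Set (Finset (Sym2 V)) :=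
  {A | ∃ p : G.Walk u v, p.IsPath ∧ p.support.toFinset = W ∧ p.edges.toFinset = A}

/-- Maker, as first player, wins the Hamiltonicity game played on the edges of `G`. -/
def MakerWinsHam (G : SimpleGraph V) : Prop :=
  MakerWinsFirst (edgeBoard G) (hamCycleSets G)

end Games

/-- `mHat n` is the smallest number of edges of a graph on `n` vertices on whose edges Maker, as
first player, wins the Hamiltonicity game. -/
noncomputable def mHat (n : ℕ) : ℕ :=
  sInf {k | ∃ G : SimpleGraph (Fin n), MakerWinsHam G ∧ G.edgeSet.ncard = k}

/-- The data of a cycle of cliques on `n = 7 m + r` vertices, where `m = n / 7` and `r = n % 7`: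
a partition of the vertices into `V 0, …, V (m - 1)`, the first `r` of size `8` and the others of
size `7`, and a vertex `a i` in every `V i`. Indices are read modulo `m`. -/
structure CliqueCycle (n : ℕ) where
  /-- The parts of the vertex partition. -/
  V : ZMod (n / 7) → Finset (Fin n)
  /-- The chosen vertices, one in every part. -/
  a : ZMod (n / 7) → Fin n
  disjoint : ∀ i j, i ≠ j → Disjoint (V i) (V j)
  cover : ∀ v, ∃ i, v ∈ V i
  card_V : ∀ i, (V i).card = if i.val < n % 7 then 8 else 7
  a_mem : ∀ i, a i ∈ V i

namespace CliqueCycle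

variable {n : ℕ} (C : CliqueCycle n)

/-- The vertex set of the `i`-th clique; it shares `a (i - 1)` with the previous clique and `a i`
with the next one. -/
def W (i : ZMod (n / 7)) : Finset (Fin n) := insert (C.a (i - 1)) (C.V i)

/-- The union of the cliques on the sets `W i`, where the `i`-th clique lacks the edge between its
two shared vertices `a (i - 1)` and `a i`. -/
def graph : SimpleGraph (Fin n) where
  Adj u v := u ≠ v ∧ ∃ i, u ∈ C.W i ∧ v ∈ C.W i ∧ s(u, v) ≠ s(C.a (i - 1), C.a i)
  symm := ⟨by
    rintro u v ⟨h, i, hu, hv, he⟩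
    exact ⟨h.symm, i, hv, hu, by rwa [Sym2.eq_swap]⟩⟩
  loopless := ⟨fun _ h => h.1 rfl⟩

/-- The sets of edges that contain, for every `i`, a Hamiltonian path of the `i`-th clique between
its two shared vertices: Maker's goal when he plays all Fixed Hamiltonian Path games in parallel. -/
def parallelSets : Set (Finset (Sym2 (Fin n))) :=
  {A | ∀ i, ∃ B ∈ fixedHamPathSets C.graph (C.W i) (C.a (i - 1)) (C.a i), B ⊆ A}

end CliqueCycle

/-!
Maker plays a Fixed Hamiltonian Path game in every clique. The boards are disjoint, so he wins all
of these games at once by replying in the clique in which Breaker has just moved, and the paths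
between consecutive shared vertices join up to a Hamiltonian cycle.

In a clique of order `9` without the edge `uv`, Maker answers Breaker's first edge with an edge `vx`
and is left with the game between `u` and `x` in a clique of order `8` from which, besides `ux`, at
most the edge of Breaker is missing, and `x` can be chosen such that these two edges are disjoint or
equal. For order `8` it therefore suffices to let Maker, as second player, win without the two
disjoint edges `uv` and `xy`. This is a finite check with two reductions: positions that differ only
by a relabelling of the vertices that preserves `{u, v}` are identified, and positions that Maker
wins when he is to move are merged into one that he wins when Breaker is to move, provided that no
single edge spoils all of them.
-/

namespace MakerWins

variable {α : Type*} [DecidableEq α] {F F' : Set (Finset α)} {p : Player} {U U' M M' : Finset α}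

theorem of_subset {A : Finset α} (hA : A ∈ F) (hAM : A ⊆ M) : MakerWins F p U M := by
  induction U using Finset.strongInduction generalizing p M with
  | H U ih =>
    rcases U.eq_empty_or_nonempty with rfl | ⟨x, hx⟩
    · exact .game_over p M A hA hAM
    · cases p with
      | maker =>
        exact .maker_move U M x hx
          (ih _ (Finset.erase_ssubset hx) (hAM.trans (Finset.subset_insert _ _)))
      | breaker => exact .breaker_move U M ⟨x, hx⟩ fun y hy => ih _ (Finset.erase_ssubset hy) hAM

theorem empty_iff : MakerWins F p ∅ M ↔ ∃ A ∈ F, A ⊆ M := by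
  refine ⟨fun h => ?_, fun ⟨A, hA, hAM⟩ => of_subset hA hAM⟩
  generalize hU : (∅ : Finset α) = U at h
  cases h with
  | game_over _ _ A hA hAM => exact ⟨A, hA, hAM⟩
  | maker_move _ _ x hx => simp [← hU] at hx
  | breaker_move _ _ hne => simp [← hU] at hne

theorem maker_of_mem (h : MakerWins F .breaker U M) {x : α} (hx : x ∈ U) :
    MakerWins F .maker (U.erase x) M := by
  cases h with
  | game_over => simp at hx
  | breaker_move _ _ _ hall => exact hall x hx

theorem breaker_or_exists_move (h : MakerWins F .maker U M) :
    MakerWins F .breaker U M ∨ ∃ x ∈ U, MakerWins F .breaker (U.erase x) (insert x M) := by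
  cases h with
  | game_over _ _ A hA hAM => exact .inl (of_subset hA hAM)
  | maker_move _ _ x hx h => exact .inr ⟨x, hx, h⟩

theorem mono_or_maker (h : MakerWins F p U M) {p' : Player} (hp : p' = p ∨ p' = .maker)
    (hU : U ⊆ U' ∪ M') (hM : M ⊆ M') : MakerWins F p' U' M' := by
  induction h generalizing p' U' M' with
  | game_over _ _ A hA hAM => exact of_subset hA (hAM.trans hM)
  | maker_move U M x hx _ ih =>
    obtain rfl : p' = .maker := hp.elim id id
    by_cases hxM : x ∈ M'
    · exact ih (.inr rfl) ((Finset.erase_subset _ _).trans hU) (Finset.insert_subset hxM hM)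
    · have hxU : x ∈ U' := (Finset.mem_union.1 (hU hx)).resolve_right hxM
      exact .maker_move _ _ x hxU
        (ih (.inl rfl) (by grind) (Finset.insert_subset_insert _ hM))
  | breaker_move U M hne _ ih =>
    obtain ⟨y, hy⟩ := hne
    have hmaker : MakerWins F .maker U' M' :=
      ih y hy (.inl rfl) ((Finset.erase_subset _ _).trans hU) hM
    rcases hp with rfl | rfl
    · rcases U'.eq_empty_or_nonempty with rfl | hU'
      · exact empty_iff.2 (empty_iff.1 hmaker)
      · refine .breaker_move _ _ hU' fun x _ => ?_
        by_cases hxU : x ∈ U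
        · exact ih x hxU (.inl rfl) (by grind) hM
        · exact ih y hy (.inl rfl) (by grind) hM
    · exact hmaker

theorem mono (h : MakerWins F p U M) (hU : U ⊆ U' ∪ M') (hM : M ⊆ M') : MakerWins F p U' M' :=
  h.mono_or_maker (.inl rfl) hU hM

theorem maker_of_breaker (h : MakerWins F .breaker U M) : MakerWins F .maker U M :=
  h.mono_or_maker (.inr rfl) Finset.subset_union_left subset_rfl

theorem mono_family (h : MakerWins F p U M)
    (hF : ∀ A ∈ F, A ⊆ U ∪ M → ∃ B ∈ F', B ⊆ A ∪ M) : MakerWins F' p U M := by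
  induction h with
  | game_over p M A hA hAM =>
    obtain ⟨B, hB, hBA⟩ := hF A hA (by simpa using hAM)
    exact .game_over p M B hB (hBA.trans (Finset.union_subset hAM subset_rfl))
  | maker_move U M x hx _ ih =>
    refine .maker_move U M x hx (ih fun A hA hAU => ?_)
    obtain ⟨B, hB, hBA⟩ := hF A hA (by grind)
    exact ⟨B, hB, hBA.trans (Finset.union_subset_union_right (Finset.subset_insert _ _))⟩
  | breaker_move U M hne _ ih =>
    exact .breaker_move U M hne fun x hx =>
      ih x hx fun A hA hAU => hF A hA
        (hAU.trans (Finset.union_subset_union_left (Finset.erase_subset _ _)))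

theorem breaker_of_forall {ι : Type*} {s : Set ι} (hs : s.Nonempty) {S N : ι → Finset α}
    (hwin : ∀ i ∈ s, MakerWins F .maker (S i) (N i)) (hS : ∀ i ∈ s, S i ⊆ U ∪ M)
    (hN : ∀ i ∈ s, N i ⊆ M) (hU : ∀ x ∈ U, ∃ i ∈ s, x ∉ S i) : MakerWins F .breaker U M := by
  rcases U.eq_empty_or_nonempty with rfl | hne
  · obtain ⟨i, hi⟩ := hs
    exact empty_iff.2 (empty_iff.1 ((hwin i hi).mono (hS i hi) (hN i hi)))
  · refine .breaker_move _ _ hne fun x hx => ?_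
    obtain ⟨i, hi, hxi⟩ := hU x hx
    have hSi := hS i hi
    exact (hwin i hi).mono (by grind) (hN i hi)

theorem map {β : Type*} [DecidableEq β] (f : α ↪ β) {G : Set (Finset β)}
    (hFG : ∀ A ∈ F, A.map f ∈ G) (h : MakerWins F p U M) :
    MakerWins G p (U.map f) (M.map f) := by
  induction h with
  | game_over p M A hA hAM => exact of_subset (hFG A hA) (Finset.map_subset_map.2 hAM)
  | maker_move U M x hx _ ih =>
    refine .maker_move _ _ (f x) (Finset.mem_map_of_mem f hx) ?_
    rwa [← Finset.map_erase, ← Finset.map_insert]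
  | breaker_move U M hne _ ih =>
    refine .breaker_move _ _ (hne.map (f := f)) fun y hy => ?_
    obtain ⟨x, hx, rfl⟩ := Finset.mem_map.1 hy
    rw [← Finset.map_erase]
    exact ih x hx

theorem parallel {ι : Type*} {F : ι → Set (Finset α)} {D : ι → Finset α}
    (hD : ∀ i j, i ≠ j → Disjoint (D i) (D j)) (h : ∀ i, MakerWins (F i) .breaker (U ∩ D i) M) :
    MakerWins {A | ∀ i, ∃ B ∈ F i, B ⊆ A} .breaker U M := by
  induction U using Finset.strongInduction generalizing M with
  | H U ih =>
    rcases U.eq_empty_or_nonempty with rfl | hne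
    · exact empty_iff.2 ⟨M, fun i => empty_iff.1 (by simpa using h i), subset_rfl⟩
    refine .breaker_move _ _ hne fun x hx => ?_
    have hUx : U.erase x ⊂ U := Finset.erase_ssubset hx
    have hother : ∀ i, x ∉ D i → MakerWins (F i) .breaker (U.erase x ∩ D i) M := fun i hi =>
      (h i).mono (by grind) subset_rfl
    by_cases hxD : ∃ i, x ∈ D i
    · obtain ⟨i, hi⟩ := hxD
      have hxDj : ∀ j, j ≠ i → x ∉ D j := fun j hj => Finset.disjoint_right.1 (hD j i hj) hi
      have hwin : MakerWins (F i) .maker (U.erase x ∩ D i) M := by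
        rw [Finset.erase_inter]
        exact (h i).maker_of_mem (Finset.mem_inter.2 ⟨hx, hi⟩)
      rcases hwin.breaker_or_exists_move with hi | ⟨y, hy, hi⟩
      · refine (ih _ hUx fun j => ?_).maker_of_breaker
        rcases eq_or_ne j i with rfl | hj
        exacts [hi, hother j (hxDj j hj)]
      · refine .maker_move _ _ y (Finset.mem_inter.1 hy).1
          (ih _ ((Finset.erase_subset _ _).trans_ssubset hUx) fun j => ?_)
        rcases eq_or_ne j i with rfl | hj
        · exact hi.mono (by grind) subset_rfl
        · exact (hother j (hxDj j hj)).mono (by grind) (Finset.subset_insert _ _)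
    · push Not at hxD
      exact (ih _ hUx fun i => hother i (hxD i)).maker_of_breaker

end MakerWins

theorem exists_mem_notMem_of_length_lt_card {V : Type*} {W : Finset V} (l : List V)
    (h : l.length < W.card) : ∃ x ∈ W, x ∉ l := by
  classical
  simpa using Finset.exists_mem_notMem_of_card_lt_card (l.toFinset_card_le.trans_lt h)

section HamiltonianPathGame

variable {V : Type*} [DecidableEq V] {W : Finset V} {u v : V}

/-- The edge set of the complete graph on `W`. -/
def cliqueEdges (W : Finset V) : Finset (Sym2 V) := W.offDiag.image Sym2.mk.uncurry

theorem mk_mem_cliqueEdges {x y : V} : s(x, y) ∈ cliqueEdges W ↔ x ∈ W ∧ y ∈ W ∧ x ≠ y := by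
  simp only [cliqueEdges, Finset.mem_image, Finset.mem_offDiag, Prod.exists,
    Function.uncurry_apply_pair, Sym2.eq_iff]
  grind

theorem map_cliqueEdges {V' : Type*} [DecidableEq V'] (f : V' ↪ V) (W' : Finset V') :
    (cliqueEdges W').map f.sym2Map = cliqueEdges (W'.map f) := by
  ext e
  induction e with
  | _ x y =>
  simp only [mk_mem_cliqueEdges, Finset.mem_map, Sym2.exists, Function.Embedding.sym2Map_apply,
    Sym2.map_mk, Sym2.eq_iff]
  grind

/-- The sets of pairs that contain the edge set of a Hamiltonian path from `u` to `v` of the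
complete graph on `W`. The path is a list of vertices, so that it can be manipulated without
reference to a graph. -/
def pathSets (W : Finset V) (u v : V) : Set (Finset (Sym2 V)) :=
  {A | ∃ l : List V, l.Nodup ∧ l.head? = some u ∧ l.getLast? = some v ∧ l.toFinset = W ∧
    l.IsChain fun x y => s(x, y) ∈ A}

theorem pathSets_comm (W : Finset V) (u v : V) : pathSets W u v = pathSets W v u := by
  suffices ∀ u v, pathSets W u v ⊆ pathSets W v u from Set.Subset.antisymm (this u v) (this v u)
  rintro u v A ⟨l, hl, hu, hv, hW, hc⟩
  refine ⟨l.reverse, List.nodup_reverse.2 hl, by simpa using hv, by simpa using hu,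
    by simpa using hW, ?_⟩
  rw [List.isChain_reverse]
  exact hc.imp fun a b h => by rwa [Sym2.eq_swap]

theorem map_mem_pathSets {V' : Type*} [DecidableEq V'] (f : V' ↪ V) {W' : Finset V'} {u' v' : V'}
    {A : Finset (Sym2 V')} (hA : A ∈ pathSets W' u' v') :
    A.map f.sym2Map ∈ pathSets (W'.map f) (f u') (f v') := by
  obtain ⟨l, hl, hu, hv, rfl, hc⟩ := hA
  refine ⟨l.map f, hl.map f.injective, by simp [hu], by simp [hv], ?_, ?_⟩
  · ext x
    simp
  · rw [List.isChain_map]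
    exact hc.imp fun a b h => Finset.mem_map_of_mem f.sym2Map h

theorem insert_mem_pathSets {x : V} (hv : v ∈ W) {A : Finset (Sym2 V)}
    (hA : A ∈ pathSets (W.erase v) u x) : insert s(v, x) A ∈ pathSets W u v := by
  obtain ⟨l, hl, hu, hx, hW, hc⟩ := hA
  have hvl : v ∉ l := by
    rw [← List.mem_toFinset, hW]
    exact Finset.notMem_erase v W
  refine ⟨l ++ [v], ?_, by simp [hu], by simp, ?_, ?_⟩
  · exact hl.append (List.nodup_singleton v) (by simpa using hvl)
  · rw [List.toFinset_append, hW]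
    grind [List.mem_toFinset]
  · rw [List.isChain_append]
    refine ⟨hc.imp fun a b => Finset.mem_insert_of_mem, by simp, ?_⟩
    simp [hx, Sym2.eq_swap]

theorem MakerWins.of_erase {x : V} {U : Finset (Sym2 V)} (hv : v ∈ W) (hx : s(v, x) ∈ U)
    (h : MakerWins (pathSets (W.erase v) u x) .breaker (U.erase s(v, x)) ∅) :
    MakerWins (pathSets W u v) .maker U ∅ := by
  refine .maker_move _ _ s(v, x) hx ((h.mono Finset.subset_union_left
    (Finset.empty_subset _)).mono_family fun A hA _ => ⟨_, insert_mem_pathSets hv hA, ?_⟩)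
  grind

/-- Maker, as second player, can build a Hamiltonian path between any two vertices `u` and `v` of a
clique on `k` vertices of `V` from which the edges `uv` and `xy` are missing. The second missing
edge makes it possible to add a vertex to the clique, see
`WinsWithTwoMissingEdges.makerWins_succ`. -/
def WinsWithTwoMissingEdges (V : Type*) [DecidableEq V] (k : ℕ) : Prop :=
  ∀ (W : Finset V) (u v x y : V), W.card = k → [u, v, x, y].Nodup → (∀ z ∈ [u, v, x, y], z ∈ W) →
    MakerWins (pathSets W u v) .breaker (cliqueEdges W \ {s(u, v), s(x, y)}) ∅

namespace WinsWithTwoMissingEdges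

variable {k : ℕ} (h : WinsWithTwoMissingEdges V k) (hk : 4 ≤ k)

include h hk

theorem makerWins (hW : W.card = k) (hu : u ∈ W) (hv : v ∈ W) (huv : u ≠ v) :
    MakerWins (pathSets W u v) .breaker (cliqueEdges W \ {s(u, v)}) ∅ := by
  obtain ⟨x, hx, hx'⟩ := exists_mem_notMem_of_length_lt_card (W := W) [u, v]
    (by simp only [List.length_cons, List.length_nil]; omega)
  obtain ⟨y, hy, hy'⟩ := exists_mem_notMem_of_length_lt_card (W := W) [u, v, x]
    (by simp only [List.length_cons, List.length_nil]; omega)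
  exact (h W u v x y hW (by grind) (by grind)).mono (by grind) subset_rfl

theorem maker_of_incident (hW : W.card = k + 1) (hu : u ∈ W) (hv : v ∈ W) (huv : u ≠ v) {x : V}
    (hx : x ∈ W) (hxu : x ≠ u) (hxv : x ≠ v) {e : Sym2 V} (he : e ≠ s(v, x))
    (he' : e = s(u, x) ∨ v ∈ e) :
    MakerWins (pathSets W u v) .maker ((cliqueEdges W \ {s(u, v)}).erase e) ∅ := by
  have hwin : MakerWins (pathSets (W.erase v) u x) .breaker
      (cliqueEdges (W.erase v) \ {s(u, x)}) ∅ :=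
    h.makerWins hk (by rw [Finset.card_erase_of_mem hv, hW, Nat.add_sub_cancel])
      (by grind) (by grind) hxu.symm
  refine .of_erase hv ?_ (hwin.mono (fun f hf => ?_) subset_rfl)
  · simp only [Finset.mem_erase, Finset.mem_sdiff, mk_mem_cliqueEdges, Finset.mem_singleton,
      Sym2.eq_iff]
    grind
  · induction f with
    | _ a b =>
    simp only [Finset.mem_erase, Finset.mem_sdiff, mk_mem_cliqueEdges, Finset.mem_singleton,
      Finset.union_empty, Sym2.eq_iff] at hf ⊢
    have hve : v ∉ s(a, b) := by
      rw [Sym2.mem_iff]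
      grind
    grind

theorem maker_of_not_incident (hW : W.card = k + 1) (hu : u ∈ W) (hv : v ∈ W) (huv : u ≠ v)
    {x y : V} (hxy : s(x, y) ∈ cliqueEdges W) (hue : u ∉ s(x, y)) (hve : v ∉ s(x, y)) :
    MakerWins (pathSets W u v) .maker ((cliqueEdges W \ {s(u, v)}).erase s(x, y)) ∅ := by
  rw [mk_mem_cliqueEdges] at hxy
  rw [Sym2.mem_iff] at hue hve
  obtain ⟨w, hw, hw'⟩ := exists_mem_notMem_of_length_lt_card (W := W) [u, v, x, y]
    (by simp only [List.length_cons, List.length_nil]; omega)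
  have hwin : MakerWins (pathSets (W.erase v) u w) .breaker
      (cliqueEdges (W.erase v) \ {s(u, w), s(x, y)}) ∅ :=
    h _ _ _ _ _ (by rw [Finset.card_erase_of_mem hv, hW, Nat.add_sub_cancel])
      (by grind) (by grind)
  refine .of_erase hv (x := w) ?_ (hwin.mono (fun f hf => ?_) subset_rfl)
  · simp only [Finset.mem_erase, Finset.mem_sdiff, mk_mem_cliqueEdges, Finset.mem_singleton,
      ne_eq, Sym2.eq_iff]
    grind
  · induction f with
    | _ a b =>
    simp only [Finset.mem_erase, Finset.mem_sdiff, mk_mem_cliqueEdges, Finset.mem_singleton,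
      Finset.mem_insert, Finset.union_empty, ne_eq, Sym2.eq_iff] at hf ⊢
    grind

/-- A first edge of Breaker at `u` or `v` is not missed in the clique without `v`, for a suitable
edge `vx` of Maker; any other one becomes its second missing edge. -/
theorem makerWins_succ (hW : W.card = k + 1) (hu : u ∈ W) (hv : v ∈ W) (huv : u ≠ v) :
    MakerWins (pathSets W u v) .breaker (cliqueEdges W \ {s(u, v)}) ∅ := by
  obtain ⟨z, hzW, hz⟩ := exists_mem_notMem_of_length_lt_card (W := W) [u, v]
    (by simp only [List.length_cons, List.length_nil]; omega)
  refine .breaker_move _ _ ⟨s(u, z), ?_⟩ fun e he => ?_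
  · simp only [Finset.mem_sdiff, Finset.mem_singleton, mk_mem_cliqueEdges, Sym2.eq_iff]
    grind
  induction e with
  | _ x y =>
  simp only [Finset.mem_sdiff, mk_mem_cliqueEdges, Finset.mem_singleton] at he
  by_cases hve : v ∈ s(x, y)
  · obtain ⟨w, hw, hw'⟩ := exists_mem_notMem_of_length_lt_card (W := W) [u, v, x, y]
      (by simp only [List.length_cons, List.length_nil]; omega)
    refine h.maker_of_incident hk hW hu hv huv hw (by grind) (by grind) ?_ (.inr hve)
    rw [ne_eq, Sym2.eq_iff]
    grind
  by_cases hue : u ∈ s(x, y)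
  · obtain ⟨w, hw⟩ := hue
    have hmem : s(u, w) ∈ cliqueEdges W := hw ▸ mk_mem_cliqueEdges.2 he.1
    rw [mk_mem_cliqueEdges] at hmem
    rw [hw, Sym2.mem_iff] at hve
    refine h.maker_of_incident hk hW hu hv huv (x := w) hmem.2.1 hmem.2.2.symm (by grind) ?_
      (.inl hw)
    rw [hw, ne_eq, Sym2.eq_iff]
    grind
  · exact h.maker_of_not_incident hk hW hu hv huv (mk_mem_cliqueEdges.2 he.1) hue hve

end WinsWithTwoMissingEdges

end HamiltonianPathGame

namespace Certificate

/-- The `i`-th term of `0, 1, 2, 4, 7, 12, 20, 29`, a sequence with distinct sums of pairs. Here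
and below, the functions that the kernel evaluates most often are written with `Nat.mod` and the
like instead of notation, which saves it the unfolding of instances. -/
def weight (i : ℕ) : ℕ := Nat.mod (Nat.div 2920120704020100 (Nat.pow 100 i)) 100

/-- The number that stands for the edge `ij` of the complete graph on `Fin 8`. -/
def code (i j : ℕ) : ℕ := Nat.add (weight i) (weight j)

/-- The function given by `code` on unordered pairs. -/
def edgeCode : Sym2 (Fin 8) → ℕ :=
  Sym2.lift ⟨fun i j => code i j, fun _ _ => Nat.add_comm _ _⟩

/-- The edges `ij`, `i < j`, of the complete graph on `Fin 8`. -/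
def edgeList : List (ℕ × ℕ) :=
  [(0, 1), (0, 2), (0, 3), (0, 4), (0, 5), (0, 6), (0, 7), (1, 2), (1, 3), (1, 4), (1, 5), (1, 6),
    (1, 7), (2, 3), (2, 4), (2, 5), (2, 6), (2, 7), (3, 4), (3, 5), (3, 6), (3, 7), (4, 5), (4, 6),
    (4, 7), (5, 6), (5, 7), (6, 7)]

/-- The complete graph on `Fin 8`. -/
abbrev board : Finset (Sym2 (Fin 8)) := cliqueEdges Finset.univ

/-- The set of edges that is encoded in the binary digits of `p` from position `d` on. -/
def edges (d p : ℕ) : Finset (Sym2 (Fin 8)) := board.filter fun e => p.testBit (edgeCode e + d)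

/-- The goal of Maker on the complete graph on `Fin 8`. -/
abbrev goal : Set (Finset (Sym2 (Fin 8))) := pathSets Finset.univ 0 1

/-- A number `p` encodes a position: the digits from `0` on give the unclaimed edges, and the digits
from `50` on give the edges that Maker has not claimed. In particular `0` encodes a position in
which Maker owns the whole board. -/
def Wins (q : Player) (p : ℕ) : Prop := MakerWins goal q (edges 0 p) (board \ edges 50 p)

/-- The encoding of the position with unclaimed edges `S` and edges `L` that Maker does not own. -/
def pack (S L : ℕ) : ℕ := 2 ^ 50 * L + S % 2 ^ 50

/-- The position before Maker has claimed the edge `ij`, where `x = 10 * i + j`. -/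
def unclaim (x p : ℕ) : ℕ :=
  p ||| pack (1 <<< code (x / 10) (x % 10)) (1 <<< code (x / 10) (x % 10))

/-- The bitwise disjunction of `l`. -/
def unions (l : List ℕ) : ℕ := l.foldr Nat.lor 0

/-- The bitwise conjunction of `l`. -/
def inters (l : List ℕ) : ℕ := l.foldr (· &&& ·) (2 ^ 100 - 1)

/-- A position from which Breaker's moves lead to the positions `l`: Maker owns what he owns in one
of them, and the edges that are unclaimed in all of them, which Breaker must not be able to take. -/
def combine (l : List ℕ) : ℕ :=
  pack (unions l &&& (inters l >>> 50 &&& (inters l ^^^ (2 ^ 50 - 1))))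
    (inters l >>> 50 &&& (inters l ^^^ (2 ^ 50 - 1)))

/-- The image of the vertex `i` under the relabelling that is given by the eight decimal digits
`r`. -/
def digit (r i : ℕ) : ℕ := Nat.mod (Nat.div r (Nat.pow 10 (Nat.sub 7 i))) 10

/-- The image of the position `p` under the relabelling `g` of the vertices. -/
def relabel (g : ℕ → ℕ) (p : ℕ) : ℕ :=
  unions (edgeList.map fun e => Nat.shiftLeft (Nat.land (Nat.shiftRight p (code e.1 e.2))
    (Nat.add (Nat.pow 2 50) 1)) (code (g e.1) (g e.2)))

/-- Whether `g` permutes the numbers below `8`. -/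
def isPerm (g : ℕ → ℕ) : Bool :=
  Nat.beq (unions ([0, 1, 2, 3, 4, 5, 6, 7].map fun i => 1 <<< g i)) 255

/-- Whether `g` maps `{0, 1}` to itself, provided that it is injective. -/
def fixesEnds (g : ℕ → ℕ) : Bool := Nat.beq (g 0 + g 1) 1

/-- The `k`-th entry, counted from the last one, of the table of positions `T`, which has 100 binary
digits per entry. -/
def slot (T k : ℕ) : ℕ := T >>> (100 * k) % 2 ^ 100

/-- The position that is obtained from an entry of the table `T` by a relabelling; the last eight
digits of `r` are the relabelling and the others are the index of the entry. -/
def refer (T r : ℕ) : ℕ :=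
  bif isPerm (digit r) && fixesEnds (digit r) then relabel (digit r) (slot T (r / 10 ^ 8)) else 0

/-- Adds to the table `T` the position before Maker's move `row.1`, after which Breaker's moves lead
to the positions `row.2`. -/
def step (T : ℕ) (row : ℕ × List ℕ) : ℕ :=
  2 ^ 100 * T + unclaim row.1 (combine (row.2.map (refer T))) % 2 ^ 100

/-- The value of `k` at `n`. The case distinction makes the kernel evaluate `n` first. -/
def force {α : Type*} (n : ℕ) (k : ℕ → α) : α :=
  match n with
  | 0 => k 0
  | m + 1 => k (m + 1)

/-- The table that is obtained from `T` by adding the rows of a list one by one. -/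
def table : List (ℕ × List ℕ) → ℕ → ℕ
  | [], T => T
  | row :: rows, T => force (step T row) (table rows)

theorem edgeCode_mk (i j : Fin 8) : edgeCode s(i, j) = code i j := rfl

theorem mk_mem_board {i j : Fin 8} : s(i, j) ∈ board ↔ i ≠ j := by
  simp [mk_mem_cliqueEdges]

theorem edgeCode_lt {e : Sym2 (Fin 8)} (he : e ∈ board) : edgeCode e < 50 := by
  revert e
  decide +kernel

theorem edgeCode_injOn : Set.InjOn edgeCode board := by
  have h : ∀ e ∈ board, ∀ f ∈ board, edgeCode e = edgeCode f → e = f := by decide +kernel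
  exact fun e he f hf => h e he f hf

theorem mem_edges {d p : ℕ} {e : Sym2 (Fin 8)} :
    e ∈ edges d p ↔ e ∈ board ∧ p.testBit (edgeCode e + d) :=
  Finset.mem_filter

theorem edges_subset_board (d p : ℕ) : edges d p ⊆ board := Finset.filter_subset _ _

theorem edges_or (d p q : ℕ) : edges d (p ||| q) = edges d p ∪ edges d q := by
  ext e
  simp only [mem_edges, Finset.mem_union, Nat.testBit_or, Bool.or_eq_true]
  grind

theorem edges_and (d p q : ℕ) : edges d (p &&& q) = edges d p ∩ edges d q := by
  ext e
  simp only [mem_edges, Finset.mem_inter, Nat.testBit_and, Bool.and_eq_true]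
  grind

theorem edges_shiftRight (d p k : ℕ) : edges d (p >>> k) = edges (d + k) p := by
  ext e
  rw [mem_edges, mem_edges, Nat.testBit_shiftRight, ← add_assoc, add_comm k]
  simp only [add_assoc, add_comm k]

theorem edges_xor_two_pow_sub_one (p : ℕ) :
    edges 0 (p ^^^ (2 ^ 50 - 1)) = board \ edges 0 p := by
  ext e
  simp only [mem_edges, Finset.mem_sdiff, Nat.testBit_xor, Nat.testBit_two_pow_sub_one]
  refine and_congr_right fun he => ?_
  simp [he, edgeCode_lt he]

theorem edges_mod_two_pow {d k : ℕ} (h : d + 50 ≤ k) (p : ℕ) :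
    edges d (p % 2 ^ k) = edges d p := by
  ext e
  simp only [mem_edges, Nat.testBit_mod_two_pow]
  refine and_congr_right fun he => ?_
  have := edgeCode_lt he
  simp [show edgeCode e + d < k by omega]

theorem edges_zero_pack (S L : ℕ) : edges 0 (pack S L) = edges 0 S := by
  rw [← edges_mod_two_pow (k := 50) le_rfl (pack S L), pack, Nat.mul_add_mod, Nat.mod_mod,
    edges_mod_two_pow le_rfl]

theorem edges_fifty_pack (S L : ℕ) : edges 50 (pack S L) = edges 0 L := by
  ext e
  simp only [mem_edges, pack]
  rw [Nat.testBit_two_pow_mul_add _ (Nat.mod_lt _ (by positivity))]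
  simp

theorem edges_one_shiftLeft_subsingleton (c : ℕ) :
    (edges 0 (1 <<< c) : Set (Sym2 (Fin 8))).Subsingleton := by
  have hc : ∀ e ∈ edges 0 (1 <<< c), edgeCode e = c := fun e he => by
    have := (mem_edges.1 he).2
    rw [Nat.one_shiftLeft, Nat.testBit_two_pow] at this
    simpa [eq_comm] using this
  intro e he f hf
  exact edgeCode_injOn (edges_subset_board _ _ he) (edges_subset_board _ _ hf)
    ((hc e he).trans (hc f hf).symm)

theorem testBit_unions {l : List ℕ} {b : ℕ} :
    (unions l).testBit b ↔ ∃ p ∈ l, p.testBit b := by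
  induction l with
  | nil => simp [unions]
  | cons p l ih =>
    change (p ||| unions l).testBit b ↔ _
    simp [ih]

theorem mem_edges_unions {d : ℕ} {l : List ℕ} {e : Sym2 (Fin 8)} :
    e ∈ edges d (unions l) ↔ ∃ p ∈ l, e ∈ edges d p := by
  simp only [mem_edges, testBit_unions]
  grind

theorem mem_edges_inters {d : ℕ} (hd : d ≤ 50) {l : List ℕ} {e : Sym2 (Fin 8)} :
    e ∈ edges d (inters l) ↔ e ∈ board ∧ ∀ p ∈ l, e ∈ edges d p := by
  induction l with
  | nil =>
    simp only [inters, List.foldr_nil, mem_edges, Nat.testBit_two_pow_sub_one]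
    refine and_congr_right fun he => ?_
    have : edgeCode e + d < 100 := by
      have := edgeCode_lt he
      omega
    simpa using this
  | cons p l ih =>
    change e ∈ edges d (p &&& inters l) ↔ _
    simp only [edges_and, Finset.mem_inter, ih, List.forall_mem_cons]
    grind

theorem wins_zero (q : Player) : Wins q 0 := by
  have hM : board \ edges 50 0 = board := by simp [edges]
  have hpath : board ∈ goal :=
    ⟨[0, 2, 3, 4, 5, 6, 7, 1], by decide, rfl, rfl, by decide, by
      simp only [mk_mem_board]
      decide⟩
  exact .of_subset hpath hM.ge

theorem wins_mod_two_pow {q : Player} {p : ℕ} : Wins q (p % 2 ^ 100) ↔ Wins q p := by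
  rw [Wins, edges_mod_two_pow (by norm_num), edges_mod_two_pow (by norm_num), Wins]

theorem Wins.unclaim {p : ℕ} (h : Wins .breaker p) (x : ℕ) : Wins .maker (unclaim x p) := by
  simp only [Wins, Certificate.unclaim, edges_or, edges_zero_pack, edges_fifty_pack]
  rcases (edges_one_shiftLeft_subsingleton (code (x / 10) (x % 10))).eq_empty_or_singleton with
    hx | ⟨e, he⟩
  · rw [Finset.coe_eq_empty.1 hx, Finset.union_empty, Finset.union_empty]
    exact h.maker_of_breaker
  · rw [Finset.coe_eq_singleton.1 he]
    exact .maker_move _ _ e (by simp) (h.mono (by grind) (by grind))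

theorem wins_combine {l : List ℕ} (h : ∀ p ∈ l, Wins .maker p) : Wins .breaker (combine l) := by
  have hfree : edges 0 (combine l) = edges 0 (unions l) ∩ edges 50 (combine l) := by
    rw [combine, edges_zero_pack, edges_fifty_pack, edges_and]
  have hunowned : edges 50 (combine l) = edges 50 (inters l) \ edges 0 (inters l) := by
    rw [combine, edges_fifty_pack, edges_and, edges_shiftRight, edges_xor_two_pow_sub_one,
      zero_add, ← Finset.inter_sdiff_assoc, Finset.inter_eq_left.2 (edges_subset_board _ _)]
  rcases l with _ | ⟨p₀, l'⟩
  · exact wins_zero _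
  set l := p₀ :: l' with hl
  have hS : ∀ p ∈ l, edges 0 p ⊆ edges 0 (combine l) ∪ (board \ edges 50 (combine l)) :=
    fun p hp e he => by
      have := edges_subset_board _ _ he
      have : e ∈ edges 0 (unions l) := (mem_edges_unions).2 ⟨p, hp, he⟩
      grind
  have hN : ∀ p ∈ l, board \ edges 50 p ⊆ board \ edges 50 (combine l) := fun p hp =>
    Finset.sdiff_subset_sdiff le_rfl fun e he =>
      ((mem_edges_inters le_rfl).1 (Finset.mem_sdiff.1 (hunowned ▸ he)).1).2 p hp
  refine MakerWins.breaker_of_forall (s := {p | p ∈ l}) ⟨p₀, by simp [hl]⟩ h hS hN fun e he => ?_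
  have he' : e ∉ edges 0 (inters l) := by grind
  have heb := edges_subset_board _ _ he
  rw [mem_edges_inters (by norm_num)] at he'
  simpa [heb] using he'

theorem testBit_relabel_iff {g : ℕ → ℕ} {p b : ℕ} :
    (relabel g p).testBit b ↔ ∃ e ∈ edgeList, ∃ d ∈ [0, 50],
      b = code (g e.1) (g e.2) + d ∧ p.testBit (code e.1 e.2 + d) := by
  have hmask (k : ℕ) : (2 ^ 50 + 1 : ℕ).testBit k ↔ k ∈ [0, 50] := by
    rw [← mul_one (2 ^ 50), Nat.testBit_two_pow_mul_add _ (by norm_num), List.mem_pair]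
    split_ifs <;> rw [Nat.testBit_one_eq_true_iff_self_eq_zero] <;> omega
  have hrelabel : relabel g p = unions (edgeList.map fun e =>
      (p >>> code e.1 e.2 &&& (2 ^ 50 + 1)) <<< code (g e.1) (g e.2)) := rfl
  simp only [hrelabel, testBit_unions, List.mem_map, exists_exists_and_eq_and,
    Nat.testBit_shiftLeft, Nat.testBit_and, Nat.testBit_shiftRight, Bool.and_eq_true,
    decide_eq_true_eq, hmask]
  refine exists_congr fun e => and_congr_right fun _ => ?_
  constructor
  · rintro ⟨hb, hp, hd⟩
    exact ⟨_, hd, by omega, hp⟩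
  · rintro ⟨d, hd, rfl, hp⟩
    simp [hp, hd]

theorem exists_mem_edgeList {e : Sym2 (Fin 8)} (he : e ∈ board) :
    ∃ i j : Fin 8, (i.val, j.val) ∈ edgeList ∧ e = s(i, j) := by
  revert e
  decide +kernel

theorem exists_eq_of_mem_edgeList : ∀ x ∈ edgeList, ∃ i j : Fin 8, i ≠ j ∧ x = (i.val, j.val) := by
  decide +kernel

theorem exists_perm_of_isPerm {g : ℕ → ℕ} (hg : isPerm g) :
    ∃ σ : Equiv.Perm (Fin 8), ∀ i : Fin 8, g i = σ i := by
  have hunions : unions ((List.range 8).map fun i => 1 <<< g i) = 2 ^ 8 - 1 :=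
    Nat.eq_of_beq_eq_true hg
  have hsurj : ∀ j : Fin 8, ∃ i : Fin 8, g i = j := fun j => by
    have : (unions ((List.range 8).map fun i => 1 <<< g i)).testBit j := by
      rw [hunions, Nat.testBit_two_pow_sub_one]
      simp
    simp only [testBit_unions, List.mem_map, exists_exists_and_eq_and, List.mem_range,
      Nat.one_shiftLeft, Nat.testBit_two_pow, decide_eq_true_eq] at this
    obtain ⟨i, hi, hij⟩ := this
    exact ⟨⟨i, hi⟩, hij⟩
  choose τ hτ using hsurj
  have hτ_inj : Function.Injective τ := fun j j' h => Fin.ext (by rw [← hτ j, h, hτ j'])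
  refine ⟨(Equiv.ofBijective τ (Finite.injective_iff_bijective.1 hτ_inj)).symm, fun i => ?_⟩
  exact (congrArg (g ∘ Fin.val) (Equiv.ofBijective_apply_symm_apply τ _ i).symm).trans (hτ _)

theorem edges_relabel {g : ℕ → ℕ} {σ : Equiv.Perm (Fin 8)} (hg : ∀ i : Fin 8, g i = σ i) {d : ℕ}
    (hd : d ∈ [0, 50]) (p : ℕ) :
    edges d (relabel g p) = (edges d p).map σ.toEmbedding.sym2Map := by
  have hσ_board {i j : Fin 8} (hij : i ≠ j) : s(σ i, σ j) ∈ board :=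
    mk_mem_board.2 (σ.injective.ne hij)
  ext e
  simp only [mem_edges, Finset.mem_map, testBit_relabel_iff]
  constructor
  · rintro ⟨he, x, hx, d', hd', hcode, hp⟩
    obtain ⟨i, j, hij, rfl⟩ := exists_eq_of_mem_edgeList x hx
    rw [hg, hg, ← edgeCode_mk] at hcode
    have hd_eq : d' = d := by
      have := edgeCode_lt he
      have := edgeCode_lt (hσ_board hij)
      simp only [List.mem_cons, List.not_mem_nil, or_false] at hd hd'
      omega
    subst hd_eq
    exact ⟨s(i, j), ⟨mk_mem_board.2 hij, hp⟩,
      (edgeCode_injOn he (hσ_board hij) (Nat.add_right_cancel hcode)).symm⟩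
  · rintro ⟨f, ⟨hf, hp⟩, rfl⟩
    obtain ⟨i, j, hij, rfl⟩ := exists_mem_edgeList hf
    refine ⟨hσ_board (mk_mem_board.1 hf), _, hij, d, hd, ?_, hp⟩
    rw [hg, hg]
    rfl

theorem Wins.relabel {g : ℕ → ℕ} (hperm : isPerm g) (hends : fixesEnds g) {q : Player} {p : ℕ}
    (h : Wins q p) : Wins q (relabel g p) := by
  obtain ⟨σ, hσ⟩ := exists_perm_of_isPerm hperm
  have huniv : Finset.univ.map σ.toEmbedding = Finset.univ := Finset.map_univ_equiv σ
  have hboard : board.map σ.toEmbedding.sym2Map = board := by rw [map_cliqueEdges, huniv]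
  have hgoal : ∀ A ∈ goal, A.map σ.toEmbedding.sym2Map ∈ goal := fun A hA => by
    have hA' := map_mem_pathSets σ.toEmbedding hA
    have h01 : (σ 0 = 0 ∧ σ 1 = 1) ∨ (σ 0 = 1 ∧ σ 1 = 0) := by
      have := Nat.eq_of_beq_eq_true hends
      have h0 := hσ 0
      have h1 := hσ 1
      simp only [Fin.val_zero, Fin.val_one] at h0 h1
      omega
    rw [huniv, Equiv.coe_toEmbedding] at hA'
    rcases h01 with ⟨h0, h1⟩ | ⟨h0, h1⟩ <;> rw [h0, h1] at hA'
    · exact hA'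
    · rwa [pathSets_comm] at hA'
  rw [Wins, edges_relabel hσ (by simp), edges_relabel hσ (by simp)]
  conv => arg 4; rw [← hboard]
  rw [← Finset.map_sdiff]
  exact MakerWins.map _ hgoal h

theorem wins_refer {T : ℕ} (hT : ∀ k, Wins .maker (slot T k)) (r : ℕ) :
    Wins .maker (refer T r) := by
  rw [refer, Bool.cond_eq_ite]
  split_ifs with h
  · rw [Bool.and_eq_true] at h
    exact (hT _).relabel h.1 h.2
  · exact wins_zero _

theorem wins_slot_step {T : ℕ} (hT : ∀ k, Wins .maker (slot T k)) (row : ℕ × List ℕ) (k : ℕ) :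
    Wins .maker (slot (step T row) k) := by
  have hrow : Wins .maker (unclaim row.1 (combine (row.2.map (refer T)))) :=
    (wins_combine (by simpa using fun r _ => wins_refer hT r)).unclaim _
  cases k with
  | zero =>
    rw [slot, step, mul_zero, Nat.shiftRight_zero, Nat.mul_add_mod, Nat.mod_mod, wins_mod_two_pow]
    exact hrow
  | succ k =>
    convert hT k using 1
    rw [slot, slot, step, mul_add_one, Nat.add_comm (100 * k), Nat.shiftRight_add,
      Nat.shiftRight_eq_div_pow _ 100, Nat.mul_add_div (by positivity),
      Nat.div_eq_of_lt (Nat.mod_lt _ (by positivity)), add_zero]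

theorem wins_slot_table (rows : List (ℕ × List ℕ)) {T : ℕ} (hT : ∀ k, Wins .maker (slot T k))
    (k : ℕ) : Wins .maker (slot (table rows T) k) := by
  induction rows generalizing T with
  | nil => exact hT k
  | cons row rows ih =>
    have hforce (n : ℕ) (f : ℕ → ℕ) : force n f = f n := by cases n <;> rfl
    rw [table, hforce]
    exact ih (wins_slot_step hT row)

/-- The position in which Maker owns exactly the path `0, 2, 3, 4, 5, 6, 7, 1`, and Breaker the rest
of the board. -/
def start : ℕ := pack 0 2279175451578

theorem wins_slot_start (k : ℕ) : Wins .maker (slot start k) := by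
  cases k with
  | zero =>
    rw [slot, mul_zero, Nat.shiftRight_zero, wins_mod_two_pow]
    refine .of_subset ⟨[0, 2, 3, 4, 5, 6, 7, 1], ?_, rfl, rfl, ?_, ?_⟩ subset_rfl <;> decide +kernel
  | succ k =>
    have hslot : slot start (k + 1) = 0 := by
      rw [slot, mul_add_one, Nat.add_comm, Nat.shiftRight_add]
      exact congrArg (· % 2 ^ 100) (Nat.zero_shiftRight _)
    rw [hslot]
    exact wins_zero _

set_option maxRecDepth 100000 in
/-- Maker's strategy on the complete graph on `Fin 8`, found by a computer search, from the end of
the game to its beginning; see `step` for the meaning of a row. -/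
def rows : List (ℕ × List ℕ) :=
  [(17, [001634527]), (67, [001362475]), (57, [001257436]), (57, [010536247]), (25, [301352647,
  301352746]), (46, [210265347, 401234657]), (67, [501467235, 501567234]), (16, [410724563,
  410734562]), (15, [710342657, 710342756]), (07, [801426375, 801526374]), (47, [710476325,
  901432765]), (07, [1001325476, 1001426375]), (12, [1110364527, 1110473526]), (27, [1201325476,
  1201426375]), (15, [1001235467, 1001245367]), (67, [1401642357, 1401642753]), (16, [1301426375,
  1301526374]), (17, [1310234675, 1610325476]), (47, [1601374256, 1701327465]), (57, [1601425763,
  1801524367]), (46, [1601246573, 1901423675]), (27, [1701243576, 1701253476]), (37, [2101427365,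
  2101527364]), (16, [2001426375, 2101432657]), (15, [2101365427, 2101375426]), (17, [2210423675,
  2210523674]), (56, [2410263574, 2510256347]), (16, [2410235467, 2401246357]), (56, [2501652743,
  2701256347]), (57, [2510354726, 2801357246]), (16, [2710432765, 2910234567]), (56, [3001523674,
  3001624573]), (47, [3101432765, 3110432765]), (17, [2910243576, 2910253476]), (16, [3201425637,
  3201534627]), (16, [3201256347, 3410234567]), (47, [3210247356, 3410243765]), (67, [3601476325,
  3601654327]), (67, [3701236745, 3701652743]), (17, [3610325476, 3710342567]), (15, [3601235467,
  3801234576]), (67, [4001634257, 4001734256]), (17, [4010324657, 4010325647]), (17, [3910235476,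
  4110234567]), (35, [4110537264, 4210523746]), (46, [4301423567, 4301426537]), (56, [4401536247,
  4501523674]), (57, [4310257346, 4601253476]), (37, [4601327546, 4610327645]), (14, [4601624573,
  4701236457]), (57, [4710276354, 4901532467]), (57, [4901472536, 5001524367]), (26, [4901624573,
  5001236457]), (37, [5001432675, 5201536274]), (16, [5101246357, 5310234567]), (06, [5401427365,
  5401537264]), (47, [5501234765, 5501435267]), (14, [5301234675, 5501652437]), (67, [5510456723,
  5710476325]), (14, [5601374625, 5810253746]), (67, [5910236745, 5901472563]), (15, [5710472356,
  6010637254]), (67, [5401264537, 5401264573, 5701264537, 5701624537]), (15, [5510235467,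
  5510235476, 5810235467, 5810325467]), (56, [6310256347, 5810256473]), (14, [6210256347,
  5901234675]), (37, [6301734562, 5910342756]), (25, [6410256347, 2710235467]), (15, [6410236457,
  3901526374]), (14, [6610256347, 5801437265]), (47, [6901234765, 6501576324]), (47, [7001234765,
  6201423657]), (14, [6910256347, 6610236475]), (37, [7201537264, 5901427356]), (13, [7201245376,
  2701342756]), (47, [7401234765, 6701576324]), (15, [7210236457, 5501347256]), (07, [7601526374,
  6201245376]), (12, [7501432765, 4801256347]), (67, [7801472563, 6610537624]), (25, [7901352746,
  7101235467]), (25, [7810256347, 6510235467]), (37, [7901734562, 6501342756]), (67, [8201472563,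
  7001537624]), (67, [8301472563, 6601236745]), (13, [8301245376, 6601327564]), (37, [8410327654,
  6610327645]), (35, [8501253476, 6601357246]), (37, [8701537264, 3801325476]), (15, [8501245367,
  6701753426]), (45, [8601254367, 6801743526]), (35, [8901253476, 7010532764]), (37, [9101536274,
  6801346257]), (07, [9201426375, 6901256347]), (37, [9301537264, 7001347256]), (14, [9210256347,
  7710234567]), (37, [9501527364, 7001364527]), (25, [9410256347, 4601235467]), (16, [9710234567,
  6501437265]), (47, [9610476325, 9301432657]), (35, [9801253476, 7601325476]), (67, [9801274563,
  9310264537]), (47, [10101432765, 8210732645]), (67, [10201472563, 9001426735]), (67, [10101274563,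
  7901624537]), (47, [10401234765, 7701453627]), (67, [10301274563, 7710674523]), (47, [10601234765,
  7901473625]), (35, [10601253476, 6310532764]), (37, [10801537264, 9710325476]), (37, [10901537264,
  8601374526]), (67, [11001472563, 8001654327]), (67, [11101472563, 8101652743]), (12, [11001432765,
  9310534627]), (37, [11301537264, 6401352746]), (46, [11401234657, 10401437256]),
  (16, [11510437265, 8410247356]), (47, [11410476325, 9910432765]), (67, [11701472563,
  10001476325]), (67, [11801472563, 10610357264]), (67, [11901472563, 10701246375]),
  (45, [11701254367, 8710243567]), (37, [12010327654, 7010327645]), (37, [12201537264, 8801573426]),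
  (15, [12010236457, 8810325476]), (67, [12401472563, 8901476325]), (67, [12501472563, 6601642573]),
  (56, [12501462537, 11301235647]), (15, [12410236457, 7501325476]), (13, [12701245376,
  9810325476]), (36, [12801236547, 9301362547]), (56, [12901462537, 9601456237]), (37, [13101537264,
  9701243756]), (56, [13101462537, 7901524367]), (07, [13301325476, 11001256347]),
  (35, [13301253476, 10710325476]), (67, [13501472563, 12301624537]), (56, [13610256347,
  13101254673]), (25, [13510256347, 12201253647]), (12, [13601432765, 10110234567]),
  (25, [13710256347, 8910253647]), (37, [13910234765, 9201362574]), (07, [14101436275,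
  10301437265]), (17, [13910234675, 11410437265]), (37, [14301537264, 10301354267]),
  (14, [14210256347, 10610234567]), (67, [14301274563, 14110264537]), (37, [9001324765, 10301324657,
  10401234765, 10501324657]), (37, [14701352746, 11001437265]), (47, [14610476325, 11010432765]),
  (27, [14601253476, 12701234576]), (15, [14710236457, 11210325476]), (15, [14810236457,
  10710432765]), (06, [15201437265, 12801675423]), (37, [15301537264, 9601352746]),
  (25, [15210256347, 11501253647]), (12, [15301432765, 9701234567]), (27, [15601426375,
  14510234567]), (25, [15601235476, 11210253674]), (06, [15801745362, 14101746253]),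
  (67, [15901472563, 10001624537]), (56, [15901462537, 14701456237]), (67, [16101472563,
  10001642573]), (27, [15901235476, 11710243765]), (47, [16301432765, 13401476325]),
  (15, [16110236457, 14410432765]), (56, [16401462537, 11801365247]), (27, [16301235476,
  11501234576]), (56, [16710256347, 10710256347]), (47, [16601245376, 14110423567]),
  (37, [16810237564, 12101362457]), (37, [16910234765, 16501235746]), (47, [17101327465,
  13610234756]), (67, [17201472563, 13701236745]), (56, [17301573624, 13801572634]),
  (13, [17301245376, 14801253647]), (67, [17501472563, 11401624537]), (56, [17610235647,
  12910526734]), (25, [17701537264, 16810324567]), (46, [17801326475, 12410234657]),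
  (45, [17810524736, 15701243576]), (34, [18001673425, 17110245637]), (14, [18001327465,
  17710234567]), (46, [18210254637, 14701326475]), (47, [18301432765, 11801432765]),
  (17, [18210324576, 11810324576]), (67, [17801264537, 17801374526]), (67, [17901264537,
  18201374526]), (16, [18510234567, 8610234567]), (57, [18801357246, 11301357246]),
  (67, [18501264537, 18501374526]), (56, [19001256347, 12001256347]), (17, [18910324576,
  4510324576]), (16, [19010234567, 5710234567]), (13, [16401324576, 16501324576]),
  (24, [18601234567, 18610234567]), (17, [19310324576, 13110324576]), (07, [19601325476,
  12701325476]), (07, [19701325476, 8801325476]), (07, [19801325476, 10001325476]),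
  (16, [19910234567, 12910234567]), (16, [20010234567, 13210234567]), (16, [20110234567,
  13610234567]), (15, [19701235467, 19701235476]), (07, [20301325476, 13101325476]),
  (47, [20401432765, 13301432765]), (07, [20501325476, 12201325476]), (16, [20610234567,
  13310234567]), (07, [20701325476, 13301325476]), (06, [20801234567, 13701234567]),
  (56, [20901235647, 13601235647]), (57, [21001235746, 14801724365]), (07, [21101325476,
  10801325476]), (07, [21201325476, 13601325476]), (16, [21310234567, 13810234567]),
  (16, [21410234567, 15210526374]), (07, [21501325476, 13701325476]), (56, [21601256347,
  14001256347]), (56, [21701256347, 14401256347]), (15, [21601235467, 15201235467]),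
  (13, [17301324576, 17301325476]), (17, [20001324576, 20001325476]), (47, [22101432765,
  15101432765]), (15, [22001235467, 14101235467]), (14, [22101234567, 14101234567]),
  (56, [22401256347, 15001256347]), (15, [22301235467, 15801235467]), (47, [22601432765,
  14301432765]), (47, [22701432765, 15501432765]), (56, [22801256347, 14501256347]),
  (47, [22901432765, 15601432765]), (12, [22001234567, 22001235467]), (15, [22901235467,
  16701235467]), (56, [23201256347, 14801256347]), (47, [23301432765, 14801432765]),
  (56, [23401235647, 16001235647]), (17, [23210234576, 14901327645]), (16, [23610234567,
  15210234567]), (47, [23701432765, 17501746352]), (16, [23810234567, 15310234567]),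
  (56, [23901235647, 15101235647]), (47, [24001432765, 15601432765]), (46, [23901462735,
  15901462735]), (56, [24201235647, 15901235647]), (67, [23101537624, 23110537624]),
  (56, [24401235647, 17501235647]), (67, [22510764532, 22501675423]), (17, [24310234576,
  15610234576]), (27, [23601234567, 23610234567]), (07, [15601234567, 23501234567, 23501325467]),
  (16, [24910234567, 15510234567]), (05, [21501325476, 23301325476]), (56, [25101256347,
  15701256347]), (15, [25001235467, 15501235467]), (35, [22201325476, 23001325476]),
  (56, [25401235647, 16001235647]), (17, [25310324576, 11810324576]), (67, [24401357264,
  24410537624]), (67, [24501426735, 24501537624]), (17, [25610324576, 17710324576]),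
  (56, [25901256347, 16101256347]), (56, [26001256347, 18901256347]), (17, [25910324576,
  17410324576]), (15, [26001235467, 16101235467]), (56, [26301235647, 18701235647]),
  (56, [26401256347, 17901256347]), (15, [26301235467, 16501235467]), (17, [26410324576,
  16410324576]), (47, [26510473625, 16710473625]), (17, [26610324576, 17710324576]),
  (17, [26710324576, 17210324576]), (56, [27001235647, 17501235647]), (56, [26901562734,
  16701562734]), (17, [27010324576, 16410324576]), (47, [27301432765, 16401432765]),
  (15, [27201235467, 13601235467]), (07, [27501325476, 16801325476]), (57, [27601532764,
  17101532764]), (56, [27701235647, 17001235647]), (57, [27801235746, 20001235746]),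
  (07, [27901325476, 16901325476]), (57, [28001253476, 17101253476]), (07, [28101325476,
  17001325476]), (07, [28201325476, 17001325476]), (07, [28301325476, 17801325476]),
  (47, [28401432765, 17301432765]), (47, [28501432765, 17301432765]), (07, [28601325476,
  17301325476]), (14, [28501234567, 18301234567]), (34, [25701324576, 26501342756]),
  (15, [28701235467, 18301235467]), (16, [29010234567, 17210234567]), (57, [29101253476,
  22001253476]), (56, [29201256347, 17401256347]), (57, [29301357246, 18201357246]),
  (56, [29401235647, 17501235647]), (56, [29501235647, 17501235647]), (56, [29601235647,
  18401235647]), (56, [29701235647, 18801235647]), (16, [29510234567, 17710234567]),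
  (47, [29901432765, 18101432765]), (56, [30001235647, 19001235647]), (67, [30101362475,
  18201362475]), (57, [30201253476, 22401253476]), (17, [30010234576, 18110234576]),
  (47, [30401432765, 18501432765]), (57, [30501532764, 19101532764]), (56, [30601256347,
  17401256347]), (56, [30701256347, 18801256347]), (07, [30801325476, 18201325476]),
  (57, [30901357246, 21401357246]), (17, [30710234576, 18901327645]), (07, [31101325476,
  18601325476]), (47, [31201432765, 19201432765]), (07, [31301325476, 19001325476]),
  (47, [31401432765, 19001432765]), (16, [31401324657, 18801324657]), (57, [31601253476,
  19801253476]), (47, [31701432765, 18901432765]), (56, [31801256347, 19001256347]),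
  (16, [31910234567, 19010234567]), (57, [32001253476, 25101253476]), (57, [32101253476,
  25601253476]), (37, [31910237456, 20101325674]), (16, [32201324657, 19301324657]),
  (16, [32410234567, 19610234567]), (67, [32501362475, 21201362475]), (16, [32501324657,
  19501324657]), (56, [32701235647, 21401235647]), (56, [32801235647, 19601235647]),
  (56, [32901235647, 20401235647]), (57, [33001253476, 22301253476]), (16, [33001324657,
  19801324657]), (57, [33201253476, 21201253476]), (47, [33301432765, 20101432765]),
  (56, [33401256347, 20801256347]), (15, [33301235467, 23301235467]), (57, [33601532764,
  21001532764]), (57, [33701357246, 22401357246]), (46, [30001246357, 30301246357]),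
  (15, [33701235467, 20401235467]), (47, [34001432765, 20401432765]), (26, [33101264537,
  33101265437]), (56, [34201256347, 20301256347]), (17, [34010234576, 22101327645]),
  (47, [34210473625, 20910473625]), (27, [29701234576, 29701243576]), (57, [34601253476,
  21001253476]), (57, [34701253476, 26401253476]), (67, [34801362475, 20401362475]),
  (67, [34901362475, 20401362475]), (15, [34801235467, 18601235467]), (47, [35101432765,
  20601432765]), (07, [35201325476, 20701325476]), (67, [35301634257, 27001634257]),
  (15, [35201235467, 24601235467]), (17, [35310324576, 21710324576]), (56, [35601235647,
  25801235647]), (56, [35701235647, 21801235647]), (56, [34501326547, 34501524367]),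
  (47, [35901432765, 20801432765]), (47, [35201423657, 20701423657, 20701423675, 29701246357]),
  (56, [36101256347, 28201256347]), (57, [36201253476, 26801253476]), (56, [36301235647,
  20901235647]), (57, [36401253476, 19101253476]), (57, [36501235746, 21301235746]),
  (37, [36310237456, 24401325674]), (67, [36701362475, 29301362475]), (37, [35001325674,
  35001326574]), (16, [36801324657, 22801324657]), (45, [36901245367, 23901245367]),
  (57, [37101253476, 26101253476]), (57, [37201357246, 21601357246]), (07, [37301325476,
  23701325476]), (16, [37410234567, 28610234567]), (17, [37210234576, 21701327645]),
  (67, [36401357264, 36401426735]), (17, [37410234576, 21910234576]), (47, [37801432765,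
  21801432765]), (57, [37901253476, 30401253476]), (47, [38001432765, 21801432765]),
  (07, [38101325476, 22101325476]), (67, [37001246375, 37001426735, 22301246375]),
  (16, [38310234567, 22110234567]), (16, [38301324657, 22101324657]), (57, [38501235746,
  22301235746]), (17, [38410324576, 22210324576]), (47, [38701432765, 29901432765]),
  (15, [38601235467, 24801235467]), (56, [38701562734, 29201562734]), (35, [36110352746,
  36210352746]), (56, [39101256347, 22901256347]), (56, [39201256347, 25601256347]),
  (16, [39201324657, 22701324657]), (16, [39301324657, 22701324657]), (47, [39310473625,
  22710473625]), (16, [39501324657, 22701324657]), (57, [39701253476, 23201253476]),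
  (15, [39601235467, 23001235467]), (46, [39801426537, 23601426537]), (46, [36301423675,
  37001423675]), (56, [36701235647, 38801524367]), (14, [40001234567, 24701234567]),
  (17, [40010234576, 23101327645]), (46, [40301426537, 24301426537]), (07, [40501325476,
  23201325476]), (47, [40601432765, 23301432765]), (47, [36901234756, 37201234756]),
  (17, [40510234576, 23610234576]), (46, [37401246357, 39201246357]), (06, [41001234567,
  23501234567]), (16, [41110234567, 27910234567]), (16, [41101324657, 24101324657]),
  (47, [41110473625, 31110473625]), (56, [41401256347, 23801256347]), (47, [41310473625,
  26910473625]), (17, [41310234576, 23901327645]), (37, [41410237456, 24001325674]),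
  (57, [41801734562, 34110352746]), (47, [41901234765, 33901576324]), (57, [42001734562,
  33101327564]), (14, [41910256347, 32201437265]), (47, [42201234765, 35901246357]),
  (37, [40001374526, 41001427356]), (46, [42401473625, 24601674523]), (14, [42310256347,
  31010236457]), (35, [37101235467, 37110235467]), (14, [42510256347, 31001437265]),
  (13, [38201342756, 39810325476]), (56, [41201256347, 41910657243]), (37, [42910234765,
  25101324657]), (37, [43010234765, 25101324657]), (37, [37701234576, 37710234576]),
  (57, [43301734562, 33701325764]), (57, [29210253674, 37101476325, 41901237564]),
  (67, [43501372465, 28701256734]), (14, [43410256347, 28701437265]), (67, [43410376245,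
  28710562734]), (14, [43610256347, 29510234567]), (45, [43601254367, 28901745326]),
  (47, [44001234765, 25801423657]), (13, [39501342756, 41501253647]), (45, [43901254367,
  25901243567]), (47, [44110473625, 13501473625]), (57, [44201253476, 13101253476]),
  (46, [44401426537, 27401426537]), (67, [38301264537, 38310264537, 25101264537, 25101624537]),
  (47, [44701234765, 23110327456]), (56, [44810256347, 14401256437]), (37, [44810237564,
  1310327645]), (37, [42501342756, 38801734562, 25401374526]), (56, [45101256347, 26701657243]),
  (17, [45210325476, 24710526374]), (47, [45301432765, 3301432765]), (47, [45401432765,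
  3501432765]), (47, [45501432765, 25501432765]), (47, [45601432765, 22101436257]),
  (07, [45701325476, 3601325476]), (56, [45801235647, 2401235647]), (06, [30701234567, 38901234567,
  36501234567, 39701526374]), (56, [46001256347, 23001657243]), (16, [46110234567, 23110437265]),
  (07, [46201325476, 4001325476]), (56, [46301235647, 4001235647]), (16, [46410234567,
  20310526374]), (07, [46501325476, 23101526374]), (16, [46610234567, 20410526374]),
  (07, [46701325476, 4301325476]), (17, [46810325476, 19410526374]), (67, [44501624537, 29501624537,
  4401624537]), (57, [47001532764, 4401532764]), (47, [46301423657, 35501423657, 4401423657]),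
  (47, [46410423657, 27701246357, 35601423657, 35601423675]), (07, [47301325476, 4701325476]),
  (17, [47410325476, 4610325476]), (56, [47501256347, 20101657243]), (56, [47601256347,
  27101657243]), (56, [47701235647, 25001537246]), (07, [47801325476, 25101526374]),
  (57, [47901253476, 19601253476]), (16, [48010234567, 5110234567]), (37, [47001325476,
  34710325476]), (56, [48201256347, 5801256347]), (57, [48301532764, 15901257436]),
  (17, [48410325476, 14310526374]), (47, [48501432765, 18801436257]), (15, [48401235467,
  5601235467]), (56, [48701235647, 18201537246]), (36, [48701326547, 5701326547]),
  (46, [48801426537, 5701426537]), (07, [49001325476, 5601325476]), (25, [45201253647, 5601253647,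
  7601256347, 13701532647]), (56, [49201256347, 29210523674]), (56, [49301256347, 15201657243]),
  (56, [49401235647, 26401537246]), (56, [49501235647, 5801235647]), (16, [49610234567,
  20310526374]), (56, [49701256347, 20001254673]), (56, [49801235647, 5901235647]),
  (56, [49901256347, 13601623754]), (17, [49710234576, 6010234576]), (17, [49810234576,
  6101327645]), (07, [50201325476, 12301526374]), (57, [50301253476, 12810524367]),
  (56, [50401256347, 28101657243]), (47, [50501432765, 20701436257]), (57, [50601253476,
  12701356274]), (56, [50701235647, 12801537246]), (56, [47401362457, 41601253467]),
  (17, [50610234576, 18601253764]), (56, [51001235647, 10301537246]), (56, [51101256347,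
  10201254673]), (15, [51001235467, 9810657243]), (57, [51301253476, 7101253476]),
  (56, [50101634257, 35701524367]), (47, [51501432765, 7301432765]), (17, [51310234576,
  7301327645]), (56, [51701235647, 12401624375]), (37, [51510237456, 10010362745]),
  (15, [45710325476, 32510235467, 26010235467, 33010325476, 33410235467]), (15, [45810235467,
  32710235467, 32810325476, 33210235467, 33510235467]), (46, [45901462735, 32801462735, 32901642753,
  33301462735, 33601462735]), (15, [19310235467, 19310235476, 22310235467, 21810235467, 21810235476,
  31910235467]), (47, [19401247356, 19401247365, 22401247356, 21901247356, 21901247365,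
  32001247356]), (37, [52401537264, 17701473256]), (67, [50301734562, 34401624357]),
  (06, [44801234567, 43801234567, 45001234567]), (57, [52701532764, 7901532764]), (07, [44001325476,
  45901325476, 10701325476, 29801526374]), (67, [50701326745, 50701362745, 31901734526]),
  (14, [52801234567, 8101234567]), (17, [52910324576, 8701746352]), (17, [53010324576,
  13601746352]), (17, [53110324576, 8810345627]), (07, [42001325476, 40801325476, 46101325476]),
  (17, [53310324576, 16410345267]), (15, [35110235467, 35110325476, 8410235467, 8410325476,
  8510235467, 8510325476]), (15, [47510235467, 27810235467, 8510235467, 34710235467, 35010235467]),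
  (15, [47610325476, 32010235467, 34710235467, 34910325476]), (46, [47701462735, 32101642753,
  34801642753, 35001462735]), (46, [47801462735, 32301642753, 35501642753]), (15, [24210235467,
  30110235467, 30110235476, 33010235467, 33010235476]), (07, [29701327645, 33901327645, 26401327645,
  29701327654]), (15, [48110235467, 29110235467, 34710235467, 35210325476, 35410235467]),
  (07, [26501327645, 26501327654, 34101327645, 8501327645, 8501327654, 26601327645]),
  (07, [19401324576, 32301324576, 36101325476, 29201324576]), (15, [48410325476, 29010235467,
  35410235467, 35810325476]), (15, [9610235467, 27410325476, 33010325476, 36010235467,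
  36110235467]), (37, [30301237456, 34501237456, 27001237456, 30301237465]), (37, [25001237456,
  33801237456, 33901237456, 33901237465, 33801237465]), (15, [29810235467, 33310235467, 33310325476,
  35610325476]), (07, [26201324576, 8001324576, 8001325476, 8101324576, 8101325476, 26201325476,
  26301324576, 32001324576]), (46, [30101246357, 7901246357, 7910246357, 8001246357, 8010246357,
  30110246357, 34301246357, 35401246357]), (15, [17710235467, 27510235476, 5110235467, 5110235476,
  17710235476, 25410235467]), (16, [16410264537, 20910264537, 20910265437, 21210264537]),
  (47, [17901247356, 27701247365, 5301247356, 5301247365, 17901247365, 25601247356]),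
  (47, [55601432765, 11501432765]), (17, [55710325476, 3210325476]), (67, [53601362745, 46201372645,
  46901362745]), (37, [41201327645, 20501237465, 12301327645, 23801237564]), (47, [56001432765,
  6401436257]), (17, [56110325476, 5510526374]), (67, [54001326745, 3601367245, 46601326745,
  46601327645]), (15, [55810234576, 39310234567]), (47, [36501432765, 36601432765, 36701432765,
  36710432765]), (46, [20401234657, 20410234657, 35601234657, 36601234657]), (46, [35301423675,
  35310423675, 35701246357, 11301423675]), (57, [34401576324, 34401573624, 34601573624]),
  (47, [36210347256, 35601347256, 24810432765, 36901432765]), (15, [50710235467, 35110235467,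
  31010325476, 37610325476, 38110235467]), (47, [36101234756, 36901234756, 36910234756,
  37201327465]), (37, [26501374526, 28501374526, 28501375426, 35101374526]), (16, [33110234567,
  33110235467, 35110234567, 35210234567]), (56, [32401235647, 32410235647, 32501235647,
  32501326547]), (57, [37501253476, 37601253476, 37701253476, 37710253476]), (56, [32601253467,
  32610253467, 32701235647, 32701524367]), (46, [37701234657, 37801234657, 37901234657,
  37910234657]), (46, [32701246357, 32710246357, 37901246357, 37901423675]), (46, [37901246357,
  38001246357, 38101246357, 38110246357]), (46, [32901234657, 32910234657, 38101234657,
  38101326475]), (47, [33001234756, 37610234756, 38201327465]), (47, [33101432765, 37710432765,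
  38301347256]), (15, [52010235467, 22010325476, 32610235467, 39410235467]), (47, [17710432765,
  32501347256, 38301347256, 34601347256]), (47, [27510347256, 30201432765, 37601347256,
  9901347256]), (07, [18201325476, 27901324576, 40101325476, 33101324576]), (46, [37701234657,
  38910234657, 11201234657, 11110234657]), (47, [33701347256, 38310347256, 38901432765]),
  (15, [34310235476, 32410235467, 34110235467, 34810235476]), (07, [23801325476, 32301325476,
  33501324576, 36801324576]), (46, [52801642753, 37201642753, 33101462735, 39701462735,
  40201642753]), (56, [37501256347, 37510256347, 39201256347, 12601523674]), (47, [38401432765,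
  38410432765, 21801432765, 10710432765]), (47, [23201234756, 39610234756, 39401234756,
  34201234756]), (46, [38101234657, 38110234657, 38501326475, 14101234657]), (47, [38601432765,
  39810432765, 12101432765, 12010432765]), (37, [29501237465, 29501237456, 31801237456,
  39301237456]), (15, [22110235467, 31810235467, 35710235476, 6710235467, 33310235467]),
  (07, [37501325476, 37501324576, 37701324576]), (47, [27901234756, 28510234756, 34801234756,
  36201234756]), (47, [28001432765, 28610432765, 34901432765, 36301432765]), (37, [28301374526,
  31301374526, 28301375426]), (57, [26301573624, 32701573624, 36101576324, 38301573624]),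
  (15, [54110235467, 54110325476, 29610235467]), (56, [40501256347, 29501256347, 29510256347,
  29501523674, 29510523674]), (56, [33201562734, 34901562734, 33201652743, 33601652743]),
  (47, [35501234756, 35601327465, 40401234756, 40801327465]), (57, [20401254376, 30101253476,
  42301254376, 35301253476]), (36, [20601326547, 28201326547, 29201236457, 24001326547]),
  (57, [27001253476, 33401253476, 36801254376, 39001253476]), (47, [23601347256, 37310432765,
  39810347256, 40101432765]), (56, [23701235647, 37410326574, 39910235647, 40201326574]),
  (46, [36201423675, 36210423675, 41401246357, 41401423675]), (36, [21801326547, 24101236457,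
  28601326547, 24501326547]), (47, [21501473625, 21501476325, 27801473625, 30101473625,
  30101476325]), (56, [24101523674, 25401256347, 30110256347]), (07, [21701324576, 21701325476,
  28001324576, 30301324576, 30301325476]), (07, [21401325476, 43301325476, 22901324576,
  38601324576]), (07, [22901324576, 39601325476, 32901324576, 43401325476]), (07, [28001324576,
  34401324576, 37801325476, 40001324576]), (15, [34710235467, 36410235467, 34710325476,
  35110325476]), (56, [21001326574, 30110235647, 41301326574, 14010235647, 30901235647]),
  (57, [21201254376, 32201253476, 28301253476]), (46, [25801246357, 32001246357, 30201426537,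
  25801426537]), (07, [21601327654, 32301327645, 29401327654, 34501327654]), (46, [24001426537,
  24501246357, 25701426537]), (07, [10401764532, 10401735462, 10401743652, 10401756342, 8501764532,
  8501734562, 8501753642, 8501743652]), (37, [53401325476, 31510352746, 19401325476]),
  (06, [49601234567, 40101437265, 55901234567]), (15, [48610325476, 32810325746, 39110342756,
  40710342756]), (15, [62510234576, 18010234567]), (15, [46101235467, 26210243675, 46101235476]),
  (17, [62910234576, 19401327645]), (56, [42901235647, 43301326574, 43501235647]),
  (46, [43401234657, 43210234657, 43601326475]), (56, [35101256347, 42101523674, 43601256347]),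
  (17, [43110325476, 18210324576, 10810325476, 41210324576]), (47, [35301432765, 42201347256,
  43801432765]), (07, [41401324576, 18201324576, 18201325476, 18301324576]), (56, [38701562734,
  41401562734, 42201652743]), (07, [42001324576, 42101325476, 42101324576]), (47, [22901432765,
  44410432765, 44301347256]), (46, [42810234657, 44001234657, 44401234657]), (07, [41101324576,
  41101325476, 42301324576]), (47, [44001432765, 44401347256, 44601432765]), (56, [36110256347,
  43010523674, 44601256347]), (57, [35601573624, 32801576324, 37101576324]), (16, [23110264537,
  40110265437, 40510264537, 25601625473]), (57, [44101253476, 44110253476, 44901253476,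
  45001524367]), (57, [23701253476, 45210253476, 45101524367]), (15, [39810325476, 42510325476,
  18910235467, 16710235467]), (47, [40001347256, 43601347256, 40101432765]), (47, [44410432765,
  44510432765, 39401347256]), (56, [27110523674, 44010256347, 33310256347]), (56, [41710326574,
  44201326574, 45501235647]), (47, [39801234756, 44901234756, 45601234756]), (56, [59401562734,
  43101652743, 38701562734]), (07, [30601324576, 43801324576, 42901325476]), (14, [39310234567,
  43310324576, 46510234567]), (47, [38201473625, 39601473625, 42501476325, 20201473625]),
  (47, [44501234756, 46101234756, 19410234756]), (46, [46301423675, 44801246357, 44810246357]),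
  (47, [37910432765, 45301347256, 42510347256]), (46, [38201426537, 36101426537, 36001246357]),
  (47, [25201234756, 38410234756, 46601327465]), (46, [25301246357, 41401423675, 44910246357]),
  (16, [27810234567, 33210235467, 31510234567, 38910234567]), (57, [33301253476, 33301254376,
  36101253476, 13601253476]), (56, [35410256347, 45901523674, 42901256347]), (07, [33301324576,
  35101324576, 35101325476]), (57, [29601524367, 47201524367, 38701524367, 38710524367]),
  (56, [29701256347, 38801256347, 38810256347, 47301256347]), (57, [26110357246, 38810357246,
  35810532764]), (46, [39310246357, 39710423675, 19201246357]), (56, [26301326574, 47710235647,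
  38301235647]), (15, [61310235467, 36510235467, 48310325476, 48710235467]), (47, [37601473625,
  43501476325, 34001473625]), (07, [40201325476, 38701324576, 35901325476]), (57, [33701253476,
  37201253476, 37301254376]), (46, [29901246357, 36201246357, 35801426537]), (56, [44701652743,
  48701652743, 34501562734]), (46, [61901642753, 29401462735, 48501462735]), (56, [39101523674,
  48501256347, 32901256347]), (45, [29801245367, 30301425637, 31501245367]), (36, [28201236457,
  35101326547, 35201326547]), (37, [34101237456, 40701237465, 38901237465]), (46, [38401426537,
  36501246357, 36401426537]), (17, [34610324576, 38110324576, 38210325476]), (36, [28601236457,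
  33901236457, 28601326547, 37101236457]), (36, [27601236457, 34001326547, 31901326547,
  32101326547]), (37, [35601374526, 35601375426, 40201374526]), (17, [37310325476, 48610324576,
  23610325476, 41410324576]), (46, [29001426537, 32701426537, 29801246357]), (56, [31601256347,
  49501256347, 31610256347]), (05, [39501235467, 48301235467, 48401235467, 48401235476,
  48301235476]), (47, [49701432765, 43701347256, 41310432765]), (56, [31410256347, 32101256347,
  32201256347]), (47, [29101234756, 31510234756, 48801234756]), (47, [31610234756, 32301234756,
  32401234756]), (07, [32001324576, 39301324576, 32001325476, 47901324576]), (47, [29401432765,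
  31810432765, 49101432765]), (57, [29010357246, 34801532764, 46401357246, 50301532764]),
  (07, [29901325476, 32301325476, 44801324576]), (15, [34710235467, 31010325476, 51010235467]),
  (47, [32210432765, 45401432765, 33001432765]), (57, [29301253476, 49801524367, 22401524367]),
  (47, [32901432765, 49801432765, 49901432765]), (07, [32601325476, 41801325476, 45301324576]),
  (07, [34801325476, 47701324576, 45401324576]), (46, [32901246357, 37601426537, 38801426537]),
  (57, [32201254376, 37601253476, 35901254376, 43301254376]), (36, [31401236457, 31401326547,
  36401236457]), (36, [31001326547, 31401236457, 37901236457]), (67, [37901263475, 37901264375,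
  42501263475]), (46, [39701246357, 41101246357, 33401426537]), (57, [42501573624, 49301576324,
  40901573624, 53101576324]), (47, [33801247356, 43701247356, 47601247365, 45201247356]),
  (67, [31401675423, 45401674523, 45101675423, 42901674523]), (07, [37801324576, 48801325476,
  37901324576]), (07, [34101327645, 34301327654, 47901327654, 51601327645]), (07, [37601327645,
  44201327654, 42401327654]), (07, [34201324576, 44601324576, 34201325476, 50101324576]),
  (16, [42210234567, 48110235467, 38610234567]), (56, [34010256347, 40301256347, 34001523674,
  52401256347]), (56, [40401256347, 51610523674, 51701523674]), (46, [52601234657, 35001234657,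
  52501326475]), (36, [32401326547, 42401236457, 41001236457, 24601236457]), (16, [31310264537,
  33110265437, 48501624573]), (37, [38901374526, 39401374526, 49801375426]), (45, [32701425637,
  42701245367, 41301245367, 40201245367]), (57, [32701253476, 34901253476, 44501254376]),
  (67, [39101263475, 39101264375, 39501263475]), (36, [33001236457, 41501326547, 33701326547,
  33801326547]), (16, [28701234657, 36601243657, 38701234657]), (15, [36110235467, 46410235467,
  37210325476, 54910235467]), (46, [37001426537, 35001426537, 36501246357]), (36, [33401326547,
  37101326547, 42001236457, 22701326547]), (14, [39910234567, 41810324576, 52010234567,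
  52010324576]), (07, [33101325476, 38701324576, 51901324576]), (07, [32901324576, 35801325476,
  33601325476, 40001324576]), (07, [33801234567, 41401234567, 33801324657, 37201234567]),
  (37, [33101375426, 36001374526, 40201375426, 46401374526]), (56, [35001652743, 36901652743,
  54901652743, 38001562734]), (46, [34801246357, 39501246357, 34901426537, 34901246357]),
  (46, [37401426537, 37901246357, 35901246357]), (16, [35501624573, 47310265437, 47310264537,
  50310264537]), (46, [33301426537, 39601246357, 37601246357, 41301246357]), (46, [34501426537,
  41401246357, 35301246357]), (56, [34210256347, 39501256347, 55001256347]), (26, [30201264537,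
  30201265437, 19701264537, 19710264537, 17001264537]), (06, [61801234567, 36901437265,
  52101526374]), (46, [47501423675, 55101246357, 55201423675]), (46, [54501234657, 54510234657,
  29901234657, 55401326475]), (46, [54010423675, 55301423675, 55401423675]), (46, [54110423675,
  54501423675, 55401423675]), (56, [47901256347, 55501523674, 55601256347]), (46, [54310246357,
  55601246357, 55701246357]), (47, [50001432765, 55901347256, 54901432765]), (47, [35210432765,
  55701347256, 51401432765, 52101347256]), (46, [34701246357, 48310246357, 50801246357]),
  (57, [35301576324, 53901573624, 53401573624]), (56, [55201523674, 54701523674, 55310523674]),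
  (56, [35601256347, 56201523674, 38801523674]), (47, [38601234756, 51301234756, 48101234756]),
  (56, [35801256347, 50601256347, 31101523674, 55801256347]), (56, [52601256347, 52601523674,
  56501256347, 56501523674]), (17, [38510325476, 45110324576, 54210324576]), (67, [36001675423,
  47901674523, 53501674523]), (56, [39401523674, 55310523674, 55401523674]), (57, [55501357246,
  44901357246, 56110357246]), (16, [50201625473, 50210265437, 52810264537]), (15, [51110235467,
  54210325476, 51510235467]), (56, [36601256347, 36610256347, 57301523674]), (56, [50401562734,
  54001652743, 50601562734]), (13, [50201324576, 50201325476, 53210234567]), (37, [42301375426,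
  42401375426, 51201374526]), (35, [71401532764, 51601532764, 58901352746, 59001352746]),
  (47, [56801234756, 57001234756, 57010234756]), (05, [47901235467, 48001235467, 48001235476]),
  (07, [44301325476, 47901324576, 47901325476]), (15, [45110235476, 30210235467, 50110235467,
  47610235467]), (56, [37001523674, 57401523674, 46901256347]), (15, [40910235467, 48910235467,
  56410325476, 42010325476]), (56, [46310235647, 58101326574, 47101235647]), (56, [50010256347,
  57710523674, 57501523674]), (57, [44901253476, 45101253476, 51101254376]), (47, [40210347256,
  50310432765, 53510347256]), (56, [46710256347, 58501523674, 47501256347]), (57, [37601357246,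
  46810357246, 53801532764]), (56, [72701562734, 38801562734, 49501562734, 53001652743]),
  (47, [46101247365, 30201247356, 51101247356, 51201247356]), (47, [40701432765, 47110432765,
  51110432765]), (15, [48210325476, 29810325476, 60710235467, 26010235467, 29910235467]),
  (15, [51410235467, 58310235476, 29810235467, 23410235467, 51510235467]), (46, [43301246357,
  34101246357, 51410246357, 54301246357]), (47, [38910234756, 47501234756, 58210327465]),
  (56, [38510523674, 43510256347, 48410523674]), (15, [46810235476, 30910235467, 51810235467,
  51910235467]), (46, [59101423675, 30110423675, 34501423675, 60001246357]), (07, [57701324576,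
  51301325476, 52401325476, 23801324576]), (57, [38801253476, 30910253476, 60201524367,
  31801253476]), (07, [40601234567, 45101234567, 28701324657, 43301234567, 45101324657]),
  (67, [39101634257, 49010362475, 59510634257]), (46, [44401426537, 52201246357, 28801246357,
  50101246357]), (47, [42201347256, 51701432765, 35110432765, 48401432765]), (37, [47101374526,
  57801375426, 57401374526]), (47, [52201432765, 45310432765, 48610432765]), (57, [39501357246,
  48710532764, 39501532764]), (47, [59401432765, 52510432765, 52601347256]), (47, [39701234756,
  33401234756, 61101327465, 33510234756]), (56, [60101523674, 51910523674, 53410256347]),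
  (46, [44101246357, 50901246357, 42601426537]), (07, [42601327645, 45501327645, 48201327654]),
  (15, [44710235476, 51810235476, 44910235467, 55810235467]), (57, [47501253476, 50901254376,
  60901253476]), (46, [46801246357, 52301246357, 52301426537, 48201246357]), (16, [41101234657,
  49301243657, 41601234657]), (47, [61901327465, 25901234756, 25910234756, 34501234756,
  34510234756]), (07, [43701324576, 43701325476, 59401324576]), (15, [42710325476, 60210235467,
  60110235467]), (67, [41410362475, 44501362475, 44601362475]), (47, [57110432765, 57701347256,
  60601347256]), (56, [43801256347, 56401256347, 61001256347, 61501256347]), (17, [48210325476,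
  52310324576, 48710324576, 60310324576]), (47, [47101347256, 56701347256, 61710432765]),
  (56, [44110326574, 61101326574, 62701326574]), (46, [47901246357, 49501426537, 32201246357]),
  (46, [42901246357, 44201426537, 48001246357]), (46, [45301326475, 62901234657, 32510326475]),
  (07, [44101324576, 58801325476, 47801325476]), (37, [31901237456, 32201237465, 62701237456,
  55201237456]), (47, [61510327465, 63201234756, 36310234756]), (46, [45010246357, 37410423675,
  51210423675]), (15, [46010235467, 54010235467, 57710325476, 47110325476]), (56, [57701523674,
  61901523674, 62001523674]), (46, [29901462735, 44801642753, 57601462735]), (56, [56301652743,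
  56601562734, 64301652743, 56701652743]), (14, [42210234567, 47510324576, 58110234567,
  54310234567]), (47, [46401347256, 55401432765, 52610432765]), (07, [45801325476, 61201324576,
  50301325476]), (15, [77810325476, 43910235467, 33510235467]), (47, [64101234756, 55810234756,
  55901234756]), (57, [46301576324, 62101573624, 35601573624]), (47, [43201327465, 48201234756,
  58601234756]), (46, [47601426537, 51801246357, 32901426537, 33701246357, 56301426537]),
  (47, [35301473625, 60401476325, 50901473625]), (15, [48410235467, 53910235467, 55310325476,
  34610235467]), (46, [52201234657, 63110234657, 59610326475]), (15, [43110235467, 51910235467,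
  54410235476, 60510235476]), (57, [56201357246, 64110357246, 65001357246, 56710532764]),
  (46, [45201246357, 52901426537, 54801246357]), (57, [44001357246, 56910357246, 63501357246]),
  (46, [60101234657, 63810326475, 63701326475, 60110326475]), (15, [43810235467, 59710325476,
  51810325476]), (35, [79201352746, 79201532764, 54701352746]), (56, [48001256347, 50201523674,
  53501256347]), (57, [44510357246, 64310357246, 65210532764]), (36, [45501236457, 55501236457,
  45501326547]), (37, [62701374526, 63101375426, 44801374526]), (15, [34710235467, 51610325476,
  54010235467, 60310325476]), (47, [53101247365, 34901247356, 38201247365, 58101247356]),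
  (56, [45510523674, 54101523674, 64810256347]), (16, [55710234567, 64110234567, 55710235467]),
  (36, [46101236457, 51601236457, 46901326547]), (57, [52501573624, 64101576324, 57401573624]),
  (57, [46201573624, 63801573624, 34901576324, 37801576324]), (37, [48501374526, 55101375426,
  52901375426, 58901374526]), (67, [53101674523, 57701675423, 57701674523]), (07, [46001327654,
  63201327645, 66501327645]), (37, [46101237465, 63301237456, 66601237456]), (37, [50401237465,
  57201237465, 35301237456]), (37, [60001237456, 50501237465, 57601237465]), (05, [45701325476,
  60201235467, 68701325476]), (37, [29201234756, 29201237465, 29201325647, 29201326574, 29210234756,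
  29210237465, 29210325647, 29210326574, 29301234765, 29301237456]), (37, [78101325476, 49701352746,
  49001352746]), (57, [46401734562, 49801734562, 28701756342, 42201734562, 52201375426]),
  (46, [46401234657, 67701326475, 46401326475]), (47, [67701432765, 56310432765, 59510432765]),
  (56, [46701523674, 51701256347, 6501256473, 34301256347]), (56, [47310256347, 67901256347,
  67001523674]), (46, [68101234657, 31501342765, 38901234657, 38910234657]), (46, [42101423675,
  63101423675, 68101423675]), (46, [66610246357, 66801246357, 68301246357]), (46, [68501234657,
  34601342765, 42001234657, 32101234657]), (14, [62810324576, 65510234567, 26910437265]),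
  (47, [52401432765, 68810432765, 68601432765, 63401432765]), (56, [56601256347, 67101523674,
  41910523674, 68801256347]), (05, [47201325476, 65801235467, 51401235467]), (57, [47710357246,
  52701532764, 48210532764]), (46, [52801234657, 43601234657, 60910234657, 63801234657]),
  (15, [62110235467, 35610235467, 35710325476, 39210325476, 69610325476]), (07, [68001327654,
  59501327654, 39201327645]), (56, [50810326574, 67701326574, 41001235647]), (07, [54201324576,
  40901325476, 38001324576, 40901324576, 60801325476]), (56, [50201562734, 66101652743,
  52101562734]), (16, [56510326745, 65510326745, 26410326745]), (47, [49001347256, 63810347256,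
  69610432765, 65910432765]), (16, [51910326745, 56810326745, 33310326745]), (47, [48710234756,
  68201327465, 48701327465]), (37, [49501237456, 57101237465, 58801237456]), (36, [55301236457,
  56901236457, 39601326547]), (46, [52101426537, 62001246357, 58401426537]), (15, [45601234567,
  41301234567, 41201243567, 50201234567, 55601234567]), (47, [49901247356, 69301247365, 30901243756,
  30901243765, 32601243756]), (57, [51601254376, 58901253476, 59801253476]), (46, [60301426537,
  53501246357, 58401426537]), (47, [50201247365, 66101247365, 54901247356]), (37, [57701237465,
  55001237456, 52101237456]), (16, [50301234657, 41901234657, 50801234657, 38901243657]),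
  (47, [54801432765, 44901432765, 43001432765]), (07, [52401327645, 66301327654, 56601327645]),
  (57, [53601357246, 55001532764, 59101357246]), (47, [50010432765, 65401347256, 59810432765]),
  (46, [63701234657, 41010234657, 66210326475]), (47, [53801247356, 61601247365, 67401247356]),
  (56, [50410256347, 55410256347, 66410256347, 44101256347]), (15, [47001234567, 42701234567,
  39701243567, 51601234567, 57001234567]), (46, [71801234657, 46401326475, 44801234657, 44810234657,
  46410326475]), (15, [54510235467, 62510325476, 44110235467]), (37, [58001374526, 60101374526,
  60101375426]), (57, [51301253476, 60501254376, 51301254376]), (47, [51701247356, 59101247356,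
  68601247365]), (17, [60710324576, 63210325476, 63410324576]), (07, [58601324576, 66001325476,
  66001324576]), (46, [71501234657, 46201234657, 46201326475, 72501234657]), (47, [51410347256,
  64901432765, 51910432765]), (46, [52801246357, 57601246357, 56701426537, 57801246357]),
  (16, [57210234567, 61210235467, 59110234567]), (56, [51701523674, 65210256347, 52201256347]),
  (57, [71001253476, 59301254376, 56901254376]), (37, [52601237456, 43401237456, 63201237465,
  72701237456]), (47, [52701247356, 55501247356, 63301247365, 41401247356]), (56, [39601562734,
  45601562734, 67101652743]), (47, [41001243756, 41010243756, 35301425637, 15401243756, 26801243756,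
  26801243765, 35301426537]), (57, [41001534276, 32001534276, 32001534726, 33701534276,
  30801543276]), (26, [80110243657, 50201234567, 72001243657]), (47, [87301246357, 87310573624]),
  (47, [68001234756, 65710234756, 37201725364]), (46, [52610326475, 26601342765, 74101234657,
  30901234657, 46901326475]), (47, [52810347256, 48101432765, 64801347256]), (56, [52910256347,
  48201523674, 52901523674]), (56, [58010256347, 73410523674, 74201523674]), (47, [69101234756,
  69201234756, 38401234756, 47710234756]), (47, [63901247356, 58501247365, 43301247356]),
  (57, [67001253476, 71601254376, 15501254376]), (47, [49801723564, 66510234756, 19410327465]),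
  (47, [53401327465, 53501234756, 24601432657, 10801273546]), (46, [53510326475, 44401234657,
  33610437256, 19601234657, 46201326475]), (05, [57201235476, 43701235476, 31601235467, 38801235467,
  64401235476, 66901235467]), (46, [75001234657, 45201326475, 46401326475, 46810234657,
  47010326475]), (47, [53801327465, 42310234756, 67010234756, 48210234756]), (05, [31801235467,
  45501235476, 48701235467, 74101235476]), (46, [68301462735, 56001642753, 68501462735]),
  (47, [54901247365, 43501247365, 45201247356]), (47, [55001247356, 32101247356, 43601247365]),
  (47, [55101247365, 32201247356, 43701247365]), (56, [75201256347, 57301256347, 57310523674,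
  58110523674]), (57, [51001523467, 39001253476, 39201253476, 43701253476, 43710253476]),
  (57, [37301253476, 37301523467, 26201253476, 26201254376, 26210523467, 26210524367]),
  (46, [51201462735, 39201642753, 39401642753, 43901642753, 43910642753]), (37, [37501374526,
  37501734562, 26401374526, 26401375426, 26410734562, 26410735462]), (37, [26010374526, 26010375426,
  10410374526, 13710375426, 10401375426, 13701374526]), (47, [41901243756, 41910243756, 32701425637,
  38501243756, 38501247356]), (35, [51601352746, 51601532764, 39801352746, 44201352746,
  44210352746]), (37, [51701374526, 42001374526, 42010374526, 38601374526, 21201734562]),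
  (47, [42001243756, 42010243756, 33001425637, 37001243756, 8401243756, 8401247356]),
  (37, [51901375426, 42710734562, 39301374526]), (16, [42610624573, 31910625473, 39510624573,
  39910624573, 32710624573, 32710625473, 42710625473]), (14, [44610423675, 27710462735, 27710473625,
  42810423675, 37710423675, 37710432765, 42810432765, 44610432765]), (37, [35701234756, 35701325674,
  35701234765, 35710237465, 35710234756, 35701325647, 35710325647, 35710325674]), (47, [37001243765,
  35801425673, 35810426573, 37010243756, 37001243756, 37010243765]), (57, [34701543276, 27801534276,
  23801534276, 27801543276, 14001534726, 30301534276, 28601543276]), (46, [51901326475, 41010234657,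
  41010326475, 51901234657]), (07, [74901324576, 75001324576, 75001325476, 51801324576]),
  (47, [56201432765, 59010347256, 59110347256, 59101432765]), (07, [41801324576, 41801325476,
  75101324576]), (17, [73610327645, 74010327645, 31210362457, 41310327645]), (47, [56501327465,
  66510234756, 23901273546]), (57, [30601245736, 78110253476, 10301253476, 72810253476]),
  (57, [47601253476, 10401253476, 35101253476, 72901253476, 78201253476]), (47, [77910234756,
  78310234756, 35001234756, 4401234756]), (47, [50601234756, 78010234756, 4510234756, 10601234756]),
  (47, [78101234756, 35201234756, 50801234756, 35401234756]), (47, [78601234756, 51801234756,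
  10801234756, 35510234756]), (46, [57210234657, 77701326475, 21101263547, 10901234657]),
  (47, [57301327465, 4801234756, 37401725364, 48201327465]), (47, [70610234756, 53901275346,
  78510234756, 11101234756]), (46, [61201326475, 51201234657, 53401234657, 11101234657,
  45810234657]), (56, [57610326574, 70101235647, 28810623475]), (46, [70901423675, 23801246357,
  54201642753]), (37, [29501234756, 29510234756, 21201234756, 21201234765, 23701234756, 23701234765,
  35501234756]), (37, [54401374526, 31901374526, 32801374526, 32810374526]), (56, [54501562734,
  17201562734, 26701562734, 11310562734, 19501562734, 43901567234]), (23, [32101324576, 9601325476,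
  27101235467, 35201234567, 10801235467, 18501234567]), (37, [40601735462, 41501374526, 40610734562,
  38901734562]), (47, [43001746352, 37510743652, 27001473625, 15701473625, 35410743652]),
  (25, [38501526374, 22910253647, 23810253647, 35701253647, 35401253647]), (46, [55001462735,
  38601462735, 47701642753, 47710642753]), (57, [37801254376, 34401253476, 19010253476, 16010523467,
  31501523467, 29701524367]), (24, [34501243657, 40601243657, 43401243657, 36010243657, 36201243657,
  36210243657]), (57, [43501756342, 34101753642, 35610573624, 24110573624, 36301753642]),
  (47, [43601473625, 29901743652, 29910743652, 40801476325, 33810746352, 38401743652]),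
  (57, [24301576324, 34301756342, 29801753642, 40901756342, 17801573624, 22210573624]),
  (57, [29901756342, 38610573624, 34401753642, 34401756342, 30201576324, 30201573624]),
  (57, [48401753642, 35001756342, 23401573624, 12601576324, 18510753642]), (13, [45010324576,
  32410325476, 46510325476, 40210325476, 36510324576, 11010325476]), (25, [48501253647, 35210253647,
  38710253647, 21101256347, 23710253647]), (13, [46610324576, 33010342756, 27910324576, 46710324576,
  24610324576, 32610324576, 36710325476, 46710325476]), (25, [48701253647, 46210253647, 35401253647,
  45501256347]), (23, [35501234567, 34301325476, 35510235467, 15210235467, 22001234567,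
  34301324576]), (56, [48901652743, 28501562734, 13110562734, 45701567234, 47101562734]),
  (46, [56401462735, 27610462735, 49101462735, 17610462735]), (37, [46010374526, 47301734562,
  47301735462, 15510374526]), (37, [56601374526, 40201375426, 22601734562, 25601734562,
  35910734562]), (46, [49401462735, 11710647253, 25810462735, 17510462735, 25110462735,
  47501462735]), (37, [56801375426, 17710375426, 15201374526, 24501374526, 40401375426]),
  (13, [44410324576, 35610342756, 17310374526, 35610352746, 36910324576, 36910325476, 47610324576,
  47610325476]), (26, [49701264537, 47110265437, 13401264537, 4301264537, 25101264537,
  25701264537]), (46, [57101642753, 38201462735, 47101462735, 47110462735, 35501462735]),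
  (47, [47210473625, 40601746352, 16201473625, 34601743652, 35001743652]), (56, [49910562734,
  35401567234, 43201657243, 19601652743]), (25, [57401523674, 4710256347, 25401253647, 40801523674,
  42210253647, 47401253647]), (15, [50010523674, 45010573624, 29310562734, 48210523674, 18610523674,
  30410532764, 30610532764]), (47, [12610746352, 32101476325, 25301746352, 45801473625,
  43901743652]), (57, [50401753642, 17401756342, 47210573624, 48501756342]), (15, [50310523674,
  29610562734, 29610576324, 48510523674, 43410523674, 43410532764, 48510532764, 50310532764]),
  (16, [28310642753, 36610624573, 36610647253, 18310642753, 29710642753, 31010642753, 36910647253,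
  48610647253]), (37, [48801735462, 34410374526, 38310374526, 33101375426, 38201375426,
  44301375426]), (37, [48310325647, 44701326574, 18001325647, 30710325647, 33310325647]),
  (23, [43301324576, 35901234567, 33701235467, 32801234567, 35910234567]), (06, [16501642753,
  37001657243, 45801624573, 19301624573, 19301625473, 31201624573, 31201625473]), (25, [51001253647,
  44701526374, 48501253647, 19210253647]), (57, [43601523467, 37801254376, 36601524367, 41510253476,
  44401254376]), (37, [42101325647, 45201234756, 26910234756, 21501234756, 33501325647, 39801325647,
  39901234756, 39910234756, 42110325647]), (37, [42710234756, 42210234756, 27010326574, 22001325647,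
  42701234756, 45401325647]), (17, [51110234567, 17710234567, 17710243567, 28810243567, 32410243567,
  18410234567, 48510234567]), (47, [51301243756, 42410243756, 51310243756, 21801425673,
  33701247365]), (57, [46801524367, 46401523467, 24501523467, 42001524367, 43201254376]),
  (57, [18801253476, 39601253476, 39601254376, 21901253476, 18801254376, 39701253476]),
  (57, [46001523467, 45101254376, 45110253476, 45401523467]), (07, [51801735462, 29401734562,
  20401746352, 26501734562, 26601746352, 32201743652, 38001735462, 39301764532, 43401743652,
  51801765432]), (14, [51910423675, 35010462735, 35010473625, 35910432765, 32310423675, 32510423675,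
  32510432765, 51910432765]), (37, [51901325647, 43010325647, 51910325647, 22401234765,
  34301326574]), (57, [45501524367, 45510523467, 46401253476, 43801523467]), (57, [37201523467,
  37201524367, 26410523467, 42701523467]), (57, [45201253476, 47210523467, 42801523467, 14801523467,
  16001254376, 27301524367]), (47, [59901743652, 46101743652, 34401473625, 34410473625,
  35201743652]), (56, [42810562734, 47710652743, 25001652743, 38101567234, 45901657243]),
  (67, [60101264375, 38501263475, 43710263475, 49501263475, 38510263475]), (57, [37701253476,
  15210254376, 21110254376, 35201523467, 16101523467]), (46, [60301642753, 37801462735,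
  49701467235]), (25, [60401523674, 7701253647, 7710253647, 35701526374]), (47, [11501432765,
  50010473625, 26510743652, 36910476325, 37910743652]), (57, [20301253476, 27001254376, 47101254376,
  45201253476, 21301253476, 32801523467, 32901524367]), (56, [20401562734, 46610657243, 46201562734,
  48901562734]), (57, [50310573624, 45601753642, 35301753642, 40101753642, 35301756342]),
  (07, [16101743652, 26601735462, 39601735462, 10301734562, 13601734562, 21301734562, 34001734562,
  51601735462]), (57, [51101253476, 17101254376, 37401523467, 22301253476, 36910524367]),
  (07, [44301743652, 38101756342, 22101743652, 22101753642, 38101746352]), (37, [43410325647,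
  45201234756, 27510325647, 45901325647, 48801325674, 47801326574]), (47, [43510243756, 48901425673,
  26401425637, 43810247365, 27901243756]), (47, [53801243756, 46101425637, 48010426573, 49001425673,
  45410243756]), (26, [40801264537, 37001624573, 39210624573, 37010625473, 39201625473,
  40001265437]), (47, [54001425637, 46301243756, 48210247365, 49201243765, 45610425637]),
  (27, [54001234576, 33401243756, 20601243576, 35301243576, 21301234576, 35001234576, 51401234576]),
  (57, [50901534276, 37801534276, 37801534726, 46801543276, 38101534276, 45701534276, 45701534726,
  51501534276]), (47, [14401452376, 34901425376, 51001425376, 46901452376, 33201425376, 25401425376,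
  33601425736]), (47, [37210243756, 51310243756, 47201425637, 23801425637, 23801426537]),
  (07, [51201234567, 45801234567, 44401243567, 35101234567, 35301234567, 38801234567, 46001234567]),
  (37, [52601325647, 45701234756, 52610325647, 49201325674]), (07, [42201764532, 32401734562,
  35201743652, 29501734562, 38801746352, 46801753642, 29401743652]), (67, [50201264375, 50401263475,
  50210264375, 50201623457, 50210623457, 50401624357]), (47, [22201473625, 46101746352, 37501476325,
  37801743652, 48701743652]), (37, [44810325647, 37410326574, 47301325647, 25501234765, 37401326574,
  40801325674, 46101325647]), (57, [45710253476, 46301254376, 37701524367, 38001253476,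
  45401523467]), (57, [49601523467, 32601523467, 37401523467, 28301523467, 28310523467,
  49701523467]), (57, [22610253476, 31801253476, 31801254376, 25701253476, 26801253476, 26801254376,
  45901523467]), (47, [26401243756, 42110243756, 46501243756, 26410243756, 29901243756, 42101243756,
  42201243756, 42210243756, 48201243756]), (57, [40601523467, 27301253476, 22801253476, 32801673452,
  13801253476, 47301524367]), (37, [53410325647, 26601325647, 31501325647, 18901325647, 29501325647,
  42401325647]), (47, [55901473625, 52810473625, 31110473625, 37601473625, 41101473625]),
  (57, [23101253476, 34101524367, 46801253476, 34110524367, 38701254376]), (56, [63501652743,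
  23201652743, 41310652743, 25801562734]), (56, [51801562734, 24501657243, 38701657243, 46610652743,
  49001567234]), (07, [56001234567, 46001234567, 47501234567, 47501243567, 41601234567,
  45801243567]), (57, [23501524367, 30201523467, 50301523467, 48401524367, 24510253476, 36001254376,
  36101253476]), (47, [46410426573, 42101243765, 46410247365, 42101425673]), (57, [41501523467,
  19001524367, 30401523467, 36501253476, 28201254376, 46701253476]), (17, [56410243567, 28410243567,
  36110243567, 30210234567, 40910243567]), (57, [25101523467, 38910523467, 50101254376, 22701253476,
  23201523467, 39301524367, 40610523467]), (47, [56701425637, 53601243756, 24201425637, 37010243756,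
  50901426573]), (57, [56701543276, 16901534276, 49401534276, 27901543276, 35401534726, 35501543726,
  36101543726, 53501534276]), (07, [48901743652, 24601746352, 25501734562, 25501735462, 34901734562,
  36401743652, 50101735462, 57001756342]), (07, [56901243567, 40701243567, 27601234567, 14901243567,
  34501243567, 34601243567, 53701234567, 54401234567]), (07, [53901734562, 17401753642, 25701743652,
  35101743652, 49101734562, 50301746352, 57201765432]), (57, [42810253476, 45810253476, 49401254376,
  25710523467, 41201523467]), (57, [24610253476, 51010523467, 30701254376, 28701254376, 30801523467,
  39101253476, 43001524367, 47901523467]), (57, [25001524367, 20010253476, 35710524367, 34801523467,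
  30810253476]), (57, [42601523467, 20110524367, 26010524367, 40101253476, 21001253476]),
  (17, [57710734562, 45110765432, 45110735462, 14610753642, 32410734562, 41710753642, 41710756342,
  49710743652]), (47, [55510243756, 50001243756, 52001243765, 31610243756, 52901243756]),
  (37, [48401734562, 51501374526, 42801374526, 44701735462, 24701374526, 50801375426]),
  (07, [57801234567, 47801234567, 24101234657, 36501234567, 39101243567, 41201243567]),
  (57, [57901534276, 43901534276, 35901543276, 25801534276, 31701534276, 37001534276, 47701543276]),
  (13, [50110324576, 20910324576, 42310324576, 50110375426, 46410352746, 50210324576]),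
  (37, [58201325647, 58210325647, 47001325647, 44010325647, 44010325674, 52501234756, 52501237456]),
  (17, [58210234567, 20610243567, 20510243567, 49710243567, 27810234567, 29410234567, 37210234567]),
  (17, [55810234567, 41710243567, 39610243567, 39010234567, 31610234657, 37610243567]),
  (17, [58410234567, 17710234567, 15210243657, 15310243567, 15410234657, 17610234567, 19310234567,
  20510234567, 20510234657, 23710243567]), (57, [25901253476, 50801254376, 46301523467, 37401253476,
  38601253476, 48901253476, 49201253476]), (37, [49801325647, 25701325647, 29601325647, 16701325674,
  21701325647, 21810325647, 26801234756, 28401325647, 34601326574, 46701234756]), (07, [58701234567,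
  18401243567, 40101234567, 36301234567, 36301243567, 36401234567, 39801243567, 44301234567]),
  (67, [48501236745, 48510236745, 14801236745, 14801237645, 14801246735, 14801247635, 15201236745,
  15201246735, 15201263475, 15201273465]), (47, [50110247356, 51301243765, 30010426573,
  48810243756]), (67, [66701263475, 54501624357, 39510263475, 23501263475]), (57, [44301253476,
  55001253476, 47901253476, 21801524367, 21810524367]), (47, [46101243756, 49401247365, 46110243756,
  55001243756, 33801425673]), (67, [67001623457, 36101263475, 51201263475, 50601624357]),
  (37, [42310237456, 56410237456, 52301325674, 16801325674, 16801326574]), (57, [58201253476,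
  55010253476, 48301253476, 36110524367]), (57, [44801523467, 31501523467, 55501253476, 42601523467,
  32101524367]), (47, [55501243756, 24401243765, 20701425637, 29201243756, 24410243765, 34001243756,
  34010243756, 34301243756]), (57, [45001524367, 51701253476, 36601254376, 34901253476,
  32301523467]), (57, [52201524367, 42601254376, 42301523467, 47001254376, 51801253476]),
  (47, [52410425637, 29210243765, 29501425673, 49910243756, 28001243756]), (57, [22810524367,
  55610523467, 28701524367, 29210523467]), (37, [52801325674, 52810325674, 34801325674, 53101234756,
  15301237456, 29701234756]), (67, [55810624357, 30701623457, 32010264375, 27110624357]),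
  (47, [50610247356, 55701247356, 53001425673, 47310425673]), (37, [31610237456, 50701325674,
  53101325674, 53101237456, 31601325674]), (37, [55901325674, 53201237456, 50810325674,
  47510237456]), (37, [31801237456, 53301237456, 30201234756, 51901237456, 53301325674]),
  (47, [53401425637, 53410425637, 35401425637, 53701243756, 15901243756, 30301247356]),
  (67, [37701623457, 61301623457, 59410623457, 56410623457]), (67, [37801624357, 32701623457,
  48101623457, 48110623457, 58101263475]), (67, [61501623457, 28510623457, 32810624357,
  37210623457]), (67, [61601623457, 29701624357, 58301264375, 41401623457]), (67, [69001263475,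
  28101624357, 48410624357, 41510623457]), (47, [54001425637, 41701247356, 22410425673, 34210425673,
  48201243765]), (56, [69201652743, 38301562734, 53401562734, 52801657243]), (25, [54101253647,
  38601253647, 16610253647, 38401253647, 16410253647, 38301253647, 38501256347]), (57, [69401573624,
  50410756342, 59001573624, 16601753642]), (24, [59610243657, 60401243657, 46801246357, 16801243657,
  38801246357]), (46, [48901642753, 50501462735, 57401467235, 16810642753, 16901642753, 28101642753,
  30201642753, 53801642753]), (47, [54501743652, 38901743652, 38701743652, 38901746352, 16810743652,
  50510743652]), (23, [29501234567, 56301234567, 43610325476, 46201324576, 44001235467,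
  52801234567]), (23, [49201325476, 29401235467, 57301234567, 52901325476, 46301324576, 43701234567,
  43701235467]), (25, [70001523674, 49401253647, 17310256347, 25010526374]), (24, [54710243657,
  56901243657, 39901243657, 27001243657, 57001243657]), (47, [57601473625, 54401743652, 58001473625,
  53201473625, 54801476325]), (37, [61101735462, 61101734562, 59801374526, 56501374526]),
  (26, [31310625473, 48410264537, 50901264537, 34010265437]), (23, [31401235467, 58701234567,
  31701234567, 49410234567, 34101235467]), (25, [63310253647, 54201526374, 56901526374, 17910253647,
  38701253647]), (23, [60810234567, 56901324576, 48710234567, 27601324576, 37101234567]),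
  (57, [63510753642, 63501756342, 31701573624]), (26, [61010264537, 36701265437, 37110624573,
  50210264537]), (37, [63410234756, 53510326574, 55901325674, 26101325647, 55701325647]),
  (37, [63501234756, 34510234756, 56001325674, 16901237465, 46001325647]), (37, [61501374526,
  49601375426, 29701735462, 37901374526, 38901374526]), (56, [64001652743, 30401562734, 54310562734,
  40501657243]), (46, [60910462735, 46001462735, 61001462735, 43601462735]), (57, [61010573624,
  35510753642, 22110573624, 35510756342, 22110576324, 31201753642, 34310753642]), (57, [61110573624,
  35610573624, 39301573624, 6310235467, 50910753642, 50910756342]), (37, [49201734562, 57801374526,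
  38101374526, 26701735462]), (25, [64410253647, 49301253647, 19001253647, 19110253647]),
  (07, [48901746352, 56301753642, 59401734562, 32901743652, 43801743652, 51801765432]),
  (07, [55201756342, 59501734562, 33001743652, 51001743652, 33001753642]), (37, [57601734562,
  55110734562, 58610375426, 46510374526, 31110375426]), (56, [64901652743, 31310657243, 61801567234,
  24310562734, 30910652743]), (47, [54810425637, 59901425637, 57201243756, 51510243756]),
  (47, [57301243756, 29410426537, 59101243765, 19401243756, 22001243756, 29001243756, 60501243756]),
  (47, [64901425637, 55010243756, 37401243765, 32401243756]), (47, [65001425637, 36010243756,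
  34401243765, 45210425637]), (57, [63710253476, 33601254376, 31801254376, 33901253476,
  18401254376]), (57, [62910253476, 63801253476, 31301253476, 40601253476, 45001253476,
  58301253476]), (47, [62210425637, 55410247365, 57801243756, 59501243756, 19801243756]),
  (37, [63301375426, 40710374526, 63301374526, 47701374526]), (56, [65701562734, 52410652743,
  20210652743, 41601652743, 47301652743]), (23, [34101325476, 52101235467, 50901324576, 29210234567,
  59701325476]), (47, [48501425637, 30301426537, 28101243756, 41601243756, 23301243756,
  52401243756]), (37, [33101374526, 33101734562, 58501374526, 59301735462, 42501374526]),
  (37, [64301734562, 61301374526, 34301375426, 48201374526]), (37, [63101374526, 58201375426,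
  57801735462, 54501374526]), (56, [37710562734, 36401657243, 61510652743, 32810652743]),
  (56, [56810562734, 58410567234, 54710562734, 58001657243, 30610562734]), (47, [66501473625,
  48501476325, 51201746352, 46710743652]), (34, [66601432765, 50910342756, 42001342756, 23001437265,
  30101432765, 63910432765]), (57, [51601253476, 43201254376, 51601524367, 57501523467]),
  (37, [64501374526, 52610374526, 60501374526, 63710374526, 50610374526]), (25, [57001253647,
  48901253647, 48710253647, 54410253647, 59401253647]), (37, [62201375426, 65210734562, 43910734562,
  65201734562]), (37, [65301734562, 60401735462, 52910374526, 46810375426, 26610374526]),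
  (25, [52101253647, 52101526374, 60101256347, 58001523674]), (46, [57410462735, 65701462735,
  60201462735, 50001462735]), (57, [52301524367, 64901253476, 45601253476, 55301253476,
  48801253476]), (56, [52401562734, 61210652743, 53001657243, 64910562734]), (56, [75001562734,
  75001652743, 35901567234, 65010562734]), (37, [64501735462, 64610374526, 58501735462, 51510375426,
  61401375426]), (37, [75201375426, 61701375426, 61510734562, 37710375426]), (47, [68001473625,
  52710743652, 59901476325, 53410746352]), (26, [64901264537, 60801264537, 65701264537,
  61701625473]), (37, [65801375426, 50101375426, 58601375426, 58310374526]), (47, [65610473625,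
  35301743652, 32410743652, 41610746352, 37910473625, 47910476325]), (56, [68310562734, 53201562734,
  37910567234, 48101562734]), (56, [75801562734, 32701657243, 48210562734, 54701562734]),
  (37, [75901375426, 62210734562, 60501375426, 66210375426]), (24, [67001243657, 61401426375,
  58910243657, 50410243657]), (47, [68701473625, 60301746352, 48501473625, 58901473625]),
  (57, [66310254376, 59810524367, 29610253476, 32701253476, 50201253476]), (46, [76301642753,
  65810462735, 59901647253]), (37, [76401734562, 45501374526, 27401342756, 67201374526,
  40410374526]), (47, [69201473625, 59510476325, 56001476325, 35601473625]), (37, [76601734562,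
  51310375426, 28710375426, 50810375426]), (37, [69401374526, 36410735462, 41410375426,
  33601735462]), (07, [69301756342, 35601734562, 35601743652, 67501756342, 62401756342, 62401765432,
  67501765432, 69301765432]), (35, [76901357246, 69510532764, 27901324576, 31910352746]),
  (47, [77001743652, 56501476325, 28001432765, 60001476325]), (46, [77101642753, 32110462735,
  42301462735, 67901462735]), (46, [77201642753, 32210462735, 64901462735, 54501462735]),
  (46, [77301462735, 69901642753, 60901462735, 63710462735]), (56, [68401562734, 60410562734,
  34301657243, 41210567234]), (37, [70201374526, 37210374526, 51410735462, 38310375426]),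
  (46, [70201642753, 67110462735, 34501462735, 55401462735]), (37, [70401374526, 45410374526,
  42401375426, 47201735462]), (37, [77801735462, 55601374526, 55801374526, 70501375426]),
  (47, [70601746352, 45710743652, 67410473625, 50101476325]), (23, [34101234567, 52710324576,
  43801234567, 57601235467, 62201325476]), (23, [33101325476, 61101235467, 63501235467, 34201234567,
  38801234567, 39001234567]), (23, [33201325476, 57801235467, 40401324576, 39601324576,
  50701234567]), (23, [55801324576, 53001235467, 33301325476, 57901324576]), (47, [43701243756,
  35410426537, 63710243765, 27901243756, 40201243756, 41301243756, 42101243756]), (57, [33510524367,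
  34601253476, 50801253476, 42110253476, 46910253476, 47601253476]), (47, [61110243756, 35601426537,
  65210243756, 40401247356, 35610426537]), (57, [38410524367, 53401523467, 65201523467, 47101253476,
  29401524367, 47601523467]), (57, [34901253476, 53510523467, 44601253476, 58401254376,
  63001524367]), (57, [33901524367, 61901254376, 64301254376, 35001253476, 39601253476,
  39801253476]), (57, [38701253476, 64101524367, 64101253476, 38701524367]), (57, [63701253476,
  64210524367, 62110523467, 53301523467]), (57, [64310524367, 58810523467, 41501523467, 32701523467,
  42801253476, 61910524367]), (56, [72010562734, 62901657243, 67301567234, 34310657243,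
  47501562734]), (46, [79401467235, 69010462735, 47601462735, 34410462735]), (47, [79501743652,
  66901473625, 59001476325, 59801473625]), (37, [79601734562, 70401735462, 30601342756,
  63001735462]), (26, [72401264537, 65101264537, 66001625473, 69801265437]), (47, [79801743652,
  69310473625, 66310476325]), (35, [79901357246, 70810532764, 30901324576, 49710352746]),
  (47, [31001432765, 57501743652, 65710746352, 70801746352]), (47, [69601473625, 39801473625,
  70101743652, 54010746352]), (25, [69710253647, 57301523674, 54801526374, 64501253647,
  58001253647]), (47, [57801743652, 64610473625, 48001473625, 52701743652, 59810476325]),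
  (47, [70401743652, 41301473625, 69901473625, 36810746352]), (47, [80501743652, 67901473625,
  64801473625, 66801743652]), (26, [80601265437, 73310264537, 31601243657, 37101264537]),
  (26, [80701265437, 73410264537, 27901264537, 34110264537]), (26, [80801625473, 68201264537,
  65101625473, 31801243657]), (37, [66610735462, 66610374526, 58701734562, 65201375426,
  59001375426]), (37, [71010374526, 58110735462, 66710734562, 56901375426]), (37, [81101735462,
  64701735462, 65401375426, 58210735462, 71110375426]), (37, [71210374526, 42101374526, 67501375426,
  65501735462]), (37, [70810734562, 65601374526, 58401375426, 41001374526]), (46, [36410467235,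
  67701467235, 37010462735, 38101642753, 62401642753, 39901642753]), (26, [71001264537, 71001624573,
  71501264537, 64501264537, 67901625473]), (37, [72401374526, 58701375426, 40610374526, 65901734562,
  34710374526]), (37, [71201734562, 41401734562, 71701374526, 58801735462]), (26, [71801624573,
  58901265437, 67501264537, 34101624573, 47601264537]), (47, [47201243756, 67201243765, 54001425637,
  32701243765, 34801425637, 27801243756]), (57, [59501523467, 38101253476, 61601523467, 44201523467,
  46710523467, 46801524367, 50901254376]), (47, [47410425673, 64610247365, 67401243756, 61310425637,
  33001243756, 42401243756]), (57, [37201523467, 56610523467, 35001523467, 47001523467, 50601523467,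
  54501523467, 66401523467]), (36, [59901236457, 46901326547, 44901236457, 46710326547, 46801326547,
  52910326547, 56401236457]), (57, [57101254376, 62001254376, 57101523467, 35201253476, 35201524367,
  39501352674]), (57, [60001523467, 39401253476, 57201523467, 50901524367, 43201253476]),
  (57, [70401253476, 39501254376, 57301253476, 66801523467, 43501254376]), (57, [57110253476,
  43410253476, 52401673452, 57101524367, 47410254376, 47401523467]), (57, [60301523467, 43701253476,
  57210524367, 35601524367, 46701253476, 51001253476]), (57, [39001253476, 40001425763, 62501523467,
  33601253476, 57310524367]), (57, [42710253476, 57701254376, 69501254376, 51401524367, 33701253476,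
  51901254376]), (57, [38101524367, 62701254376, 45301523467, 44501523467, 55601253476]),
  (46, [72801462735, 71010647253, 61610462735, 33710467235, 55510462735]), (47, [34301432765,
  44210476325, 45801476325, 45810743652]), (25, [83401253647, 60901526374, 73401253647,
  73410253647]), (15, [51410523674, 74210567234, 51410532764, 56410523674, 56410532764, 56610523674,
  56610532764, 74210576324]), (37, [76201374526, 73110374526, 58010374526, 69901374526,
  73601374526]), (25, [76301253647, 34701234567, 73201253647, 38701526374, 44501253647]),
  (37, [69801325647, 70501325647, 30110325674, 30201325674, 30310325674, 30401325674, 40101325674,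
  47510325674, 62001325674, 71401325674]), (57, [74010253476, 52801524367, 49301253476, 54701253476,
  35701253476, 69401253476]), (47, [73301425637, 68701243756, 70701243765, 56701243756,
  71601243756]), (47, [59310425637, 73410425637, 39801243756, 45901247356]), (47, [74701425637,
  73510425637, 39901243756, 66701243756]), (57, [75301253476, 59801253476, 72110253476,
  63210253476]), (57, [69510523467, 55601253476, 45601253476, 63310253476, 65401254376]),
  (15, [73710523674, 56310562734, 75210576324, 67710537264]), (47, [77201473625, 43610473625,
  64101476325, 37010476325]), (56, [74601562734, 67710652743, 48710567234, 64810652743]),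
  (37, [77401374526, 64301375426, 70901374526, 45610375426]), (47, [72301473625, 75210476325,
  71010473625, 77610473625]), (35, [36001324576, 67901352746, 74910352746, 74501352746]),
  (56, [85101652743, 59810562734, 67910562734, 75001562734]), (37, [77801374526, 52901374526,
  59401375426, 59110735462]), (17, [77810756342, 43210734562, 61910734562, 43310765432, 51010743652,
  58210734562, 69410734562, 69410735462]), (46, [78010642753, 40410462735, 75301642753, 62701462735,
  75410462735]), (37, [75810374526, 75801375426, 46401374526, 46410375426]), (47, [75901476325,
  75610473625, 46501473625, 72010743652]), (47, [78310473625, 53401473625, 66610476325,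
  58101743652]), (47, [78410473625, 76101476325, 46710476325, 44510473625]), (06, [75101624573,
  62901647253, 44701652743, 45101624573]), (56, [75601567234, 68710652743, 50010567234,
  54810562734]), (56, [78801657243, 68910652743, 63501562734, 58910562734]), (56, [78810652743,
  78901657243, 47101562734]), (37, [78901374526, 59110735462, 72010375426, 54301374526]),
  (37, [75910734562, 76510374526, 38510374526, 39510734562]), (37, [79101374526, 66001735462,
  39610734562, 45510734562]), (23, [46301234567, 71201234567, 54401324576, 54601325476, 59010324576,
  69601234567]), (37, [79301374526, 39810735462, 45710735462, 79401375426]), (37, [76910374526,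
  64910735462, 74510734562, 69910735462]), (07, [79401746352, 63901743652, 58701753642, 77601764532,
  51001734562, 72501746352, 79401764532]), (46, [78010462735, 72110647253, 42801462735, 37601462735,
  44401642753]), (37, [79701374526, 48010735462, 65110374526, 69801375426]), (57, [79901573624,
  79901756342, 46901573624, 53001573624, 61110756342]), (37, [87301735462, 77310374526, 55301375426,
  34610374526]), (37, [80101375426, 77410374526, 48310735462, 73810734562]), (37, [77001734562,
  47201734562, 77501374526, 55501375426]), (56, [80210652743, 80310657243, 65601652743,
  75001562734]), (23, [78701234567, 65710324576, 53201234567, 41101325476, 49101324576]),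
  (37, [87801734562, 80401374526, 71401734562, 77810374526]), (37, [38901352746, 77910374526,
  55601735462, 65901374526]), (23, [43001325476, 66010324576, 48901234567, 44101234567,
  62701324576]), (37, [78510325647, 71601325647, 47901325647, 48001325647, 50201325647, 62901326574,
  66301325674]), (47, [80610243756, 63410425637, 70710426573, 43101243756]), (37, [80710325647,
  75001325647, 73201325647, 75001237456]), (56, [78001567234, 61210652743, 47501652743,
  71210562734]), (47, [78801476325, 61310743652, 74610473625, 63001473625]), (57, [78710753642,
  63101573624, 71210573624, 40501753642, 73701756342]), (56, [74601657243, 71310652743, 40601562734,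
  59410657243, 71610562734]), (37, [81401374526, 48501375426, 65901375426, 66510734562]),
  (47, [48601743652, 59610473625, 64410743652, 41310476325, 67001746352]), (37, [81601374526,
  74710735462, 48101375426, 71810374526]), (47, [81701473625, 48801746352, 79401476325,
  55810473625]), (56, [78801567234, 79110562734, 51601562734, 42601657243]), (47, [82001473625,
  48310476325, 42410476325, 79601476325]), (37, [81810234756, 54701325674, 71910326574, 44501325647,
  74101325647]), (47, [81910425637, 68110243756, 72001425637, 39301243756, 78810425637]),
  (57, [50510524367, 72501523467, 65110253476, 53510254376, 66001524367]), (16, [60210674523,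
  50710624573, 50710625473, 61610642753, 66310624573, 68710652743, 75310624573, 75310625473,
  82210657243]), (57, [82401573624, 67801753642, 48901576324, 65301753642, 72410753642]),
  (26, [82501264537, 67901265437, 67201624573, 67701265437]), (57, [79901753642, 75710756342,
  54010753642, 72610753642, 67301573624, 80110753642]), (37, [82701374526, 68101374526, 57801375426,
  76401734562]), (56, [90201652743, 68201652743, 69010652743]), (37, [79810734562, 69601734562,
  75101374526, 68301374526, 78001734562]), (37, [50101734562, 67501735462, 67501734562, 68101734562,
  78101734562]), (37, [80010734562, 50201734562, 42910374526, 42910375426, 68210734562,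
  68210735462]), (37, [67710735462, 78310734562, 49601374526, 75410374526, 43001375426,
  66101735462]), (26, [83301264537, 73701625473, 83301265437, 43001624573, 80201264537]),
  (26, [83401264537, 80801625473, 46101264537, 61601265437, 43101624573]), (26, [80401624573,
  80901264537, 78601625473, 43201264537, 73901264537, 80901265437]), (37, [80510374526, 68710734562,
  50010734562, 68710735462, 44110375426]), (07, [83601765432, 49301734562, 67701743652, 58701764532,
  52101746352, 76701746352, 43801753642, 64001743652]), (37, [81201374526, 50901735462, 43601375426,
  76901735462, 78901734562]), (57, [72401523467, 56710253476, 62001523467, 48710523467, 76701254376,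
  54901523467]), (57, [81510253476, 62101523467, 70301253476, 56801254376, 76901253476]),
  (56, [84101652743, 74510562734, 77401567234, 72601652743]), (57, [70901753642, 65910573624,
  43501753642, 43510753642, 67101753642, 67110753642, 72701573624]), (47, [74301473625, 74810743652,
  43601473625, 58401473625, 59501743652, 71001746352]), (26, [51501624573, 69810265437, 59801264537,
  59801265437, 55601625473, 74801264537]), (26, [51601264537, 77301264537, 44201624573, 44210624573,
  77301265437, 44201625473, 44210625473, 51610264537]), (37, [72401234756, 66801326574, 64601325647,
  49810325647, 82501325647, 51410234756]), (37, [82501325647, 78701326574, 51910325647, 78110325647,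
  79701325674]), (47, [81510243756, 64301243756, 74701425637, 50010425637]), (47, [78101425673,
  45901243756, 79901425673, 78301243756, 69510425637]), (07, [84701243567, 76101234567, 63701234567,
  62601234567, 68601234567, 50101243567, 63801243567]), (17, [84810234567, 47010234567, 50810234567,
  54410243567, 46910234567, 46910234657, 62810234567]), (47, [85010425637, 75110247365, 81901243756,
  47501425637, 77301243756]), (47, [85101243756, 82010243756, 76701425673, 65410243756,
  79301426573]), (37, [85201234756, 78601325674, 52710325647, 70010326574]), (57, [83901253476,
  51910524367, 46610524367, 56510254376, 43510524367]), (56, [93001652743, 85701657243, 44001523674,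
  53001657243]), (46, [83210642753, 73210462735, 43710462735, 76110467235, 43710467235]),
  (57, [84201253476, 67801523467, 76110523467, 45010523467, 50101523467]), (57, [83410253476,
  53001523467, 84301253476, 50201524367]), (57, [76310524367, 68001523467, 73001523467, 78501253476,
  73510524367]), (37, [85901325647, 78701234756, 82810325647, 50501325647, 50501325674]),
  (57, [83710253476, 59810523467, 60310523467, 59401254376]), (57, [83801253476, 73801523467,
  44301523467, 76701253476, 44301524367]), (47, [86201243756, 86201425637, 83110425637, 66510425637,
  80401247365]), (16, [59610647253, 64010624573, 81410674523, 51810624573, 64010625473, 72910657243,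
  79510674523]), (57, [86601573624, 68301756342, 72001753642, 47110573624]), (56, [86810652743,
  83701567234, 55010567234, 56501562734]), (57, [76910523467, 77101523467, 68801523467, 62001523467,
  79310523467]), (37, [86701325647, 62601234756, 79010325647, 53701234756, 56401234756,
  78301234765]), (57, [84510253476, 54110523467, 75001253476, 77301523467]), (47, [86910243756,
  77010426573, 83801425637, 49401243756, 49910243756]), (57, [84710254376, 62401524367, 53110253476,
  79701253476]), (47, [87101243756, 84001425637, 79410425637, 54601243756, 81301247365]),
  (57, [84310573624, 77410753642, 65510756342, 46710753642, 57610753642]), (07, [53001764532,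
  55001735462, 55901734562, 65301743652, 66801735462, 79001746352, 80501746352, 87401765432]),
  (57, [85110253476, 55901524367, 51901523467, 56201253476, 56301253476, 69710253476, 70001254376]),
  (57, [50110524367, 56001254376, 48510254376, 70101254376, 62601523467]), (57, [72701524367,
  56101524367, 56110523467, 78801523467, 53601523467]), (57, [85410253476, 56201254376, 73301253476,
  78901523467]), (57, [56310524367, 73410253476, 75901253476, 59010254376]), (47, [87910243756,
  63810425637, 80201243756, 54910425637, 57610425637, 79510425673]), (46, [55301462735, 78510462735,
  71110642753, 58410642753, 53010642753]), (37, [88101234756, 45410326547, 49010326547, 57201234756,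
  41801234756, 41901325647, 45801234756]), (47, [80701425673, 68401243756, 49110425637, 60910425637,
  74901247365]), (57, [75201253476, 68410253476, 61401523467, 61401524367, 80101254376,
  76501253476]), (47, [88401243756, 59410425637, 57801425673, 68610243756]), (47, [88501243756,
  84201425637, 70901247365, 46210243756, 55510425637, 56401243756]), (25, [88801523674, 71701253647,
  74001526374, 78810253647]), (06, [63901674523, 66401624573, 47701642753, 57401647253, 63501624573,
  69201642753, 80801652743, 88801675423]), (37, [96401375426, 89010374526, 74110734562]),
  (37, [89110374526, 89101375426, 55810374526, 86510734562]), (57, [57510524367, 57810523467,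
  62401254376, 66401524367, 75501523467]), (47, [84301243756, 53701426537, 45101247563, 82010243765,
  74910243756, 46210243756, 46201243756, 52401243756]), (57, [74801523467, 75701253476, 67501524367,
  83601253476, 71001523467]), (57, [53001253476, 64901524367, 74910523467, 56601253476,
  75801253476]), (57, [56701253476, 79910253476, 72510523467, 59810523467, 54410523467]),
  (24, [74601243657, 74601426375, 80501423675, 82601243657]), (57, [61101254376, 58601524367,
  82601253476, 82601254376, 39401635742, 63910523467]), (47, [89710243756, 79810426573, 82201425673,
  53001425673, 52401425637]), (57, [74901524367, 78401254376, 77901253476, 76801253476, 52410524367,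
  59610253476]), (37, [89901234756, 65801326574, 59010325674, 76701325647]), (56, [85410567234,
  68510652743, 60301657243, 85410657243]), (47, [52710473625, 72410473625, 52710476325, 85101473625,
  56410743652, 56410746352, 70510473625, 78010473625]), (36, [84901326547, 85001326547, 44501326547,
  44510326547, 44601326547, 44610326547, 77501326547, 77510326547, 77601326547, 85101326547]),
  (47, [84601243765, 86001243756, 43901243756, 43910243756, 48301243756, 48310243756, 53601243756,
  53610243756, 54501243756, 64801243756]), (57, [75501253476, 88110253476, 63401253476, 65801253476,
  68801253476]), (57, [88210253476, 80801253476, 65910253476, 81501523467]), (47, [90801473625,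
  81210473625, 55101746352, 62210476325]), (47, [63601243756, 63610243756, 65201243756, 85301426537,
  50501243756, 51201425637]), (57, [75901254376, 75901523467, 67501524367, 81801253476]),
  (57, [54610523467, 82101254376, 70801523467, 72901523467, 67610523467]), (47, [50801425637,
  77810243756, 77801425637, 77710425637, 77701243756, 50810243756]), (47, [81201243756, 73501243756,
  77810425637, 60510426537, 60501247356]), (47, [98801743652, 81901476325, 82201746352]),
  (25, [98901253647, 88910253647, 82510253647, 88901253647]), (47, [88310243756, 83710425637,
  85701425673, 71710425637, 86601243756]), (17, [57110765432, 71010743652, 60110734562, 60110735462,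
  66110734562, 66110735462, 75710734562, 91610756342]), (57, [76701253476, 89310253476, 60101523467,
  59201254376, 78601254376]), (47, [89510243756, 74510243756, 85901247365, 58710425637,
  71910243756]), (47, [72401425376, 51901425376, 69601425736, 58301425376, 52001425736, 75401425736,
  82701425376]), (47, [91801425376, 75501425376, 53701452376, 54201452376, 53601425376]),
  (57, [82901534276, 53801543726, 83501534726, 63101534276, 71101534276, 62601534726]),
  (47, [83501425376, 73201452376, 75701425736, 53901452376, 61701425376]), (27, [92101234576,
  75801234756, 54001243756, 62801234756, 53901234756]), (57, [90910253476, 83510254376, 68401523467,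
  39801356274, 51701523467, 66101523467, 66410523467]), (47, [92410243756, 90501425637, 54810425637,
  54901243756, 86601425637]), (47, [92510243756, 92501425637, 54901425637, 55001243756, 72810243756,
  86701425637]), (47, [92601243756, 92610425637, 55001243756, 55101243756, 72910425637,
  86801243756]), (37, [90310374526, 77410735462, 78010734562, 52610374526, 80610374526]),
  (37, [90410374526, 78401375426, 90410375426, 62110735462, 75110374526, 87801374526]),
  (16, [66210642753, 88010624573, 79210657243, 61610624573, 84610625473, 61510642753, 58410624573]),
  (57, [56701523467, 62310254376, 56401524367, 60601523467, 74601524367, 76501253476]),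
  (47, [64110243756, 83201425637, 85601425637, 85601243756, 64101425637]), (47, [65901425637,
  53001425637, 66101243756, 78010425637, 84301243756]), (57, [78401524367, 87010523467, 61801254376,
  60901523467, 62101523467]), (47, [64410243756, 73601425637, 85901243765, 67601425637,
  80101426573]), (57, [78601524367, 80001523467, 62801254376, 54501524367]), (27, [55401234576,
  64301243576, 71101234576, 55501234756, 60101243576, 64401234576, 78001234576]), (27, [93601234576,
  78001234576, 55401243576, 67401243576, 77101243576, 77501234576, 83701243576, 93601243576]),
  (57, [90501534276, 55301534276, 55301543276, 51601534276, 83801543276]), (27, [93801234576,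
  55501243576, 54501234576, 54501234756, 60101243756, 63101243756, 67101234576, 67101234756,
  90601234576]), (47, [83901425376, 56001425376, 61801452376, 51801425376, 55701452376, 71801425376,
  72701425376, 72701452376, 77301452376, 79901452376]), (57, [94001534276, 85401534276, 53401534276,
  56101534276, 59201543276, 73101543276, 77901534276, 94001543276]), (57, [94101543276, 55701543276,
  55801543276, 55601534276, 72801534276, 72901543276, 90901534276]), (47, [91201243756, 51510243765,
  51601243765, 51701243756, 51801243756, 55210426537, 80510243756]), (57, [80010254376, 71801523467,
  55710523467, 47710523467, 51010523467, 84901524367]), (57, [93101253476, 85701523467, 85001523467,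
  73310523467]), (57, [93201253476, 80210253476, 67701523467, 55601254376, 63601253476]),
  (37, [91610325647, 51901325647, 52110325674, 55601234756, 52010325647, 52210325674, 80901325674]),
  (57, [93401253476, 51410524367, 88910253476, 83410254376]), (57, [58601523467, 89901523467,
  51501524367, 58301524367, 61001254376, 63801523467, 63910253476]), (57, [93601253476, 63510524367,
  61710524367, 63810523467, 48310524367]), (57, [58801524367, 85401253476, 82301523467, 64101254376,
  66610253476]), (57, [80801253476, 64001523467, 53401524367, 89301253476, 64101523467]),
  (57, [93901253476, 68701254376, 53510524367, 82501524367, 85601254376, 90310523467]),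
  (57, [85910523467, 88910253476, 62301523467, 68810254376, 66601254376]), (17, [95410243567,
  57010243567, 57110243567, 56910234567, 74110234567, 74210243567, 92210234567]), (17, [95510243567,
  57110243567, 57210243567, 66210234567, 73510243567, 74310243567, 92310234567]), (47, [92601243756,
  92610425637, 62710425637, 49110426573, 52910243756, 53101243765]), (47, [51001425376, 52301425376,
  40901452376, 36201425376, 36210425376, 36301425376, 36310425376, 36301425736, 36310425736,
  36401425376, 36401425736, 36701425376, 36710425376, 40901452736, 51101452376]), (46, [52301425367,
  39401425367, 39410425367, 40801452367, 35601425367, 35610425367, 35701425367, 35710425367,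
  35801425367, 35810425367, 35901452367, 36001425637, 36101425367, 36501425367, 39510425367]),
  (26, [52401234567, 41101234657, 41101243657, 35101234657, 35110234657, 35201234657, 35210234657,
  35301234657, 35310234657, 35401234657, 35410234657, 35401243657, 35410243657, 35501234657,
  35510234657, 35601234657]), (56, [52501534267, 34501534627, 34510534627, 34601534627, 34610534627,
  34701534627, 34710534627, 34801534627, 34810534627, 34901543627, 35001534627, 35101534627,
  36901534627, 40901534267, 40910534267, 43401534267, 43410534267, 43501543627]), (67, [48501536742,
  51701236745, 51710326754, 22301236745, 24401263475, 24401273465, 33101426753, 33101427653,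
  33801236745, 33901236745, 34001236745, 47001365274, 47001375264, 51701237645, 51710327654]),
  (67, [51801236745, 51801326754, 43401426753, 47201273465, 34201236745, 34301236745, 34401236745,
  34401326754, 34501236745, 34601263475, 34601362574, 47201372564, 48901426753, 48901536742]),
  (67, [51901326754, 52201263475, 47701326754, 52201273465, 52501426753, 33901536742, 33901537642,
  34010326754, 34101236745, 34201426753, 34510236745, 34510237645, 51901327654]), (67, [33801236745,
  33810236745, 49601632547, 49601642537, 52601263475, 6901263475, 6901264375, 49101263475,
  49110263475, 49101264375, 49110264375, 52801263475]), (27, [55501234576, 53001234576, 6701234576,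
  6710243576, 37701243576, 41201234576, 41210234576, 37710234576, 37801234576, 37801243576]),
  (67, [44301623457, 52901246735, 46610623457, 49801624357, 43501623457, 47501263475, 41710264375,
  34110623457, 41701264375, 52901472563, 34101623457, 46601623457]), (67, [74101263475, 53001263475,
  34001263475, 34010263475, 46301263475, 46310263475, 46301264375, 46310264375, 47701263475,
  47701264375, 53101273465]), (67, [74201462573, 53101246735, 49401246735, 50001754326, 26301456723,
  26310456723, 29801263475, 41901264375, 41910264375, 41901623457, 41910623457]), (26, [55901234567,
  53401234657, 7101234657, 7110243657, 38101243657, 41601234657, 41610234657, 38110234657,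
  38201234657, 38201243657]), (67, [74401573462, 34401536742, 42101632547, 48901536742, 42101642537,
  43810536742, 44201236745, 44201246735, 47801573462, 47801574362, 52710573462, 52710574362]),
  (67, [34401573462, 34510536742, 42201732546, 34201536742, 34310536742, 34310546732, 34601632547,
  34601642537, 42201742536, 49001536742, 49801237645, 49801247635, 49901273465, 50001563472,
  50110537642, 50201563472, 50201564372]), (26, [43501234657, 42201234657, 42201243657, 43501243657,
  49710234657, 56210234567, 41110234657, 40601243657, 43401243657, 33801234657, 33701234657,
  45010234657, 7601234657]), (67, [53001573462, 42401365274, 47301642537, 49901457623, 50401563472,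
  34001536742, 34101536742, 34201536742, 34301236745, 34501536742, 34901246735, 42401375264,
  48101573462, 49601536742]), (67, [74801573462, 41401632547, 49501536742, 29801642537, 34101536742,
  34101546732, 34510536742, 49801563472, 50201273465, 50401263475, 50401264375, 53601236745,
  53601246735]), (67, [87201236745, 53701263475, 25801263475, 25801264375, 30601263475, 30601264375,
  30901263475, 30901264375, 33901263475, 47101263475, 47101264375, 48601263475]), (56, [56610534267,
  41510534267, 42601543267, 42601534267, 34201534267, 43901534267, 50110534267, 43901543267,
  8001534267, 34101534267, 43801543267, 41001534267, 45410534267]), (67, [27201356724, 47701624357,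
  19301236745, 22101236745, 30801372564, 31101362574, 31601236745, 33101236745, 33210236745,
  33501236745, 33601236745, 33901236745, 34001236745, 34701236745, 35101263475, 39901236745,
  48601264375, 49901624357]), (67, [50201536742, 49801236745, 49810236745, 49801237645, 49810237645,
  49901236745, 49910236745, 50001635247, 50001645237, 50001735246, 50001745236, 50101236745,
  50110236745, 50101246735, 50110246735, 50201546732, 54001263475, 54001273465]), (67, [40310237645,
  44701236745, 49801237645, 53501236745, 34001236745, 34101327654, 34101427653, 34201326754,
  34201426753, 34301263475, 49001273465, 49501236745, 49501246735, 49901236745, 53501246735]),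
  (67, [44501236745, 47601263475, 47601273465, 7901236745, 19601326754, 19601327654, 24201236745,
  33601236745, 33701236745, 33701237645, 35801246735, 48001645237, 48001745236, 49601236745,
  49601237645, 49801236745, 50301236745]), (67, [87810236745, 44910236745, 33810236745, 33810246735,
  33910327654, 33910427653, 34010326754, 34010426753, 34110237645, 50101236745, 51110236745,
  53701326754, 53701426753]), (67, [87901236745, 48101237645, 40401326754, 40401327654, 40401426753,
  40401427653, 50001236745, 50001246735, 50301236745, 53801236745, 53801246735]), (67, [88001236745,
  49901246735, 50610236745, 53901237645, 33701426753, 33701427653, 33810326754, 33810327654,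
  33901236745, 50610237645, 53910426753]), (67, [88101236745, 27901236745, 27901237645, 35801362574,
  34501236745, 34501237645, 36101236745, 36101246735, 44901236745, 44901246735, 50510236745]),
  (67, [88210236745, 54401264375, 48101263475, 20601263475, 31401264375, 31801263475, 33110263475,
  49401264375, 49801263475, 51201263475, 54201263475]), (67, [54801236745, 43701263475, 45301236745,
  47801236745, 49901372564, 8601236745, 12101236745, 20201236745, 26801236745, 26901263475,
  31901362574, 32301236745, 32801236745, 34101236745]), (56, [57701534267, 42310534267, 42610534267,
  8801534267, 8901543267, 9001534267, 10210534267, 10301534267, 11101543267, 38501543267,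
  40001534267, 42201534267, 44901534267, 45001534267, 45101543267]), (67, [51201236745, 48001236745,
  48801624357, 54701362574, 8801536742, 12310236745, 27001537642, 31701372564, 34210236745,
  48201236745, 50301236745, 50310236745, 50501236745, 50510236745, 51401236745]), (67, [88610236745,
  50401427653, 50501236745, 32601327654, 33401236745, 41301236745, 49701273465, 50201273465,
  50601426753, 52001273465, 54501326754, 54501426753]), (67, [88710236745, 8901236745, 14801236745,
  14801246735, 35901236745, 35901237645, 41401236745, 41401237645, 48201326754, 48201327654,
  48201426753, 48201427653, 54601326754, 54601426753]), (67, [51501426753, 55301326754, 45201236745,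
  14901236745, 14910236745, 34701236745, 34710236745, 50601426753, 50610426753, 50601427653,
  50610427653, 51701426753, 51701427653, 55001264375, 55001274365]), (67, [41610237645, 54910273465,
  45910326754, 50701427653, 33610236745, 33710236745, 33801263475, 34910236745, 36410237645,
  37401246735, 45910327654, 50801246735, 50901426753, 54801236745]), (67, [45801236745, 45810246735,
  12801326754, 12801327654, 12810426753, 12810427653, 15110236745, 15101246735, 21401263475,
  21401273465, 36101236745, 36101237645, 37001326754, 37010426753, 50901236745, 50901237645,
  50910246735, 50910247635]), (67, [89110236745, 50801246735, 51201236745, 33601326754, 33601327654,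
  33801236745, 33801237645, 36101236745, 36101237645, 37201326754, 48801426753, 48801427653]),
  (67, [89210236745, 46001236745, 50910246735, 52510563472, 55110236745, 48701326754, 48701327654,
  48701426753, 48701427653, 55110237645]), (67, [46310263475, 50601546732, 51301263475, 52701263475,
  33401263475, 33501236745, 35510263475, 35901263475, 38001236745, 44701327654, 49810263475,
  50101632547, 50901642537]), (67, [77101362574, 46410263475, 50701236745, 51201263475, 52401264375,
  33401263475, 33510263475, 33801642537, 35510263475, 35901263475, 37201327654]), (37, [55601325476,
  32601325476, 9301325476, 9310325476, 9401325476, 9410325476, 9501325476, 9601325476, 32610325476,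
  33301325476, 40601325476, 42101325476, 42110325476, 44401325476, 48801352476]), (67, [77301263475,
  55801623457, 50401623457, 53101236745, 33201623457, 33210623457, 33301623457, 33310623457,
  50801623457, 53101623457, 55901623457]), (67, [56001635247, 53201246735, 32901623457, 32910623457,
  33001623457, 33101623457, 33110623457, 33201356724, 34101623457, 34110623457, 51301623457,
  51310623457, 53201623457, 56301573462]), (67, [77501263475, 56001263475, 50601263475, 53301632547,
  33401263475, 33410263475, 33501263475, 33510263475, 51001263475, 53301263475, 56101236745]),
  (67, [56201236745, 53401472563, 33101246735, 33110246735, 33201246735, 33301246735, 33310246735,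
  33401246735, 34301246735, 34310246735, 51501246735, 51510246735, 53401246735, 56501246735]),
  (67, [56601246735, 51210635247, 48001365274, 53501362574, 47201365274, 45401632547, 50301365274,
  56601573462, 45410632547, 37810365274, 50310365274, 37801365274]), (67, [48101623457, 16501246735,
  48001623457, 51701246735, 32301623457, 32401623457, 32501623457, 32601623457, 32710264375,
  32901623457, 33101623457, 33501632547, 33801624357, 45501623457, 50901263475]), (67, [48201427653,
  48201623457, 56401426753, 47801247635, 47801263475, 56401624357, 33101246735, 33110246735,
  33201246735, 33210246735, 56801472563]), (67, [48301264375, 48301365274, 56501263475, 47901624357,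
  47901635247, 56501362574, 33201623457, 33210623457, 33301623457, 33310623457, 56901246735]),
  (67, [78101362574, 33101365274, 33101632547, 33110365274, 33110632547, 33201365274, 33210365274,
  33201632547, 33210632547, 33701356724, 33701623457, 48001247635, 48001362574]), (67, [48501264375,
  16901632547, 48401264375, 52101632547, 32701264375, 32801264375, 32901264375, 33001264375,
  33101264375, 33301264375, 33501246735, 33901246735, 34201263475, 45901264375, 51301624357]),
  (67, [78301263475, 50901264375, 32610264375, 32701264375, 32810264375, 32910623457, 33001264375,
  33101623457, 33501623457, 33801246735, 38401623457, 52110624357, 56801426753, 56901624357]),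
  (67, [48701365274, 33401623457, 48610623457, 51001264375, 52201624357, 10401264375, 32510264375,
  32601264375, 32701623457, 32801623457, 34301263475, 35101632547, 51301623457, 56901624357]),
  (67, [48801427653, 33501264375, 48710264375, 51101623457, 52301263475, 10501623457, 32601264375,
  32701264375, 32801264375, 32901264375, 34401624357, 35201246735, 51401264375, 57001263475]),
  (67, [78601263475, 51201623457, 32910623457, 33001623457, 33110623457, 33210264375, 33301623457,
  33401264375, 33801246735, 34101632547, 38701264375, 52410263475, 57101362574, 57201236745]),
  (67, [78701236745, 10001263475, 48601623457, 48601632547, 32501623457, 32510623457, 32601623457,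
  32610623457, 32601632547, 32610632547, 52201263475, 52201362574]), (67, [16010546732, 30901273465,
  32001632547, 33801632547, 46501264375, 31301623457, 31401623457, 31501623457, 31601623457,
  31801623457, 32410623457, 32701623457, 34301635247, 35501624357, 48301632547]), (67, [78901236745,
  16101546732, 49201457623, 31010372564, 31501623457, 31601632547, 31801623457, 32001547632,
  32210623457, 32601623457, 45501264375, 51501632547, 52801624357]), (67, [79001236745, 34001236745,
  34001327654, 34010236745, 34010327654, 34101236745, 34110236745, 34101327654, 34110327654,
  34601263475, 34601372564, 48901237645, 48901326754]), (67, [79101573462, 31201263475, 46801264375,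
  31001263475, 31101263475, 31110735246, 31301263475, 31401263475, 31401735246, 31501263475,
  34101642537, 34201236745, 54301564372]), (67, [79201236745, 31301456723, 46901457623, 31101456723,
  31210263475, 31201456723, 31401372564, 31501263475, 31501456723, 31601456723, 34201574362,
  34301465273, 54401357624]), (56, [66901543267, 45601543267, 45701543267, 30310543267, 30410543267,
  30501543267, 30610543267, 30701543267, 30810543267, 30901534267, 31001543267, 31101543627,
  46801534267, 46901534267]), (67, [49701263475, 49101263475, 51601236745, 29701263475, 29801263475,
  29901263475, 30001236745, 30101263475, 30201263475, 30301264375, 33301623457, 34501236745,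
  51601237645, 52410263475, 53101236745, 58201236745]), (67, [58001264375, 32701263475, 39401236745,
  53101546732, 29001263475, 29101263475, 29201263475, 29301263475, 29410263475, 29501263475,
  29701263475, 29910263475, 33401632547, 34601327654, 39101236745]), (67, [79601236745, 11001475263,
  29410263475, 29701263475, 39801236745, 46301642537, 49310263475, 53001236745, 53001237645,
  53101263475, 53201236745, 53201237645, 53301236745, 57910236745, 57910237645]), (67, [79701236745,
  52901263475, 58201462573, 29310263475, 29701263475, 30201263475, 30301547632, 30501564372,
  32901475263, 49410263475, 53201362574, 58010236745, 58010237645]), (67, [52001236745, 53201456723,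
  58001536742, 28801236745, 28901236745, 29001236745, 29101236745, 29201236745, 29501372564,
  30001362574, 52801263475, 53001564372, 53001574362, 58001246735]), (67, [79901456723, 28801236745,
  28801326754, 29301236745, 29301237645, 30601263475, 30601273465, 30601362574, 30601372564,
  40301246735, 40301356724, 49610465273, 49610564372, 58210456723, 58210457623]), (67, [53701236745,
  53701456723, 54001356724, 28601236745, 28601237645, 28701236745, 28701456723, 28801246735,
  28901236745, 28901456723, 29301236745, 29301237645, 30001362574, 30001372564, 30001564372,
  30001574362, 54001536742]), (67, [58301537642, 58301246735, 40001456723, 30601564372, 40001326754,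
  28501237645, 28601546732, 28601236745, 29001456723, 29001326754, 30601263475, 30601273465,
  30601574362, 28501236745]), (67, [80201456723, 28701236745, 28710236745, 53201263475, 53210263475,
  53201273465, 53210273465, 54201356724, 54210356724, 55201546732, 58701365274, 58701375264]),
  (67, [53601456723, 58601456723, 53301263475, 58601546732, 28710236745, 28910236745, 29310237645,
  29410236745, 29501546732, 29810372564, 30201362574, 30610273465, 41101356724, 58501426753]),
  (67, [50101263475, 50110564372, 28910236745, 28901546732, 29110326754, 29101456723, 29601236745,
  29601237645, 29610546732, 29610547632, 30201362574, 30201372564, 30210465273, 30210475263,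
  40701246735, 40710536742, 50101273465, 50110574362]), (67, [80501456723, 53810456723, 53801546732,
  29201236745, 29210326754, 30901263475, 30901273465, 30910362574, 30910372564, 58710426753,
  58701536742]), (67, [53901236745, 53910456723, 50301263475, 50310465273, 54610356724, 30201362574,
  30201372564, 30210564372, 30210574362, 50301273465, 50310475263, 54601536742, 58801246735]),
  (27, [32001234576, 46901234576, 27801234576, 27901234576, 28001234576, 28101234576, 28210234576,
  28301243576, 28401234576, 28501234576, 28601243576, 28701243576, 28801234576, 28901234576,
  29001234756, 32101234576, 47801234576, 50301234576]), (67, [59101236745, 35801236745, 50601236745,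
  53801263475, 54001263475, 27701263475, 27801263475, 30701263475, 31001263475, 34601623457,
  36101624357, 41801264375, 54201236745, 54401573462]), (67, [59201237645, 12201263475, 35901327654,
  54101263475, 54501264375, 27810263475, 30410263475, 30601263475, 31210263475, 34001475263,
  36101624357, 53101237645, 54301237645, 56201237645]), (67, [27701236745, 27701263475, 47901236745,
  47901263475, 54101326754, 27501236745, 27601236745, 34801236745, 34901326754, 34901623457,
  36901362574, 36901632547, 37001236745, 37001263475, 54101623457]), (47, [59501425376, 50001425376,
  26910425376, 27001425376, 27110425376, 27201425376, 27310425376, 27410425376, 27501425376,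
  32701425376, 38010425376, 38401425376, 38501425376, 38901425376, 39001425376, 44101425376,
  52701452376]), (67, [93510236745, 41201263475, 54301236745, 37901236745, 37901237645, 38401236745,
  38401237645, 40201236745, 41101236745, 42201236745, 42201237645, 54301237645]), (67, [51601236745,
  20001372564, 51501236745, 55201372564, 35801236745, 35901236745, 36001236745, 36101236745,
  36201236745, 36401236745, 36601236745, 37001263475, 37301237645, 49001236745, 54401326754]),
  (67, [93710236745, 20101236745, 20101263475, 23201236745, 26901236745, 26901263475, 28101362574,
  31601236745, 31601263475, 34201236745, 40301236745, 40301263475]), (67, [28201236745, 34701263475,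
  51701327654, 53701263475, 54401263475, 23201236745, 23301236745, 25701236745, 26101236745,
  26501236745, 40501236745, 47201236745, 54201236745, 54501236745, 55401642537]), (67, [18810372564,
  33701456723, 34801264375, 36601264375, 49301427653, 34101246735, 34201246735, 34301246735,
  34401246735, 34601246735, 35210246735, 35501246735, 37101263475, 38301247635, 51101264375]),
  (67, [20401236745, 20410263475, 28410236745, 47401263475, 26210236745, 26201263475, 27110236745,
  27101263475, 31610236745, 31601263475, 34210236745, 38910236745, 38901263475, 40210236745,
  40201263475, 47410236745]), (67, [60101263475, 36801263475, 51601263475, 54801236745, 55001236745,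
  28701236745, 28801236745, 31701236745, 32001236745, 35601326754, 37101327654, 42801237645,
  55201263475, 55401546732]), (67, [94201236745, 28601263475, 54801263475, 54910236745, 27501236745,
  27601263475, 32301263475, 35501236745, 36801236745, 40001236745, 51201263475]), (67, [94310236745,
  48901326754, 54801263475, 23701236745, 26401236745, 26501236745, 31701263475, 34601236745,
  36401263475, 40801236745, 54901327654, 55401263475]), (67, [52401327654, 55201236745, 60601264375,
  13201236745, 13210236745, 20801236745, 20810236745, 27001236745, 27010236745, 51601263475,
  51901263475, 54901263475, 54910263475, 55001263475, 55010263475, 56901624357]), (67, [60510263475,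
  49110326754, 52410327654, 55001263475, 19401472563, 27310236745, 27410236745, 27510236745,
  27601263475, 27710236745, 27801236745, 31710263475, 36510263475, 39410237645, 40610236745]),
  (67, [94610236745, 47101236745, 27201236745, 27301236745, 27601236745, 27701236745, 28901326754,
  32401263475, 35001236745, 36501263475, 37101327654, 51610263475, 55501236745]), (67, [94710236745,
  55001624357, 55101236745, 13501236745, 27201236745, 27501236745, 32401263475, 35401236745,
  37101327654, 49301362574, 55601236745, 56701263475]), (67, [34601356724, 26801236745, 26901236745,
  27010263475, 27101236745, 27201263475, 27301236745, 27410236745, 27701236745, 28001263475,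
  28210263475, 29001326754, 29401236745, 32301263475, 36601263475, 37101327654, 38901263475,
  39101236745, 47301236745]), (67, [94910236745, 19810472563, 48301236745, 13710236745, 26901236745,
  32201263475, 37101327654, 40601236745, 49501362574, 56401264375, 56901263475, 60901263475]),
  (67, [53001246735, 35901264375, 50401264375, 35901246735, 36001246735, 36001264375, 36101246735,
  36201246735, 36301246735, 36301264375, 36401246735, 36401264375, 36501246735, 38401247635,
  38401263475, 50401246735]), (67, [82801462573, 20001732546, 53101375264, 34910456723, 35401264375,
  35501246735, 35701264375, 35901735246, 36110264375, 36501264375, 49401623457, 55401246735,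
  56701263475]), (46, [70501452367, 49410425367, 20501425367, 14110425367, 19310425367, 24801452367,
  24901425367, 25001425367, 29101425367, 47610425367, 49201425367, 52110425367, 64501425367]),
  (16, [64510234567, 13410425367, 13410534267, 13510234567, 13610234567, 13710234567, 13810234567,
  13810325467, 48810234567, 48810325467, 51310234567, 51310325467, 51410234567, 51410325467,
  51510425367, 51510534267, 64510325467]), (67, [83101246735, 47601356724, 55301573462, 55501356724,
  27101356724, 27201356724, 36301375264, 55601263475, 55701624357, 56001365274, 57001645237,
  61410247635]), (67, [61301236745, 47701326754, 55701462573, 55901326754, 15701236745, 22501236745,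
  23101236745, 24601236745, 28201236745, 28201237645, 32101236745, 47701327654, 55901327654,
  57601326754, 61301237645]), (67, [83301456723, 13010236745, 23810237645, 22601326754, 23201236745,
  24901236745, 24901237645, 41501326754, 56201362574, 56201372564, 56301236745, 56301237645,
  58201236745]), (67, [61510237645, 61701456723, 13101236745, 13101326754, 61701546732, 24910236745,
  41710236745, 41710326754, 53610236745, 53610326754, 55310236745]), (67, [13210326754, 24010237645,
  48001236745, 53210475263, 24901236745, 27501326754, 27501327654, 28101236745, 28101237645,
  49201326754, 49201327654, 52601326754, 57701236745, 57701237645]), (67, [22301642537, 55801264375,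
  57301236745, 24501263475, 24601263475, 24701263475, 24801236745, 24901263475, 25301263475,
  28601236745, 29201263475, 29301263475, 37301263475, 38301236745, 39901263475, 40401236745,
  50501263475]), (56, [65301543267, 47901534267, 49601534267, 24310534267, 24410534267, 24501534267,
  29601534267, 41301534267, 49701543267, 50001543267, 50210534267, 52501543267, 52601543267,
  52701534267, 55801543267]), (67, [22501623457, 53201263475, 57001537642, 27301356724, 27401356724,
  27501356724, 27601356724, 27701356724, 27901623457, 28001236745, 36101264375, 36401624357,
  37501375264, 43101536742, 56301263475, 57501246735, 58101563472]), (67, [96210326754, 62001236745,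
  24101236745, 24201327654, 24301236745, 24401236745, 25101237645, 25601263475, 27801237645,
  27801653427, 28001642537, 33201236745, 58101246735]), (26, [65601243567, 48201234657, 49901234657,
  24610234657, 24710234657, 24801234657, 29901234657, 41601234657, 50001243657, 50301243657,
  50510234657, 52801243657, 52901243657, 53001234657, 56101243657]), (67, [24601236745, 52801326754,
  53501462573, 59001246735, 15201326754, 15201327654, 23710236745, 23710237645, 23801236745,
  23901236745, 24001236745, 24601237645, 25401263475, 25401273465, 58101356724, 59001247635]),
  (67, [96510326754, 55001236745, 58701462573, 23701236745, 24001236745, 24301653427, 24301753426,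
  25301263475, 25301273465, 33101456723, 58601246735, 62301236745]), (67, [62410237645, 20601326754,
  23710236745, 23901236745, 24310327654, 24710236745, 25210273465, 27401653427, 27810237645,
  28010236745, 29410327654, 29910263475, 32910236745, 41310326754, 42610246735, 50001362574,
  55110236745]), (67, [96710326754, 53501246735, 20710326754, 20710327654, 23701236745, 24901236745,
  27710326754, 27710327654, 28201236745, 28201237645, 30101263475, 30101273465, 33101236745]),
  (67, [96810326754, 23201642537, 23201742536, 20810326754, 20810327654, 23701236745, 25901236745,
  42701246735, 53201326754, 56501536742, 56501537642, 58501536742]), (67, [49101326754, 53701246735,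
  23801236745, 24001236745, 24001237645, 24101236745, 24301236745, 24801236745, 24801237645,
  25601263475, 25601273465, 28201236745, 28201237645, 29401326754, 29401327654, 33301456723,
  49101327654, 53710356724]), (67, [55001236745, 63501236745, 57801623457, 63501263475, 23701236745,
  23710236745, 26001236745, 26010236745, 26001263475, 26010263475, 57701236745, 57710236745,
  57701263475, 57710263475]), (56, [66401543267, 21501543267, 23610534267, 31010534267, 48901534267,
  55501543267, 51601543267, 21210534267, 23701534267, 66410543267, 48910534267, 23601534267]),
  (67, [84901246735, 55201357624, 27601356724, 27610356724, 27801356724, 27810356724, 51601632547,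
  54301263475, 54310263475, 54701573462, 57701563472, 57710563472, 59701624357, 60101457623]),
  (67, [14701236745, 23701326754, 57801372564, 58001263475, 59101537642, 14901236745, 23501236745,
  23601236745, 24601236745, 25501236745, 26301237645, 26601236745, 27901236745, 56910236745,
  59601236745]), (67, [85101246735, 23801356724, 59201236745, 59710536742, 51801356724, 54601375264,
  59210236745, 59801536742, 59810536742, 60001546732, 60010546732, 63901563472]), (67, [14901236745,
  59901236745, 14901237645, 15110236745, 15110237645, 23501236745, 23601326754, 24201236745,
  24201237645, 24501326754, 24910236745, 25001236745, 27901236745, 27901237645, 30101326754,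
  30101327654, 33701236745, 59901237645]), (56, [66910543267, 22810534267, 22601534267, 22710534267,
  22901534267, 23010534267, 23101534267, 23210543267, 23310534267, 23410534267, 23510543267,
  31110534267, 36310543267, 42810534267, 50910534267, 54101543267]), (67, [97701236745, 26301236745,
  26710263475, 30001236745, 35701236745, 38701263475, 39901236745, 52301263475, 54701263475,
  55101263475, 55601624357, 57201236745]), (67, [63810573462, 22710536742, 50010356724, 54901263475,
  28610356724, 28910356724, 37501264375, 38810375264, 43601236745, 55201264375, 55710632547,
  57901623457, 59810563472]), (67, [22801263475, 22810356724, 54910563472, 57410236745, 60501546732,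
  22701623457, 29110623457, 29610356724, 35201264375, 35910537642, 37601472563, 45301263475,
  57610236745, 57901356724, 59410362574]), (67, [98010326754, 22901327654, 55901624357, 25301236745,
  26601237645, 29201653427, 51201236745, 56601236745, 59001236745, 59901236745]), (67, [98110236745,
  64110372564, 26301236745, 22101326754, 23001563472, 28910237645, 50801236745, 51510326754,
  56710236745, 58101327654, 59101456723]), (67, [98201236745, 98210326754, 15601236745, 25801326754,
  29310326754, 29310327654, 55210362574, 55210372564, 59201546732]), (67, [98301236745, 55101326754,
  23110653427, 23110753426, 25201236745, 25810236745, 30301326754, 30301327654, 51501236745,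
  51501237645, 55701263475, 58410642537, 58410742536]), (67, [98401236745, 98410326754, 50601236745,
  25810236745, 50601237645, 57901536742, 57901537642, 59401236745]), (67, [98501236745, 25201236745,
  27301236745, 27301263475, 32801236745, 36701236745, 36701263475, 39701236745, 41001236745,
  41001263475, 58001236745, 58001263475, 58901236745, 58901263475]), (56, [22701534267, 50501534267,
  51010534267, 58001534267, 22810534267, 22901534267, 23001543267, 23101543267, 23201534267,
  23301534267, 23601534267, 32401534267, 37501543267, 44001534267, 45401534267, 50401534627]),
  (67, [98710326754, 58901236745, 64501236745, 16101236745, 22601236745, 22701236745, 26501327654,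
  27501237645, 29401642537, 58701237645, 59101263475, 59701236745]), (67, [58301236745, 58301563472,
  59001263475, 59001536742, 26601356724, 26601623457, 29910356724, 29910623457, 37001264375,
  37001537642, 38701264375, 39201357624, 39201624357, 40701365274, 61201263475, 61201536742]),
  (67, [46501246735, 51101356724, 51401236745, 55910563472, 59801537642, 29101356724, 29201356724,
  29301356724, 29601623457, 38801356724, 39301642537, 40101357624, 41401365274, 46101536742,
  58901356724]), (67, [99010236745, 64810237645, 16601236745, 22910236745, 29210237645, 29310236745,
  30101653427, 32010327654, 32110326754, 35110236745, 51710327654, 58510273465]), (67, [99101236745,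
  61501563472, 23101236745, 23101237645, 25101236745, 25201356724, 26301236745, 28201326754,
  35301546732, 51601326754, 51601327654, 51601426753, 51601427653]), (67, [99201236745, 23001236745,
  23001263475, 25910236745, 27901236745, 27901263475, 33401236745, 40301236745, 41501236745,
  41501263475, 52601236745, 52601263475, 56601236745, 56601263475]), (56, [23410534267, 51010534267,
  52301534267, 62110534267, 22510534267, 22610543267, 22701534267, 22810534267, 22910543267,
  23010534267, 24410534267, 27610534267, 33010534267, 38110543267, 51110534627, 58701534267]),
  (67, [39201264375, 39210547632, 51610356724, 51601623457, 23201236745, 23210563472, 24210356724,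
  24201623457, 30901356724, 30910623457, 39201274365, 41210365274, 56801264375, 56810537642,
  61810263475, 61801536742]), (67, [59610623457, 29401356724, 29501356724, 29910356724, 30001623457,
  30501356724, 30801356724, 31201356724, 34101537642, 37010264375, 39310472563, 40601357624,
  41801365274, 43601563472, 46601536742, 47201263475, 52001236745]), (67, [23601236745, 61501326754,
  17101236745, 17201236745, 22601236745, 22701236745, 24401327654, 27501236745, 28301237645,
  29601237645, 30101642537, 31101653427, 31701327654, 32801362574, 36501236745, 46001236745,
  52801236745, 53001263475]), (67, [99710326754, 17101326754, 22710327654, 22810326754, 26810326754,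
  29610327654, 31901263475, 32610237645, 36601456723, 51901642537, 51901742536, 59801653427,
  61601246735]), (67, [87501236745, 87501362574, 18801236745, 34010326754, 34101326754, 54401263475,
  54410263475, 54401623457, 54410623457, 61001263475, 61001623457]), (27, [69201243576, 43010234576,
  22310234576, 22410234576, 22501234576, 22601234576, 22701234576, 22801234576, 41601243576,
  51410243576, 51501243576, 52701243576, 53701243576, 58901243576, 59001234576, 59101234576]),
  (26, [69301243567, 43110234657, 22410234657, 22510234657, 22601234657, 22701234657, 22801234657,
  22901234657, 41701243657, 51510243657, 51601243657, 52801243657, 53801243657, 59001243657,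
  59101234657, 59201234657]), (67, [66401237645, 25001372564, 25001732546, 19101426753, 40710246735,
  40710264375, 40801246735, 40801264375, 41001375264, 41001735246, 41210246735, 41301246735,
  47901246735, 47901264375, 63001246735, 63001264375]), (67, [66201264375, 19201236745, 42901624357,
  61101236745, 61501237645, 34810236745, 37410236745, 37601236745, 38210236745, 41001745236,
  43101327654, 60101264375, 61301264375, 63201264375]), (67, [88001362574, 43001624357, 48010263475,
  59810236745, 60801236745, 44801236745, 48201236745, 52801236745, 60001236745, 66501263475,
  66601326754]), (67, [25301263475, 60401623457, 60501623457, 60901236745, 61501574362, 30401623457,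
  30501623457, 31101623457, 32001623457, 38301264375, 40401623457, 41301624357, 42801632547,
  46901563472, 63801236745]), (67, [66510574362, 61010236745, 30401623457, 30601623457, 30701623457,
  30810356724, 31001623457, 31301623457, 31401623457, 31701623457, 38101264375, 40201623457,
  41101357624, 41801642537, 42701632547, 46601563472, 48001263475]), (67, [88301362574, 60601356724,
  60601623457, 28601356724, 28601623457, 30510356724, 30510623457, 38001264375, 38001537642,
  41301375264, 41301642537, 64001237645, 64001564372]), (67, [25601623457, 60801623457, 61601537642,
  62501563472, 23001623457, 25501623457, 28501623457, 28701623457, 31610623457, 39101264375,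
  40801264375, 41201624357, 42801632547, 45201236745, 47701546732, 62901263475]), (67, [88501362574,
  25701356724, 25710623457, 28510356724, 28501623457, 30801356724, 30810623457, 31010356724,
  31001623457, 38010264375, 38001537642, 48301273465, 48310546732]), (67, [66910574362, 53110356724,
  60401236745, 60910623457, 62710563472, 23201623457, 28601623457, 32201356724, 39001264375,
  40501264375, 41101624357, 41501375264, 42901632547, 64201264375]), (67, [88701362574, 20001537642,
  23301623457, 23310623457, 31101623457, 31110623457, 53501236745, 53510236745, 58201624357,
  60701236745, 60710236745, 63901357624, 64201236745, 67201263475]), (56, [56110534267, 56201534267,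
  22901534267, 22901543267, 23001534267, 23001543267, 23101534267, 23201534267, 23201543267,
  23301534627, 47901534267, 51301534267, 51301543267, 56201543267, 59801534267, 59901534267,
  60010534267, 63901534267]), (67, [101210236745, 88901273465, 67101236745, 67101246735,
  45101236745, 61701326754, 61701426753, 64301563472]), (67, [101310236745, 89001273465,
  45210237645, 46010236745, 46010246735, 47701236745, 48701237645, 49801326754, 49801426753,
  61810326754, 61810426753]), (67, [101410236745, 89101236745, 26301742536, 30201263475,
  33410236745, 43501624357, 61101236745, 62301236745, 63201263475, 67410237645]),
  (67, [101510236745, 89201236745, 67501264375, 30201263475, 34010236745, 34310263475, 42101263475,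
  43501624357, 61010236745, 63301263475]), (67, [89301246735, 58610563472, 59501365274, 32501356724,
  32601356724, 32701356724, 33010623457, 33101356724, 42901357624, 47301236745, 61601356724,
  62301537642, 64201536742]), (36, [77001325467, 58001325467, 68101325467, 22601325467, 22610325467,
  22701325467, 22710325467, 22801325467, 22810325467, 22901325647, 56201325467, 58010325467,
  60001325467, 60101352467]), (67, [89501573462, 28201623457, 63601563472, 64110263475, 56201623457,
  59001642537, 63610563472, 64201263475, 64210263475, 64401273465, 64410273465, 68301236745]),
  (67, [89601236745, 89601362574, 28301642537, 20901236745, 28310642537, 54401236745, 54410236745,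
  56501623457, 56510623457, 68101263475]), (67, [102010326754, 89701372564, 26001326754,
  23401236745, 23501236745, 32101653427, 56601623457, 62701465273, 63801327654, 64601462573]),
  (67, [102110326754, 89801236745, 23610236745, 23610237645, 24401653427, 24401753426, 29010236745,
  29301326754, 58501246735, 63901362574, 63901372564]), (56, [69001534267, 55901534267, 55910534267,
  57301534267, 57310543267, 24901534267, 24910534267, 57101534267, 57101543267, 60401534267,
  60410534267, 61101534267, 61110534267, 65801534267]), (67, [68601237645, 65801642537, 45501263475,
  45510263475, 45601263475, 45701263475, 45710263475, 45801263475, 46701263475, 46710263475,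
  63901263475, 63910263475, 65801263475, 68901263475]), (67, [102410236745, 50101236745,
  63201263475, 46801263475, 46801264375, 47301263475, 47301264375, 49101263475, 50001263475,
  51101263475, 51101264375, 63201264375]), (67, [102510236745, 90201263475, 50210236745,
  60501735246, 60501745236, 63801263475, 63801264375, 63901263475, 68510263475, 68510264375]),
  (56, [69401534267, 55501543267, 55510543267, 56701543267, 56710543267, 21801534267, 21901543267,
  22001534267, 22101543267, 22201543627, 38001543267, 38010543267, 60301534267, 60310534267]),
  (67, [90401236745, 69301236745, 50301236745, 50310236745, 62601236745, 62610236745, 62601237645,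
  62610237645, 64001236745, 64001237645, 69401246735]), (67, [37301263475, 60401632547, 60401645237,
  64101236745, 64101546732, 23601264375, 23601563472, 37501263475, 37510263475, 41301263475,
  41310263475, 41301564372, 41310564372, 64110236745, 64110546732]), (67, [45601246735, 45601357624,
  41201246735, 41201357624, 43710264375, 43710375264, 43801264375, 43810264375, 43801375264,
  43810375264, 46401263475, 69501246735]), (67, [41301236745, 41301547632, 64301237645, 64301264375,
  64301546732, 64301573462, 41310236745, 41310547632, 60601326754, 60601457623, 64310237645,
  64310264375, 64310546732, 64310573462]), (27, [78401243576, 23601243576, 21701234576, 21801234576,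
  25501234576, 25801243576, 54610234576, 54701234576, 55701234576, 55901234576, 56210234576,
  56901234576, 60010234576, 62201234576, 72401234576]), (67, [90901246735, 50901263475, 58601365274,
  65401263475, 58601375264, 60310263475, 60701563472, 60701573462, 64301246735, 64301247635,
  69210246735, 69210247635]), (67, [61201365274, 64401246735, 64401573462, 33801356724, 33801623457,
  33901356724, 33901623457, 34001356724, 34001623457, 35101356724, 35101623457, 43401356724,
  44701357624, 44701624357, 49901236745, 49901563472, 61201632547]), (67, [28301536742, 63401356724,
  63501356724, 63901563472, 64501247635, 33401356724, 33501356724, 34101356724, 35001356724,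
  41301537642, 43401356724, 44301357624, 45801365274, 49901236745, 66801563472]), (67, [69501246735,
  69510573462, 33810356724, 33801623457, 34101356724, 34110623457, 34910356724, 34901623457,
  43110356724, 44510357624, 44501624357, 46110365274, 49710236745, 49701563472, 63610356724,
  63601623457]), (67, [69601247635, 64101563472, 33510356724, 33710356724, 33810356724, 33901623457,
  34110356724, 34410356724, 34510356724, 34810356724, 41210537642, 43310356724, 44210624357,
  44910375264, 45810365274, 49710236745, 51110536742]), (46, [79001452367, 55801452367, 73001425367,
  21401425367, 21510425367, 21601425367, 21701425367, 22601425367, 26901425367, 27810425367,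
  28901425367, 37601425367, 55710425367, 57310425367]), (67, [103810326754, 56510237645,
  57201263475, 21201236745, 30601236745, 33101326754, 34710327654, 35201653427, 37101237645,
  61701263475, 63801237645, 64801546732]), (56, [59710534267, 26601534267, 58601543267, 59601534267,
  20710534267, 20801534267, 20901534267, 21001543267, 21101534267, 21201534267, 25210534267,
  29601534267, 56801543267, 57601543267, 59801534267]), (67, [104010236745, 91701236745,
  51710263475, 62001465273, 62001475263, 65301236745, 65301237645, 65401236745, 70010236745,
  70010237645]), (67, [91801236745, 64401236745, 46110236745, 46201236745, 46310236745, 46410327654,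
  46501236745, 46601327654, 47001327654, 47301263475, 51901327654, 65610326754, 70301623457,
  70401326754]), (67, [104210236745, 58801623457, 64701236745, 33601263475, 36301263475,
  36401263475, 41601236745, 44501263475, 46301236745, 50701263475, 64801624357, 65301236745]),
  (67, [70301236745, 58901623457, 62201624357, 64810236745, 29210742536, 37101263475, 37201263475,
  37301263475, 37410236745, 37501263475, 37610263475, 41501236745, 46301236745, 49201264375,
  50401263475]), (67, [104410236745, 92101362574, 33301236745, 37310236745, 37310263475,
  64701236745, 64701263475, 65501237645, 65501264375]), (67, [92201362574, 70501237645, 70510264375,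
  33101236745, 33110263475, 36601236745, 36610263475, 37510236745, 37501263475, 66001326754,
  66010623457]), (16, [70110243567, 21310234567, 56910352467, 20710234567, 20710325467, 20810234567,
  20810325467, 20910234567, 21010425367, 21010534267, 21110234567, 21110325467, 21210425367,
  21210534267, 21310325467, 70110352467]), (67, [104710236745, 104710326754, 26401236745,
  32701742536, 32701753426, 41801456723, 64801642537, 64801653427, 70501236745]), (67, [70610237645,
  70801236745, 29710753426, 26301236745, 26301326754, 26510236745, 29710742536, 35701642537,
  35701653427, 49510246735, 49510356724, 58001236745, 58001326754, 63310236745, 70801326754]),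
  (46, [19501425367, 19601425367, 19701425367, 19810425367, 19901425367, 20010425367, 20101452367,
  20201425367, 20310425367, 20401425367, 20501452367, 20601425367, 20701425367, 20801452367,
  20901425637, 26201425367, 26701452367, 27401425367, 29901425367, 33201425367]),
  (67, [105010236745, 71010375264, 26501236745, 26601236745, 32110326754, 32701742536, 32901236745,
  37801362574, 60610237645, 65001653427, 65001753426, 66001326754]), (47, [56501423756, 2501423756,
  2510423756, 2601423756, 2610423756, 2701423756, 2701432756, 2801423756, 15201423756, 15201432756,
  16801423756, 16810423756, 16801432756, 16810432756, 17801423756, 17810423756, 18601423756,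
  18901423756, 19601423756, 19601432756]), (67, [19101267345, 19110267345, 19101623745, 19110623745,
  19201267345, 19210267345, 19201267354, 19210267354, 19301267345, 19310267345, 19301623745,
  19310623745, 19401367245, 19401367254, 19401723645, 19401723654, 19501267345, 19601267345,
  19701267345, 19701267354, 19701623745, 19701623754]), (56, [18101523647, 18110523647, 18201523647,
  18210523647, 18201532647, 18210532647, 18301523647, 18310523647, 18401523647, 18410523647,
  18501523647, 18510523647, 18601523647, 18701256374, 18701356274, 18801623574, 18901256347,
  18901356247, 19001523647, 19101623547, 19501523647, 19501532647]), (47, [17201423756, 17301423756,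
  17301432756, 17401423756, 17510423756, 17510423765, 17601423756, 17601432756, 17701423756,
  17701423765, 17801423756, 17901247356, 17901247365, 17901347256, 17901347265, 18001423756,
  18101423756, 18101423765, 18401723456, 18401723465, 19501423756, 19501432756]), (47, [16201423756,
  16301423756, 16401423756, 16510423756, 16510423765, 16601423756, 16701423756, 16801423756,
  16801423765, 16901347256, 16901347265, 17001423756, 17101247356, 17101247365, 17201423756,
  17201423765, 17410423756, 17701423756, 18401723456, 18401723465, 19401432756, 19601247356]),
  (67, [57001623745, 4210623745, 4210623754, 4301623745, 4301623754, 4401623745, 5201267345,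
  5201267354, 5201367245, 5201367254, 16310623745, 16310632745, 16401623745, 16401632745,
  17410623745, 17601623745, 18401723645, 18401723654, 19501267345, 19501367245]), (46, [14701423657,
  14710423657, 14801423657, 14810423657, 14901423657, 14910423657, 15001423657, 15010423657,
  15101423657, 15110423657, 15201246357, 15301246357, 15401423657, 15501423657, 15510423657,
  15601246357, 15701423657, 15801423657, 15901246357, 16001432657, 16101423657, 19301423657]),
  (57, [2701523746, 2801357264, 2901523746, 3001523746, 3101523746, 12501523746, 12510523746,
  12601523746, 12610523746, 13701523746, 13710523746, 13801523746, 13810523746, 13901523746,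
  13910523746, 14001523746, 14010523746, 14401257364, 14701257346, 15401357246, 20001523746,
  20301532746]), (45, [3201245367, 3201245376, 3201354267, 3201354276, 3201423567, 3201423576,
  3201532467, 3201532476, 12801245367, 12810245367, 12801245376, 12810245376, 14201245367,
  14210245367, 14201354267, 14210354267, 14201423567, 14210423567, 14201532467, 14210532467,
  20301254367, 20301345267]), (56, [2901256347, 3001265347, 3101256347, 3201256347, 3301256347,
  12701256347, 12710256347, 12801256347, 12810256347, 13901256347, 13910256347, 14001256347,
  14010256347, 14101256347, 14110256347, 14201256347, 14210256347, 14601256347, 14901256347,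
  15601265347, 20201256347, 20501265347]), (47, [2410347256, 2510347256, 2601347256, 2701347256,
  2801347256, 2901347256, 4401347256, 6501347256, 7101347256, 8210347256, 8801347256, 9901347256,
  10601347256, 11001432765, 11901247365, 14101374256, 14501374256, 14801374256, 15501432756,
  16701247356, 18601347256, 19001347256]), (56, [5101256347, 5210256347, 5310256347, 5401256347,
  5501256347, 5610256347, 5701256347, 5801256347, 5901356274, 6001523674, 6101256347, 6201256347,
  6610256347, 7201256347, 8201256347, 9801256347, 14301265347, 14701623574, 15001623547,
  15201523647, 16701356247, 19101265347]), (67, [13301267345, 13401267345, 13501267345, 13610267345,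
  13610267354, 13701267345, 13801267345, 13901267345, 14001267345, 14101267345, 14101267354,
  14201376245, 14201376254, 14301732645, 14301732654, 14401623745, 14401623754, 14501267345,
  14501267354, 14601267345, 20201632745, 20401276345]), (47, [11401423756, 11501423756, 11601423756,
  11701423756, 11810423756, 11901423756, 12001423756, 12110423756, 12201423756, 12310423756,
  12401432756, 12501423756, 12601423756, 12701247365, 12801423756, 12901423756, 13001247356,
  14501423756, 15501432756, 17001423756, 18101423756, 18901423756]), (67, [18301267345, 18401267345,
  18401276345, 18501267345, 18610267345, 18610267354, 18701267345, 18701276345, 18801267345,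
  18801267354, 18901267345, 19001623745, 19001623754, 19001723645, 19001723654, 19101267345,
  19201267345, 19201267354, 19501367245, 19501367254, 20601267345, 20601276345]), (56, [2910523647,
  3010523647, 3101523647, 3201523647, 3301523647, 3401523647, 4901523647, 7001523647, 7601523647,
  8710523647, 9301523647, 10401523647, 11101523647, 11501256374, 12401623574, 14601532647,
  15001532647, 15301532647, 16001256347, 17201623547, 19101523647, 19501523647]), (47, [10801247356,
  10801423756, 10910247356, 10910247365, 11001247356, 11001423756, 11101247356, 11101423756,
  11201347256, 11201347265, 11201723456, 11201723465, 11301247356, 11301247365, 11401247356,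
  12801247356, 12801247365, 12801423756, 12801423765, 14401247356, 18901247356, 18901423756]),
  (67, [9801267345, 9901267345, 10001267345, 10110267345, 10110267354, 10201267345, 10301267345,
  10401367245, 10401367254, 10501267345, 10501267354, 10601723645, 10601723654, 10701267345,
  10801267345, 10801267354, 11201267345, 12001623745, 12001623754, 14401267345, 17601623745,
  19001276345]), (47, [3010247356, 3010247365, 3001423756, 3001423765, 3110247356, 5201347256,
  5201347265, 5210723456, 5210723465, 8610247356, 8601423756, 10110247356, 10101423756, 11201247356,
  11210423756, 12610247356, 12610247365, 12601423756, 12601423765, 14010247356, 18810247356,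
  18801423756]), (47, [9401247356, 9410247356, 9501347256, 9501347265, 9601247356, 9610247356,
  9601247365, 9610247365, 9701723456, 9701723465, 9801247356, 9901247356, 9901247365, 10501247356,
  10510247356, 11301247356, 11310247356, 12501423756, 12501423765, 14401247356, 18101423756,
  19401247356]), (67, [8610267345, 8710267345, 8801623745, 8901267345, 8901267354, 9010267345,
  9010267354, 9101367245, 9101367254, 9201723645, 9201723654, 9310267345, 9310267354, 9410267345,
  10210267345, 10601267345, 11210267345, 12110623745, 12110623754, 14110267345, 17810623745,
  19010276345]), (47, [8001247356, 8110247356, 8110247365, 8201723456, 8201723465, 8301347256,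
  8301347265, 8401247356, 8401247365, 8501247356, 8601247356, 8601247365, 8701247356, 8901247356,
  9601247356, 10601247356, 11601423756, 12501423756, 12501423765, 14701247356, 18401423756,
  19201247356]), (47, [7510423756, 7510423765, 7601247356, 7601247365, 7701723456, 7701723465,
  7810347256, 7810347265, 7901247356, 8001247356, 8001247365, 8101247356, 8901247356, 9710247356,
  10301247356, 10510423756, 11401423756, 12401423756, 12401423765, 14501247356, 18201423756,
  19101247356]), (47, [2810423756, 2901423756, 3010423756, 3101423756, 3201423756, 3301423756,
  3401423756, 5401423756, 5801423756, 5901423756, 7001423756, 7101423756, 7501423756, 9610423756,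
  11401423756, 12201432756, 12510423756, 12701423756, 15401423756, 16601432756, 17901423756,
  19101432756]), (56, [6401523647, 6510523647, 6610523647, 6701523647, 6801523647, 6910523647,
  7001523647, 7101523647, 7201623574, 7301256374, 7401523647, 7501523647, 7910523647, 8501523647,
  9501523647, 11101523647, 15601532647, 16001356274, 16301356247, 16501256347, 18001623547,
  20401532647]), (67, [59001267345, 6210267345, 6210267354, 6301267345, 6301267354, 6401267345,
  7201623745, 7201623754, 7201723645, 7201723654, 18310267345, 18310276345, 18401267345,
  18401276345, 19410267345, 19601267345, 20401367245, 20401367254, 21501623745, 21501723645]),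
  (47, [10701423756, 10801423756, 10901423756, 11010423756, 11010423765, 11101423756, 11201423756,
  11301723456, 11301723465, 11401423756, 11401423765, 11501347256, 11501347265, 11601423756,
  11701423756, 11701423765, 12101423756, 12901247356, 12901247365, 15301374256, 18501247356,
  19901432756]), (47, [9301423756, 9401423756, 9510247356, 9610423756, 9610423765, 9701423756,
  9701423765, 9810723456, 9810723465, 9910347256, 9910347265, 10001423756, 10001423765, 10101423756,
  10901423756, 11310423756, 11901423756, 12801247356, 12801247365, 14810374256, 18501247356,
  19701432756]), (67, [3010267345, 3010267354, 3101267345, 3101267354, 3201267345, 5701267345,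
  5701623745, 6401267345, 6401267354, 6401623745, 6401623754, 7101367245, 7101367254, 7101723645,
  7101723654, 9510267345, 9510623745, 11301267345, 11301623745, 15601376245, 18701276345,
  18701632745]), (67, [2901267345, 2901267354, 2910623745, 2910623754, 3001267345, 5810267345,
  5801623745, 6401267345, 6401267354, 6410623745, 6410623754, 7010367245, 7010367254, 7001723645,
  7001723654, 9510267345, 9501623745, 11001267345, 11010623745, 15110376245, 18701276345,
  18710632745]), (47, [59501247356, 5901423756, 5910423756, 6001423756, 6010423756, 6001423765,
  6010423765, 6101423756, 6101423765, 6201347256, 6201347265, 6301423756, 7001723456, 7001723465,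
  8901247356, 8910247356, 11201423756, 11210423756, 15501374256, 19201432756]), (56, [2501562347,
  2510562347, 2501562437, 2510562437, 2501563427, 2510563427, 2601562347, 2610562347, 2601652347,
  2610652347, 2701562347, 2710562347, 2801562734, 2801563724, 2801564723, 2901562347, 2901562437,
  2901563427, 2901652347, 2901652437, 2901653427, 3001562347, 3001562437, 3001563427]),
  (46, [1901462357, 1910462357, 1901642375, 1910642375, 2001462357, 2010462357, 2001463257,
  2010463257, 2101462357, 2110462357, 2101642375, 2110642375, 2201462537, 2201463527, 2201642735,
  2201643725, 2301465723, 2401462537, 2401463527, 2401642735, 2401643725, 2501462357, 3001462375,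
  3001642357]), (27, [1001273456, 1101273456, 1210273456, 1210273546, 1210274536, 1301273456,
  1410273456, 1501273456, 1501273546, 1501274536, 1601273456, 1701273645, 1701274635, 1701275634,
  1801273456, 1801273546, 1801274536, 1901273456, 1901273546, 1901274536, 2001273456, 2001273546,
  2001274536, 2801273456]), (56, [301562347, 410562347, 410562437, 410563427, 501562347, 501562437,
  501563427, 610562347, 701562347, 801562347, 801562437, 801563427, 901562734, 901563724, 901564723,
  1001562347, 1001562437, 1001563427, 1110562347, 1201562347, 2101652374, 2101652473, 2101653472,
  2901652347])]

/-- The positions to which Breaker's first moves lead, in the encoding of `refer`. -/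
def openings : List ℕ :=
  [001456723, 010456723, 001457623, 010457623, 001467523, 010467523, 001567423, 010567423,
  101456723, 110456723, 101456732, 110456732, 201452367, 201462357, 201472356, 201562347, 201572346,
  201672345, 301456273, 301456372, 301457263, 301457362, 301467253, 301467352, 301567243, 301567342]

set_option maxRecDepth 100000 in
theorem combine_openings :
    combine (openings.map (refer (table rows start))) = pack 565234498108348 565234498108414 := by
  decide +kernel

theorem makerWins_board : MakerWins goal .breaker (board \ {s(0, 1), s(2, 3)}) ∅ := by
  have h : Wins .breaker (pack 565234498108348 565234498108414) := by
    rw [← combine_openings]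
    exact wins_combine
      (by simpa using fun r _ => wins_refer (wins_slot_table rows wins_slot_start) r)
  have hfree : edges 0 565234498108348 = board \ {s(0, 1), s(2, 3)} := by decide +kernel
  have hunowned : edges 0 565234498108414 = board := by decide +kernel
  rwa [Wins, edges_zero_pack, edges_fifty_pack, hfree, hunowned, Finset.sdiff_self] at h

end Certificate

theorem exists_embedding_of_nodup {V : Type*} {W : Finset V} {k : ℕ}
    (hk : W.card = k) {l : List V} (hl : l.Nodup) (hlW : ∀ x ∈ l, x ∈ W) :
    ∃ f : Fin k ↪ V, Finset.univ.map f = W ∧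
      ∀ (i : Fin k) (hi : i < l.length), f i = l[i] := by
  classical
  set l' := l ++ (W \ l.toFinset).toList with hl'
  have hnodup : l'.Nodup := by
    refine hl.append (Finset.nodup_toList _) fun x hx hx' => ?_
    simp only [Finset.mem_toList, Finset.mem_sdiff, List.mem_toFinset] at hx'
    exact hx'.2 hx
  have hW : l'.toFinset = W := by
    ext x
    simp only [hl', List.mem_toFinset, List.mem_append, Finset.mem_toList, Finset.mem_sdiff]
    grind
  have hlength : l'.length = k := by rw [← List.toFinset_card_of_nodup hnodup, hW, hk]
  let f : Fin k ↪ V := ⟨fun i => l'[i], fun i j hij => Fin.ext (hnodup.getElem_inj_iff.1 hij)⟩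
  refine ⟨f, Finset.eq_of_subset_of_card_le (fun x hx => ?_) (by simp [hk]),
    fun i hi => List.getElem_append_left hi⟩
  obtain ⟨i, -, rfl⟩ := Finset.mem_map.1 hx
  rw [← hW, List.mem_toFinset]
  exact List.getElem_mem _

theorem winsWithTwoMissingEdges_eight (V : Type*) [DecidableEq V] :
    WinsWithTwoMissingEdges V 8 := by
  intro W u v x y hW hnodup hmem
  obtain ⟨f, hf, hfl⟩ := exists_embedding_of_nodup hW hnodup hmem
  have h0 : f 0 = u := hfl 0 (by simp)
  have h1 : f 1 = v := hfl 1 (by simp)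
  have h2 : f 2 = x := hfl 2 (by simp)
  have h3 : f 3 = y := hfl 3 (by simp)
  have hgoal : ∀ A ∈ Certificate.goal, A.map f.sym2Map ∈ pathSets W u v := fun A hA => by
    simpa only [hf, h0, h1] using map_mem_pathSets f hA
  have h := Certificate.makerWins_board.map f.sym2Map hgoal
  rw [Finset.map_sdiff, map_cliqueEdges, hf] at h
  simpa only [Finset.map_insert, Finset.map_singleton, Finset.map_empty,
    Function.Embedding.sym2Map_apply, Sym2.map_mk, h0, h1, h2, h3] using h

section Walks

variable {V : Type*} [DecidableEq V] {G : SimpleGraph V}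

theorem exists_mem_fixedHamPathSets {W : Finset V} {u v : V} {A : Finset (Sym2 V)}
    (hA : A ∈ pathSets W u v) (hG : ∀ e ∈ A, e ∈ G.edgeSet) :
    ∃ B ∈ fixedHamPathSets G W u v, B ⊆ A := by
  obtain ⟨l, hl, hu, hv, hW, hc⟩ := hA
  have hle : SimpleGraph.fromEdgeSet (A : Set (Sym2 V)) ≤ G := fun x y h => hG _ h.1
  have hchain : l.IsChain (SimpleGraph.fromEdgeSet (A : Set (Sym2 V))).Adj :=
    hc.imp fun x y h => ⟨h, SimpleGraph.Adj.ne (hG _ h)⟩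
  have hne : l ≠ [] := by
    rintro rfl
    simp at hu
  obtain rfl : l.head hne = u := by simpa [List.head?_eq_some_head hne] using hu
  obtain rfl : l.getLast hne = v := by simpa [List.getLast?_eq_some_getLast hne] using hv
  let p := SimpleGraph.Walk.ofSupport l hne hchain
  have hp : p.support = l := SimpleGraph.Walk.support_ofSupport hne hchain
  refine ⟨_, ⟨p.mapLe hle, ?_, ?_, rfl⟩, fun e he => ?_⟩
  · rwa [SimpleGraph.Walk.isPath_def, SimpleGraph.Walk.support_mapLe_eq_support, hp]
  · rw [SimpleGraph.Walk.support_mapLe_eq_support, hp, hW]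
  · rw [List.mem_toFinset, SimpleGraph.Walk.edges_mapLe_eq_edges] at he
    have := p.edges_subset_edgeSet he
    rw [SimpleGraph.edgeSet_fromEdgeSet] at this
    exact this.1

theorem mem_tail_support_iff {u v : V} {p : G.Walk u v} (hp : p.IsPath) {S : Finset V}
    (hS : p.support.toFinset = insert u S) (hu : u ∉ S) {x : V} :
    x ∈ p.support.tail ↔ x ∈ S := by
  have hx : x ∈ p.support ↔ x = u ∨ x ∈ S := by rw [← List.mem_toFinset, hS, Finset.mem_insert]
  have hnodup := hp.support_nodup
  rw [← p.cons_tail_support] at hx hnodup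
  grind

theorem isHamiltonianCycle_of_tail_support [Fintype V] {v : V} {p : G.Walk v v}
    (hV : 3 ≤ Fintype.card V) (hp : p.support.tail.Nodup) (hmem : ∀ x, x ∈ p.support.tail) :
    p.IsHamiltonianCycle := by
  have hlength : p.length = Fintype.card V := by
    have htail : p.support.tail.toFinset = Finset.univ := by
      ext x
      simp [hmem x]
    rw [← Finset.card_univ, ← htail, List.toFinset_card_of_nodup hp, List.length_tail,
      SimpleGraph.Walk.length_support, Nat.add_sub_cancel]
  have hnil : ¬ p.Nil := by
    rw [SimpleGraph.Walk.not_nil_iff_lt_length]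
    omega
  rw [SimpleGraph.Walk.isHamiltonianCycle_iff_isCycle_and_length_eq,
    SimpleGraph.Walk.isCycle_iff_isPath_tail_and_le_length, SimpleGraph.Walk.isPath_def,
    SimpleGraph.Walk.support_tail_of_not_nil _ hnil]
  exact ⟨⟨hp, by omega⟩, hlength⟩

end Walks

theorem card_filter_natCast_zmod_eq (n : ℕ) {m : ℕ} [NeZero m] (i : ZMod m) :
    (Finset.univ.filter fun v : Fin n => ((v : ℕ) : ZMod m) = i).card =
      n / m + if i.val < n % m then 1 else 0 := by
  have hiff (x : ℕ) : (x : ZMod m) = i ↔ x ≡ i.val [MOD m] := by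
    rw [← ZMod.natCast_eq_natCast_iff, ZMod.natCast_zmod_val]
  have hcount := Nat.count_modEq_card n (Nat.pos_of_neZero m) i.val
  rw [Nat.mod_eq_of_lt i.val_lt] at hcount
  rw [← hcount, Nat.count_eq_card_filter_range, Finset.card_filter, Finset.card_filter,
    ← Fin.sum_univ_eq_sum_range (fun x => if x ≡ i.val [MOD m] then 1 else 0)]
  simp only [hiff]

namespace CliqueCycle

variable {n : ℕ} (C : CliqueCycle n)

/-- The board of the `i`-th Fixed Hamiltonian Path game. -/
def board (i : ZMod (n / 7)) : Finset (Sym2 (Fin n)) :=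
  cliqueEdges (C.W i) \ {s(C.a (i - 1), C.a i)}

theorem mk_mem_board {i : ZMod (n / 7)} {x y : Fin n} : s(x, y) ∈ C.board i ↔
    (x ∈ C.W i ∧ y ∈ C.W i ∧ x ≠ y) ∧ s(x, y) ≠ s(C.a (i - 1), C.a i) := by
  rw [board, Finset.mem_sdiff, mk_mem_cliqueEdges, Finset.mem_singleton]

theorem mem_edgeSet_iff {e : Sym2 (Fin n)} : e ∈ C.graph.edgeSet ↔ ∃ i, e ∈ C.board i := by
  induction e with
  | _ x y =>
  simp only [SimpleGraph.mem_edgeSet, graph, mk_mem_board]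
  grind

theorem board_subset_edgeBoard (i : ZMod (n / 7)) : C.board i ⊆ edgeBoard C.graph := fun e he => by
  rw [edgeBoard, Set.Finite.mem_toFinset, mem_edgeSet_iff]
  exact ⟨i, he⟩

theorem board_subset_edgeBoardOn (i : ZMod (n / 7)) :
    C.board i ⊆ edgeBoardOn C.graph (C.W i) := fun e he => by
  rw [edgeBoardOn, Set.Finite.mem_toFinset]
  refine ⟨C.mem_edgeSet_iff.2 ⟨i, he⟩, ?_⟩
  induction e with
  | _ x y =>
  rw [mk_mem_board] at he
  rw [Sym2.ball]
  exact ⟨he.1.1, he.1.2.1⟩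

theorem eq_of_mem_of_mem {i j : ZMod (n / 7)} {v : Fin n} (hi : v ∈ C.V i) (hj : v ∈ C.V j) :
    i = j := by
  by_contra h
  exact Finset.disjoint_left.1 (C.disjoint i j h) hi hj

theorem a_injective : Function.Injective C.a := fun i j h =>
  C.eq_of_mem_of_mem (C.a_mem i) (h ▸ C.a_mem j)

theorem a_sub_one_mem_W (i : ZMod (n / 7)) : C.a (i - 1) ∈ C.W i := Finset.mem_insert_self _ _

theorem a_mem_W (i : ZMod (n / 7)) : C.a i ∈ C.W i := Finset.mem_insert_of_mem (C.a_mem i)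

theorem eq_a_of_mem_W {i j : ZMod (n / 7)} (hij : i ≠ j) {v : Fin n} (hi : v ∈ C.W i)
    (hj : v ∈ C.W j) : v = C.a (i - 1) ∧ j = i - 1 ∨ v = C.a (j - 1) ∧ i = j - 1 := by
  rw [W, Finset.mem_insert] at hi hj
  rcases hi with rfl | hi <;> rcases hj with hj | hj
  · exact absurd (sub_left_injective (C.a_injective hj)) hij
  · exact .inl ⟨rfl, C.eq_of_mem_of_mem hj (C.a_mem _)⟩
  · exact .inr ⟨hj, C.eq_of_mem_of_mem hi (hj ▸ C.a_mem _)⟩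
  · exact absurd (C.eq_of_mem_of_mem hi hj) hij

theorem disjoint_board (hn : 3 ≤ n / 7) {i j : ZMod (n / 7)} (hij : i ≠ j) :
    Disjoint (C.board i) (C.board j) := by
  have hsub_two (k : ZMod (n / 7)) : k - 1 - 1 ≠ k := fun h => by
    have htwo : ((2 : ℕ) : ZMod (n / 7)) = 0 := by
      push_cast
      linear_combination -h
    rw [ZMod.natCast_eq_zero_iff] at htwo
    exact absurd (Nat.le_of_dvd two_pos htwo) (by omega)
  rw [Finset.disjoint_left]
  intro e hei hej
  induction e with
  | _ x y =>
  obtain ⟨⟨hxi, hyi, hxy⟩, -⟩ := C.mk_mem_board.1 hei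
  obtain ⟨⟨hxj, hyj, -⟩, -⟩ := C.mk_mem_board.1 hej
  rcases C.eq_a_of_mem_W hij hxi hxj with ⟨hx, hji⟩ | ⟨hx, hij'⟩ <;>
    rcases C.eq_a_of_mem_W hij hyi hyj with ⟨hy, hji'⟩ | ⟨hy, hij''⟩
  · exact hxy (hx.trans hy.symm)
  · exact hsub_two i (by rw [← hji, ← hij''])
  · exact hsub_two i (by rw [← hji', ← hij'])
  · exact hxy (hx.trans hy.symm)

section

variable (hn : 2 ≤ n / 7)

include hn

theorem sub_one_ne (i : ZMod (n / 7)) : i - 1 ≠ i := by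
  have : Fact (1 < n / 7) := ⟨hn⟩
  simp

theorem a_sub_one_ne_a (i : ZMod (n / 7)) : C.a (i - 1) ≠ C.a i :=
  C.a_injective.ne (sub_one_ne hn i)

theorem a_sub_one_notMem_V (i : ZMod (n / 7)) : C.a (i - 1) ∉ C.V i := fun h =>
  sub_one_ne hn i (C.eq_of_mem_of_mem (C.a_mem _) h)

theorem card_W (i : ZMod (n / 7)) : (C.W i).card = if i.val < n % 7 then 9 else 8 := by
  rw [W, Finset.card_insert_of_notMem (C.a_sub_one_notMem_V hn i), C.card_V]
  split_ifs <;> rfl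

theorem card_board (i : ZMod (n / 7)) :
    (C.board i).card = 27 + if i.val < n % 7 then 8 else 0 := by
  have hmem : s(C.a (i - 1), C.a i) ∈ cliqueEdges (C.W i) :=
    mk_mem_cliqueEdges.2 ⟨C.a_sub_one_mem_W i, C.a_mem_W i, C.a_sub_one_ne_a hn i⟩
  rw [board, Finset.card_sdiff_of_subset (Finset.singleton_subset_iff.2 hmem),
    Finset.card_singleton, cliqueEdges, Sym2.card_image_offDiag, C.card_W hn]
  split_ifs <;> decide

/-- There are `27` edges per clique of order `8` and `35` per clique of order `9`, which makes
`27 m + 8 r` edges for `n = 7 m + r` vertices. -/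
theorem ncard_edgeSet_le (hr : 4 * (n % 7) ≤ n / 7) : C.graph.edgeSet.ncard ≤ 4 * n := by
  have : NeZero (n / 7) := ⟨by omega⟩
  have hedges : C.graph.edgeSet = (Finset.univ.biUnion C.board : Finset _) := by
    ext e
    simp [C.mem_edgeSet_iff]
  have hlarge : (Finset.univ.filter fun i : ZMod (n / 7) => i.val < n % 7).card ≤ n % 7 := by
    rw [← Finset.card_range (n % 7)]
    exact Finset.card_le_card_of_injOn ZMod.val (fun i hi => by simpa using hi)
      (ZMod.val_injective _).injOn
  rw [hedges, Set.ncard_coe_finset]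
  refine Finset.card_biUnion_le.trans ?_
  simp only [C.card_board hn, Finset.sum_add_distrib, Finset.sum_const, Finset.card_univ,
    ZMod.card, ← Finset.sum_filter, smul_eq_mul]
  omega

theorem makerWins_board (i : ZMod (n / 7)) :
    MakerWins (fixedHamPathSets C.graph (C.W i) (C.a (i - 1)) (C.a i)) .breaker (C.board i) ∅ := by
  have height := winsWithTwoMissingEdges_eight (Fin n)
  have hwin : MakerWins (pathSets (C.W i) (C.a (i - 1)) (C.a i)) .breaker (C.board i) ∅ := by
    have hcard := C.card_W hn i
    split_ifs at hcard
    · exact height.makerWins_succ (by norm_num) hcard (C.a_sub_one_mem_W i) (C.a_mem_W i)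
        (C.a_sub_one_ne_a hn i)
    · exact height.makerWins (by norm_num) hcard (C.a_sub_one_mem_W i) (C.a_mem_W i)
        (C.a_sub_one_ne_a hn i)
  refine hwin.mono_family fun A hA hAU => ?_
  rw [Finset.union_empty] at hAU ⊢
  exact exists_mem_fixedHamPathSets hA fun e he => C.mem_edgeSet_iff.2 ⟨i, hAU he⟩

theorem makerWinsSecond (i : ZMod (n / 7)) : MakerWinsSecond (edgeBoardOn C.graph (C.W i))
    (fixedHamPathSets C.graph (C.W i) (C.a (i - 1)) (C.a i)) :=
  (C.makerWins_board hn i).mono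
    ((C.board_subset_edgeBoardOn i).trans Finset.subset_union_left) subset_rfl

theorem exists_walk {A : Finset (Sym2 (Fin n))} (hA : A ∈ C.parallelSets) {k : ℕ}
    (hk : k ≤ n / 7) :
    ∃ q : C.graph.Walk (C.a (-1)) (C.a ((k : ZMod (n / 7)) - 1)), q.edges.toFinset ⊆ A ∧
      q.support.tail.Nodup ∧ ∀ x, x ∈ q.support.tail ↔ ∃ j < k, x ∈ C.V (j : ZMod (n / 7)) := by
  induction k with
  | zero => exact ⟨SimpleGraph.Walk.nil.copy rfl (by simp), by simp, by simp, by simp⟩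
  | succ k ih =>
    obtain ⟨q, hqA, hq, hqV⟩ := ih (by omega)
    obtain ⟨B, ⟨p, hp, hpW, rfl⟩, hpA⟩ := hA (k : ZMod (n / 7))
    have hpV (x : Fin n) : x ∈ p.support.tail ↔ x ∈ C.V k :=
      mem_tail_support_iff hp hpW (C.a_sub_one_notMem_V hn k)
    refine ⟨(q.append p).copy rfl (by simp), ?_, ?_, fun x => ?_⟩
    · rw [SimpleGraph.Walk.edges_copy, SimpleGraph.Walk.edges_append, List.toFinset_append]
      exact Finset.union_subset hqA hpA
    · rw [SimpleGraph.Walk.support_copy, SimpleGraph.Walk.tail_support_append]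
      refine hq.append hp.support_nodup.tail fun x hxq hxp => ?_
      obtain ⟨j, hj, hxj⟩ := (hqV x).1 hxq
      have hjk := congrArg ZMod.val (C.eq_of_mem_of_mem hxj ((hpV x).1 hxp))
      rw [ZMod.val_cast_of_lt (by omega), ZMod.val_cast_of_lt (by omega)] at hjk
      exact hj.ne hjk
    · rw [SimpleGraph.Walk.support_copy, SimpleGraph.Walk.tail_support_append, List.mem_append,
        hqV, hpV, Nat.exists_lt_succ_right]

theorem exists_mem_hamCycleSets {A : Finset (Sym2 (Fin n))} (hA : A ∈ C.parallelSets) :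
    ∃ B ∈ hamCycleSets C.graph, B ⊆ A := by
  have : NeZero (n / 7) := ⟨by omega⟩
  obtain ⟨q, hqA, hq, hqV⟩ := C.exists_walk hn hA le_rfl
  have hclosed : C.a (((n / 7 : ℕ) : ZMod (n / 7)) - 1) = C.a (-1) := by simp
  refine ⟨_, ⟨_, q.copy rfl hclosed, ?_, rfl⟩, by rwa [SimpleGraph.Walk.edges_copy]⟩
  refine isHamiltonianCycle_of_tail_support (by rw [Fintype.card_fin]; omega)
    (by rwa [SimpleGraph.Walk.support_copy]) fun x => ?_
  rw [SimpleGraph.Walk.support_copy, hqV]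
  obtain ⟨i, hi⟩ := C.cover x
  exact ⟨i.val, i.val_lt, by simpa using hi⟩

end

theorem makerWinsFirst_parallel (hn : 3 ≤ n / 7) :
    MakerWinsFirst (edgeBoard C.graph) C.parallelSets := by
  refine (MakerWins.parallel (fun _ _ => C.disjoint_board hn) fun i => ?_).maker_of_breaker
  rw [Finset.inter_eq_right.2 (C.board_subset_edgeBoard i)]
  exact C.makerWins_board (by omega) i

theorem makerWinsHam (hn : 3 ≤ n / 7) : MakerWinsHam C.graph :=
  (C.makerWinsFirst_parallel hn).mono_family fun A hA _ => by
    simpa using C.exists_mem_hamCycleSets (by omega) hA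

/-- The parts are the residue classes modulo `n / 7`. -/
def ofResidues (h : n % 7 < n / 7) : CliqueCycle n where
  V i := {v : Fin n | ((v : ℕ) : ZMod (n / 7)) = i}
  a i := ⟨i.val, by
    have : NeZero (n / 7) := ⟨by omega⟩
    have := i.val_lt
    omega⟩
  disjoint i j hij := by
    rw [Finset.disjoint_left]
    grind
  cover v := ⟨((v : ℕ) : ZMod (n / 7)), by simp⟩
  card_V i := by
    have : NeZero (n / 7) := ⟨by omega⟩
    obtain ⟨hdiv, hmod⟩ : n / (n / 7) = 7 ∧ n % (n / 7) = n % 7 :=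
      (Nat.div_mod_unique (by omega)).2 ⟨by rw [mul_comm]; omega, h⟩
    rw [card_filter_natCast_zmod_eq, hdiv, hmod]
    split_ifs <;> rfl
  a_mem i := by
    have : NeZero (n / 7) := ⟨by omega⟩
    simp

end CliqueCycle

theorem theorem4_general (n : ℕ) (hn : 21 ≤ n) (hr : 4 * (n % 7) ≤ n / 7) :
    (∃ C : CliqueCycle n,
      (∀ i, (C.W i).card = 8 ∨ (C.W i).card = 9) ∧
      C.graph.edgeSet.ncard ≤ 4 * n ∧
      (∀ i, MakerWinsSecond (edgeBoardOn C.graph (C.W i))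
        (fixedHamPathSets C.graph (C.W i) (C.a (i - 1)) (C.a i))) ∧
      MakerWinsFirst (edgeBoard C.graph) C.parallelSets ∧
      MakerWinsHam C.graph) ∧
    mHat n ≤ 4 * n := by
  let C : CliqueCycle n := .ofResidues (by omega)
  have hcard : C.graph.edgeSet.ncard ≤ 4 * n := C.ncard_edgeSet_le (by omega) hr
  have hham : MakerWinsHam C.graph := C.makerWinsHam (by omega)
  have hW (i : ZMod (n / 7)) : (C.W i).card = 8 ∨ (C.W i).card = 9 := by
    rw [C.card_W (by omega)]
    split_ifs <;> simp
  have hmHat : mHat n ≤ C.graph.edgeSet.ncard := Nat.sInf_le ⟨C.graph, hham, rfl⟩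
  exact ⟨⟨C, hW, hcard, C.makerWinsSecond (by omega), C.makerWinsFirst_parallel (by omega), hham⟩,
    hmHat.trans hcard⟩

theorem theorem4 (n : ℕ) (hn : 336 ≤ n) :
    (∃ C : CliqueCycle n,
      (∀ i, (C.W i).card = 8 ∨ (C.W i).card = 9) ∧
      C.graph.edgeSet.ncard ≤ 4 * n ∧
      (∀ i, MakerWinsSecond (edgeBoardOn C.graph (C.W i))
        (fixedHamPathSets C.graph (C.W i) (C.a (i - 1)) (C.a i))) ∧
      MakerWinsFirst (edgeBoard C.graph) C.parallelSets ∧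
      MakerWinsHam C.graph) ∧
    mHat n ≤ 4 * n :=
  theorem4_general n (by omega) (by omega)
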